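/- Let $k$ be an algebraically closed field of characteristic $0$. **Notation.** For a sextic $f=a_6X^6+\dots+a_0=a_6\prod_{i=1}^6(X-\alpha_i)$ write $(ij)=\alpha_i-\alpha_j$ and let $$J_2=a_6^2\sum_{15}(12)^2(34)^2(56)^2,\qquad J_4=a_6^4\sum_{10}(12)^2(23)^2(31)^2(45)^2(56)^2(64)^2,$$ $$J_6=a_6^6\sum_{60}(12)^2(23)^2(31)^2(45)^2(56)^2(64)^2(14)^2(25)^2(36)^2,\qquad J_{10}=a_6^{10}\prod_{i<j}(ij)^2$$ be its classical (Igusa–Clebsch) invariants. They are homogeneous polynomials in $a_0,\dots,a_6$, and are used also for $a_6=0$. Where $J_2\ne0$ put $$i_1=144\frac{J_4}{J_2^2},\qquad i_2=-1728\frac{J_2J_4-3J_6}{J_2^3},\qquad i_3=486\frac{J_{10}}{J_2^5}.$$ For cubics $F=a_3X^3+a_2X^2+a_1X+a_0$ and $G=b_3X^3+b_2X^2+b_1X+b_0$ with roots $\alpha_i$, respectively $\beta_j$, let $$H(F,G)=a_3b_0-\tfrac13a_2b_1+\tfrac13a_1b_2-a_0b_3,\qquad R(F,G)=a_3^3b_3^3\prod_{i,j}(\beta_j-\alpha_i),$$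 let $D$ be the discriminant of a cubic, and put $$r_1(F,G)=\frac{H(F,G)^3}{R(F,G)},\qquad r_2(F,G)=\frac{H(F,G)^4}{D(F)\,D(G)}.$$ Let $a,b$ be algebraically independent over $k$, let $u=ab$, $v=b^3$, $F=X^3+aX^2+bX+1$ and $G=4X^3+b^2X^2+2bX+1$. From now on $i_1,i_2,i_3$ are the invariants of the sextic $FG$ and $r_1,r_2$ those of the pair $(F,G)$. Let $\mathcal L_3\subset k^3$ be the set of all triples $(i_1(f),i_2(f),i_3(f))$, where $f\in k[X]$ is separable of degree $5$ or $6$, $J_2(f)\neq0$, and the genus 2 function field $K=k(X,Y)$, $Y^2=f(X)$, has an elliptic subfield $E\supset k$ with $[K:E]=3$. This is the locus of genus 2 fields having an elliptic subfield of degree 3, in the coordinates $i_1,i_2,i_3$ on the part $J_2\ne0$ of the moduli space. **Lemma.** All denominators in the definitions of $i_1,i_2,i_3,r_1,r_2$ above and in the formulas below are nonzero, and the following hold. 1. $k(i_1,i_2,i_3)=k(r_1,r_2)$. 2. With $d=-1152r_2^2+96r_2r_1+r_1^2$, $$i_1=\frac94\cdot\frac{13824r_1^3r_2^2+442368r_1^2r_2^3+5308416r_1r_2^4+192r_1^4r_2+r_1^5+786432r_1r_2^3+9437184r_2^4}{r_1d^2},$$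 $$\begin{aligned}i_2=\frac{27}{8r_1^2d^3}\bigl(&79626240r_1^4r_2^4-4076863488r_1^2r_2^5+34560r_1^6r_2^2+12230590464r_1^2r_2^6\\&+32614907904r_1r_2^6+14495514624r_2^6+288r_1^7r_2+2211840r_1^5r_2^3\\&+r_1^8-212336640r_1^3r_2^4+1528823808r_1^3r_2^5-2359296r_1^4r_2^3\bigr),\end{aligned}$$ $$i_3=-521838526464\,\frac{r_2^9}{r_1^2d^5}.$$ 3. $k(i_1,i_2,i_3)\subset k(u,v)$, the extension $k(u,v)/k(i_1,i_2,i_3)$ is Galois, $[k(u,v):k(i_1,i_2,i_3)]=2$, and its Galois group is generated by the automorphism $\beta$ of order $2$ with $$\beta(u)=\frac{(v-3u)(324u^2+15u^2v-378uv-4uv^2+243v+72v^2)}{(v-27)(4u^3+27v-18uv-u^2v+4v^2)},\qquad \beta(v)=-\frac{4(v-3u)^3}{4u^3+27v-18uv-u^2v+4v^2}.$$ 4. $r_1,r_2$ are algebraically independent over $k$, and the rational map $\rho\colon k^2\dashrightarrow k^3$, $(r_1,r_2)\mapsto(i_1,i_2,i_3)$, given by the formulas in 2 is a birational parameterization of $\mathcal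 L_3$: there is a non-empty Zariski open subset $\{g\neq 0\}$ of $k^2$ on which $\rho$ is defined, which $\rho$ maps to a Zariski dense subset of $\mathcal L_3$, and on which $\rho$ has an inverse given by rational functions of $i_1,i_2,i_3$ without poles on the image. -/

import Mathlib

noncomputable section

namespace GenusTwo

open Polynomial IntermediateField

universe u v

/-! ### Classical invariants of a binary sextic

`f` stands for the binary sextic `a₆ X⁶ + a₅ X⁵ Z + ⋯ + a₀ Z⁶` with `aᵢ = f.coeff i`
(so `a₆ = 0` is allowed: a root at infinity). -/

section Sextic

variable {K : Type u} [Field K]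

/-- The classical (Igusa–Clebsch) invariant of degree 2. For `f = a₆ ∏ (X - αᵢ)` it is
`a₆ ^ 2 * ∑ (12)²(34)²(56)²` (15 terms), where `(ij) = αᵢ - αⱼ`. -/
def J₂ (f : K[X]) : K :=
  -240 * f.coeff 0 * f.coeff 6 + 40 * f.coeff 1 * f.coeff 5 - 16 * f.coeff 2 * f.coeff 4
    + 6 * f.coeff 3 ^ 2

/-- The classical (Igusa–Clebsch) invariant of degree 4. For `f = a₆ ∏ (X - αᵢ)` it is
`a₆ ^ 4 * ∑ (12)²(23)²(31)²(45)²(56)²(64)²` (10 terms). -/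
def J₄ (f : K[X]) : K :=
  1620 * f.coeff 0 ^ 2 * f.coeff 6 ^ 2 - 540 * f.coeff 0 * f.coeff 1 * f.coeff 5 * f.coeff 6
    - 504 * f.coeff 0 * f.coeff 2 * f.coeff 4 * f.coeff 6
    + 300 * f.coeff 0 * f.coeff 2 * f.coeff 5 ^ 2 + 324 * f.coeff 0 * f.coeff 3 ^ 2 * f.coeff 6
    - 180 * f.coeff 0 * f.coeff 3 * f.coeff 4 * f.coeff 5 + 48 * f.coeff 0 * f.coeff 4 ^ 3
    + 300 * f.coeff 1 ^ 2 * f.coeff 4 * f.coeff 6 - 80 * f.coeff 1 ^ 2 * f.coeff 5 ^ 2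
    - 180 * f.coeff 1 * f.coeff 2 * f.coeff 3 * f.coeff 6
    + 4 * f.coeff 1 * f.coeff 2 * f.coeff 4 * f.coeff 5
    + 36 * f.coeff 1 * f.coeff 3 ^ 2 * f.coeff 5 - 12 * f.coeff 1 * f.coeff 3 * f.coeff 4 ^ 2
    + 48 * f.coeff 2 ^ 3 * f.coeff 6 - 12 * f.coeff 2 ^ 2 * f.coeff 3 * f.coeff 5
    + 4 * f.coeff 2 ^ 2 * f.coeff 4 ^ 2

/-- The classical (Igusa–Clebsch) invariant of degree 6. For `f = a₆ ∏ (X - αᵢ)` it is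
`a₆ ^ 6 * ∑ (12)²(23)²(31)²(45)²(56)²(64)²(14)²(25)²(36)²` (60 terms). -/
def J₆ (f : K[X]) : K :=
  -119880 * f.coeff 0 ^ 3 * f.coeff 6 ^ 3
    + 59940 * f.coeff 0 ^ 2 * f.coeff 1 * f.coeff 5 * f.coeff 6 ^ 2
    + 20664 * f.coeff 0 ^ 2 * f.coeff 2 * f.coeff 4 * f.coeff 6 ^ 2
    - 18600 * f.coeff 0 ^ 2 * f.coeff 2 * f.coeff 5 ^ 2 * f.coeff 6
    - 10044 * f.coeff 0 ^ 2 * f.coeff 3 ^ 2 * f.coeff 6 ^ 2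
    + 3060 * f.coeff 0 ^ 2 * f.coeff 3 * f.coeff 4 * f.coeff 5 * f.coeff 6
    + 2250 * f.coeff 0 ^ 2 * f.coeff 3 * f.coeff 5 ^ 3
    - 96 * f.coeff 0 ^ 2 * f.coeff 4 ^ 3 * f.coeff 6
    - 900 * f.coeff 0 ^ 2 * f.coeff 4 ^ 2 * f.coeff 5 ^ 2
    - 18600 * f.coeff 0 * f.coeff 1 ^ 2 * f.coeff 4 * f.coeff 6 ^ 2
    - 2240 * f.coeff 0 * f.coeff 1 ^ 2 * f.coeff 5 ^ 2 * f.coeff 6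
    + 3060 * f.coeff 0 * f.coeff 1 * f.coeff 2 * f.coeff 3 * f.coeff 6 ^ 2
    + 3472 * f.coeff 0 * f.coeff 1 * f.coeff 2 * f.coeff 4 * f.coeff 5 * f.coeff 6
    + 1600 * f.coeff 0 * f.coeff 1 * f.coeff 2 * f.coeff 5 ^ 3
    + 1818 * f.coeff 0 * f.coeff 1 * f.coeff 3 ^ 2 * f.coeff 5 * f.coeff 6
    - 876 * f.coeff 0 * f.coeff 1 * f.coeff 3 * f.coeff 4 ^ 2 * f.coeff 6
    - 1860 * f.coeff 0 * f.coeff 1 * f.coeff 3 * f.coeff 4 * f.coeff 5 ^ 2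
    + 616 * f.coeff 0 * f.coeff 1 * f.coeff 4 ^ 3 * f.coeff 5
    - 96 * f.coeff 0 * f.coeff 2 ^ 3 * f.coeff 6 ^ 2
    - 876 * f.coeff 0 * f.coeff 2 ^ 2 * f.coeff 3 * f.coeff 5 * f.coeff 6
    + 424 * f.coeff 0 * f.coeff 2 ^ 2 * f.coeff 4 ^ 2 * f.coeff 6
    - 640 * f.coeff 0 * f.coeff 2 ^ 2 * f.coeff 4 * f.coeff 5 ^ 2
    - 468 * f.coeff 0 * f.coeff 2 * f.coeff 3 ^ 2 * f.coeff 4 * f.coeff 6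
    + 330 * f.coeff 0 * f.coeff 2 * f.coeff 3 ^ 2 * f.coeff 5 ^ 2
    + 492 * f.coeff 0 * f.coeff 2 * f.coeff 3 * f.coeff 4 ^ 2 * f.coeff 5
    - 160 * f.coeff 0 * f.coeff 2 * f.coeff 4 ^ 4 + 162 * f.coeff 0 * f.coeff 3 ^ 4 * f.coeff 6
    - 198 * f.coeff 0 * f.coeff 3 ^ 3 * f.coeff 4 * f.coeff 5
    + 60 * f.coeff 0 * f.coeff 3 ^ 2 * f.coeff 4 ^ 3
    + 2250 * f.coeff 1 ^ 3 * f.coeff 3 * f.coeff 6 ^ 2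
    + 1600 * f.coeff 1 ^ 3 * f.coeff 4 * f.coeff 5 * f.coeff 6
    - 320 * f.coeff 1 ^ 3 * f.coeff 5 ^ 3 - 900 * f.coeff 1 ^ 2 * f.coeff 2 ^ 2 * f.coeff 6 ^ 2
    - 1860 * f.coeff 1 ^ 2 * f.coeff 2 * f.coeff 3 * f.coeff 5 * f.coeff 6
    - 640 * f.coeff 1 ^ 2 * f.coeff 2 * f.coeff 4 ^ 2 * f.coeff 6
    + 64 * f.coeff 1 ^ 2 * f.coeff 2 * f.coeff 4 * f.coeff 5 ^ 2
    + 330 * f.coeff 1 ^ 2 * f.coeff 3 ^ 2 * f.coeff 4 * f.coeff 6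
    + 176 * f.coeff 1 ^ 2 * f.coeff 3 ^ 2 * f.coeff 5 ^ 2
    + 26 * f.coeff 1 ^ 2 * f.coeff 3 * f.coeff 4 ^ 2 * f.coeff 5
    - 36 * f.coeff 1 ^ 2 * f.coeff 4 ^ 4
    + 616 * f.coeff 1 * f.coeff 2 ^ 3 * f.coeff 5 * f.coeff 6
    + 492 * f.coeff 1 * f.coeff 2 ^ 2 * f.coeff 3 * f.coeff 4 * f.coeff 6
    + 26 * f.coeff 1 * f.coeff 2 ^ 2 * f.coeff 3 * f.coeff 5 ^ 2
    + 28 * f.coeff 1 * f.coeff 2 ^ 2 * f.coeff 4 ^ 2 * f.coeff 5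
    - 198 * f.coeff 1 * f.coeff 2 * f.coeff 3 ^ 3 * f.coeff 6
    - 238 * f.coeff 1 * f.coeff 2 * f.coeff 3 ^ 2 * f.coeff 4 * f.coeff 5
    + 76 * f.coeff 1 * f.coeff 2 * f.coeff 3 * f.coeff 4 ^ 3
    + 72 * f.coeff 1 * f.coeff 3 ^ 4 * f.coeff 5 - 24 * f.coeff 1 * f.coeff 3 ^ 3 * f.coeff 4 ^ 2
    - 160 * f.coeff 2 ^ 4 * f.coeff 4 * f.coeff 6 - 36 * f.coeff 2 ^ 4 * f.coeff 5 ^ 2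
    + 60 * f.coeff 2 ^ 3 * f.coeff 3 ^ 2 * f.coeff 6
    + 76 * f.coeff 2 ^ 3 * f.coeff 3 * f.coeff 4 * f.coeff 5 - 24 * f.coeff 2 ^ 3 * f.coeff 4 ^ 3
    - 24 * f.coeff 2 ^ 2 * f.coeff 3 ^ 3 * f.coeff 5
    + 8 * f.coeff 2 ^ 2 * f.coeff 3 ^ 2 * f.coeff 4 ^ 2

/-- The discriminant of the binary sextic, in characteristic zero: for a binary form of degree `6`,
`6 ^ 4 * Disc = -Res (∂f/∂X, ∂f/∂Z)`, and at `Z = 1` the two partial derivatives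
(binary quintics) are `f'` and `6 f - X f'`.
For `f = a₆ ∏ (X - αᵢ)` it is `a₆ ^ 10 * ∏_{i < j} (αᵢ - αⱼ)²`. -/
def J₁₀ (f : K[X]) : K :=
  -(resultant (derivative f) (6 * f - X * derivative f) 5 5) / 6 ^ 4

/-- The absolute invariant `i₁` of the sextic `f`. -/
def absInv₁ (f : K[X]) : K := 144 * J₄ f / J₂ f ^ 2

/-- The absolute invariant `i₂` of the sextic `f`. -/
def absInv₂ (f : K[X]) : K := -1728 * (J₂ f * J₄ f - 3 * J₆ f) / J₂ f ^ 3

/-- The absolute invariant `i₃` of the sextic `f`. -/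
def absInv₃ (f : K[X]) : K := 486 * J₁₀ f / J₂ f ^ 5

/-! ### Invariants of a pair of cubics -/

/-- The bilinear invariant `H(F, G)` of two cubics. -/
def cubicH (F G : K[X]) : K :=
  F.coeff 3 * G.coeff 0 - 1 / 3 * F.coeff 2 * G.coeff 1 + 1 / 3 * F.coeff 1 * G.coeff 2
    - F.coeff 0 * G.coeff 3

/-- The resultant `R(F, G)` of two cubics, with the sign convention
`R(F, G) = a₃ ^ 3 * b₃ ^ 3 * ∏ (βⱼ - αᵢ)`, where `αᵢ`, `βⱼ` are the roots of `F`, `G`. -/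
def cubicR (F G : K[X]) : K := resultant G F 3 3

/-- The invariant `r₁(F, G) = H ^ 3 / R`. -/
def pairInv₁ (F G : K[X]) : K := cubicH F G ^ 3 / cubicR F G

/-- The invariant `r₂(F, G) = H ^ 4 / (D(F) D(G))`. -/
def pairInv₂ (F G : K[X]) : K := cubicH F G ^ 4 / (discr F * discr G)

/-! ### The rational functions expressing `i₁, i₂, i₃` through `r₁, r₂` -/

/-- The factor of the denominators of the three rational functions. -/
def rhoDen (r₁ r₂ : K) : K := -1152 * r₂ ^ 2 + 96 * r₂ * r₁ + r₁ ^ 2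

/-- `i₁` as a rational function of `r₁, r₂`. -/
def rho₁ (r₁ r₂ : K) : K :=
  9 / 4 * (13824 * r₁ ^ 3 * r₂ ^ 2 + 442368 * r₁ ^ 2 * r₂ ^ 3 + 5308416 * r₁ * r₂ ^ 4
    + 192 * r₁ ^ 4 * r₂ + r₁ ^ 5 + 786432 * r₁ * r₂ ^ 3 + 9437184 * r₂ ^ 4)
    / (r₁ * rhoDen r₁ r₂ ^ 2)

/-- `i₂` as a rational function of `r₁, r₂`. -/
def rho₂ (r₁ r₂ : K) : K :=
  27 / (8 * r₁ ^ 2 * rhoDen r₁ r₂ ^ 3) * (79626240 * r₁ ^ 4 * r₂ ^ 4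
    - 4076863488 * r₁ ^ 2 * r₂ ^ 5 + 34560 * r₁ ^ 6 * r₂ ^ 2 + 12230590464 * r₁ ^ 2 * r₂ ^ 6
    + 32614907904 * r₁ * r₂ ^ 6 + 14495514624 * r₂ ^ 6 + 288 * r₁ ^ 7 * r₂
    + 2211840 * r₁ ^ 5 * r₂ ^ 3 + r₁ ^ 8 - 212336640 * r₁ ^ 3 * r₂ ^ 4
    + 1528823808 * r₁ ^ 3 * r₂ ^ 5 - 2359296 * r₁ ^ 4 * r₂ ^ 3)

/-- `i₃` as a rational function of `r₁, r₂`. -/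
def rho₃ (r₁ r₂ : K) : K :=
  -521838526464 * (r₂ ^ 9 / (r₁ ^ 2 * rhoDen r₁ r₂ ^ 5))

/-- The map `(r₁, r₂) ↦ (i₁, i₂, i₃)` on points. -/
def rho (p : Fin 2 → K) : Fin 3 → K :=
  ![rho₁ (p 0) (p 1), rho₂ (p 0) (p 1), rho₃ (p 0) (p 1)]

/-! ### The involution `β` -/

/-- A factor of the denominators of `β(u)` and `β(v)`. -/
def betaDen (u v : K) : K := 4 * u ^ 3 + 27 * v - 18 * u * v - u ^ 2 * v + 4 * v ^ 2

/-- The image of `u` under `β`. -/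
def betaU (u v : K) : K :=
  (v - 3 * u) * (324 * u ^ 2 + 15 * u ^ 2 * v - 378 * u * v - 4 * u * v ^ 2 + 243 * v
    + 72 * v ^ 2) / ((v - 27) * betaDen u v)

/-- The image of `v` under `β`. -/
def betaV (u v : K) : K := -(4 * (v - 3 * u) ^ 3) / betaDen u v

end Sextic

/-! ### The generic pair of cubics and its fields of invariants -/

section Generic

variable {L : Type v} [Field L]

/-- The cubic `F = X³ + a X² + b X + 1`. -/
def cubicF (a b : L) : L[X] := X ^ 3 + C a * X ^ 2 + C b * X + 1

/-- The cubic `G = 4 X³ + b² X² + 2 b X + 1`. -/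
def cubicG (b : L) : L[X] := C 4 * X ^ 3 + C (b ^ 2) * X ^ 2 + C (2 * b) * X + 1

/-- The sextic `F G` of the normal form `Y² = F(X) G(X)`. -/
def sextic (a b : L) : L[X] := cubicF a b * cubicG b

variable (k : Type u) [Field k] [Algebra k L]

/-- The field `k(u, v)` with `u = a b` and `v = b³`. -/
def fieldUV (a b : L) : IntermediateField k L := adjoin k {a * b, b ^ 3}

/-- The field `k(i₁, i₂, i₃)` generated by the absolute invariants of `F G`. -/
def fieldI (a b : L) : IntermediateField k L :=
  adjoin k {absInv₁ (sextic a b), absInv₂ (sextic a b), absInv₃ (sextic a b)}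

/-- The field `k(r₁, r₂)` generated by the invariants of the pair `F, G`. -/
def fieldR (a b : L) : IntermediateField k L :=
  adjoin k {pairInv₁ (cubicF a b) (cubicG b), pairInv₂ (cubicF a b) (cubicG b)}

theorem u_mem (a b : L) : a * b ∈ fieldUV k a b :=
  subset_adjoin _ _ (by simp)

theorem v_mem (a b : L) : b ^ 3 ∈ fieldUV k a b :=
  subset_adjoin _ _ (by simp)

end Generic

/-! ### The locus of genus 2 fields with an elliptic subfield of degree 3 -/

section Locus

variable {k : Type u} [Field k] {K : Type v} [Field K] [Algebra k K]

/-- `K = k(x, y)` is the function field of the genus 2 curve `y² = f(x)`: `x` is transcendental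
over `k`, and `f` is separable of degree 5 or 6. Over an algebraically closed field of
characteristic 0, the genus 2 function fields are exactly the fields `K` with such a model. -/
structure IsGenusTwoModel (f : k[X]) (x y : K) : Prop where
  separable : f.Separable
  natDegree_eq : f.natDegree = 5 ∨ f.natDegree = 6
  transcendental : Transcendental k x
  equation : y ^ 2 = aeval x f
  adjoin_eq_top : adjoin k {x, y} = ⊤

/-- The intermediate field `E` is an elliptic function field over `k`: `E = k(s, t)` with `s`
transcendental over `k` and `t² = g(s)` for a separable cubic `g`. -/
def IsEllipticSubfield (E : IntermediateField k K) : Prop :=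
  ∃ (g : k[X]) (s t : K), g.Separable ∧ g.natDegree = 3 ∧ Transcendental k s ∧
    t ^ 2 = aeval s g ∧ adjoin k {s, t} = E

/-- `K` has an elliptic subfield of degree 3. -/
def HasDegreeThreeEllipticSubfield (k : Type u) [Field k] (K : Type v) [Field K] [Algebra k K] :
    Prop :=
  ∃ E : IntermediateField k K, IsEllipticSubfield E ∧ Module.finrank E K = 3

/-- The locus `L₃` of genus 2 fields having an elliptic subfield of degree 3, in the coordinates
`(i₁, i₂, i₃)` on the part `J₂ ≠ 0` of the moduli space, where these coordinates are defined and
determine the genus 2 field up to isomorphism. -/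
def locusL₃ (k : Type u) [Field k] : Set (Fin 3 → k) :=
  {p | ∃ (K : Type u) (_ : Field K) (_ : Algebra k K) (f : k[X]) (x y : K),
    IsGenusTwoModel f x y ∧ HasDegreeThreeEllipticSubfield k K ∧
    J₂ f ≠ 0 ∧ p = ![absInv₁ f, absInv₂ f, absInv₃ f]}

/-- The map `φ` is a birational parameterization of the locus `S ⊆ kⁿ` by the affine space `kᵐ`:
on some non-empty Zariski open subset `{g ≠ 0}` of `kᵐ`, the map `φ` is given by rational functions
without poles, it takes values in `S`, its image is Zariski dense in `S`, and it has an inverse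
given by rational functions that have no poles on the image. -/
def IsBirationalParameterization {m n : ℕ} (φ : (Fin m → k) → (Fin n → k))
    (S : Set (Fin n → k)) : Prop :=
  ∃ g : MvPolynomial (Fin m) k, g ≠ 0 ∧
    (∃ N D : Fin n → MvPolynomial (Fin m) k, ∀ p, MvPolynomial.eval p g ≠ 0 → ∀ j,
      MvPolynomial.eval p (D j) ≠ 0 ∧
      φ p j = MvPolynomial.eval p (N j) / MvPolynomial.eval p (D j)) ∧
    (∀ p, MvPolynomial.eval p g ≠ 0 → φ p ∈ S) ∧
    (∀ P : MvPolynomial (Fin n) k,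
      (∀ p, MvPolynomial.eval p g ≠ 0 → MvPolynomial.eval (φ p) P = 0) →
      ∀ q ∈ S, MvPolynomial.eval q P = 0) ∧
    (∃ A B : Fin m → MvPolynomial (Fin n) k, ∀ p, MvPolynomial.eval p g ≠ 0 → ∀ j,
      MvPolynomial.eval (φ p) (B j) ≠ 0 ∧
      p j = MvPolynomial.eval (φ p) (A j) / MvPolynomial.eval (φ p) (B j))

end Locus

end GenusTwo

end

open GenusTwo

open GenusTwo Polynomial IntermediateField

/-! ### Invariants of the generic sextic as polynomials in three quantities -/

section Formulas
variable {K : Type*} [Field K]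

/-! Put `m = v - 2u - 9`, `n = v - 27`, and let `R` be the resultant of `F` and `G`, which is also
minus the discriminant of `F`. With weights 1, 1, 3 for `m, n, R`, the invariants `J₂, J₄, J₆, J₁₀`
of `F G` are isobaric polynomials in `m, n, R`, while `r₁ = m³ / (27 R)` and `r₂ = -m⁴ / (1296 R
n)`. The absolute invariants have weight zero, so they are functions of `m / n` and `m³ / R`, that
is, of `r₁, r₂`; the formulas `rho₁, rho₂, rho₃` follow by substitution.

That `r₁, r₂` are rational in the `iⱼ` is proved without inverting the formulas. In the parameters
`y = m / (m - n)` and `T = 192 R / (m - n)³`, `y` is integral over a localization of the algebra of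
invariants, and near `(y, T) = (1, -4)` the element `y - 1` lies in the ideal generated by two
invariants that vanish there. Nakayama's lemma then makes `y` a fraction of invariants
(`exists_mul_eq_algebraMap`, `mem_adjoin_of_parameters`), and `T` follows linearly.

For the Galois statement, `d = 1 - m / n` lies in `k(r₁, r₂)`, `u` is affine in `v` over `k(d)`, and
`n` is a root of a quadratic over `k(r₁, r₂)` whose other root is `β(v) - 27`. The degree is not 1,
because substituting `β(u), β(v)` is an embedding of `k(u, v)` that fixes `r₁, r₂` and moves `v`.

Points of the image of `rho` lie in the locus because `X² / F` induces an explicit elliptic subfield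
of degree 3. For density, let `K` have such a subfield. A translation by a constant point makes the
hyperelliptic involution act on the generic point of the elliptic curve as negation; this uses
halving of points over `k` and the absence of non-constant points over `k(x)`, a Wronskian argument.
The result is a cubic map `P / Q` such that `f S²` is a product of four members of its pencil. In
general position a degree count shows that exactly three of the four have a double root. Moving
these roots to `0, ∞, 1` gives a family over an affine space (`ramifiedSextic`), whose generic
member has the invariants of some `F G`. A polynomial relation valid on the image of `rho` therefore
holds for all `F G`, then for the whole family, then on the locus. -/

theorem coeff_cubicF (a b : K) : (cubicF a b).coeff 0 = 1 ∧ (cubicF a b).coeff 1 = b ∧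
    (cubicF a b).coeff 2 = a ∧ (cubicF a b).coeff 3 = 1 := by
  simp [cubicF, coeff_X, coeff_one, coeff_X_pow]

theorem coeff_cubicG (b : K) : (cubicG b).coeff 0 = 1 ∧ (cubicG b).coeff 1 = 2 * b ∧
    (cubicG b).coeff 2 = b ^ 2 ∧ (cubicG b).coeff 3 = 4 := by
  refine ⟨?_, ?_, ?_, ?_⟩ <;> simp [cubicG, coeff_X, coeff_one, coeff_X_pow, -map_mul, -map_pow]

theorem natDegree_cubicF (a b : K) : (cubicF a b).natDegree = 3 := by
  unfold cubicF; compute_degree!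

theorem natDegree_cubicG [CharZero K] (b : K) : (cubicG b).natDegree = 3 := by
  unfold cubicG; compute_degree!

theorem degree_cubicF (a b : K) : (cubicF a b).degree = 3 := by
  unfold cubicF; compute_degree!

theorem degree_cubicG [CharZero K] (b : K) : (cubicG b).degree = 3 := by
  unfold cubicG; compute_degree!

theorem sextic_eq (a b : K) : sextic a b = C 4 * X ^ 6 + C (b ^ 2 + 4 * a) * X ^ 5
    + C (6 * b + a * b ^ 2) * X ^ 4 + C (5 + 2 * a * b + b ^ 3) * X ^ 3
    + C (a + 3 * b ^ 2) * X ^ 2 + C (3 * b) * X + C 1 := by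
  simp only [sextic, cubicF, cubicG, map_add, map_mul, map_pow, map_ofNat, map_one]
  ring

theorem coeff_sextic (a b : K) : (sextic a b).coeff 0 = 1 ∧ (sextic a b).coeff 1 = 3 * b ∧
    (sextic a b).coeff 2 = a + 3 * b ^ 2 ∧ (sextic a b).coeff 3 = 5 + 2 * a * b + b ^ 3 ∧
    (sextic a b).coeff 4 = 6 * b + a * b ^ 2 ∧ (sextic a b).coeff 5 = b ^ 2 + 4 * a ∧
    (sextic a b).coeff 6 = 4 := by
  rw [sextic_eq]
  refine ⟨?_, ?_, ?_, ?_, ?_, ?_, ?_⟩ <;>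
    simp only [coeff_add, coeff_C_mul, coeff_X_pow, coeff_X, coeff_C] <;> norm_num

/-- The resultant of `F` and `G`; it is also `-disc F`. -/
def resFG (a b : K) : K := 4 * a ^ 3 + 4 * b ^ 3 + 27 - 18 * a * b - a ^ 2 * b ^ 2

theorem discr_cubicF (a b : K) : (cubicF a b).discr = -resFG a b := by
  obtain ⟨h0, h1, h2, h3⟩ := coeff_cubicF a b
  rw [discr_of_degree_eq_three (degree_cubicF a b), h0, h1, h2, h3, resFG]; ring

theorem discr_cubicG [CharZero K] (b : K) : (cubicG b).discr = 16 * (b ^ 3 - 27) := by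
  obtain ⟨h0, h1, h2, h3⟩ := coeff_cubicG b
  rw [discr_of_degree_eq_three (degree_cubicG b), h0, h1, h2, h3]; ring

theorem cubicH_eq [CharZero K] (a b : K) :
    cubicH (cubicF a b) (cubicG b) = (b ^ 3 - 2 * (a * b) - 9) / 3 := by
  obtain ⟨h0, h1, h2, h3⟩ := coeff_cubicG b
  obtain ⟨k0, k1, k2, k3⟩ := coeff_cubicF a b
  rw [cubicH, h0, h1, h2, h3, k0, k1, k2, k3]; field_simp; ring

/-- Here `m` is three times `H(F, G)` and `n` is a sixteenth of the discriminant of `G`. Expressing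
the invariants through `m, n, R` keeps the later verifications of `rho₁, rho₂, rho₃` small. -/
theorem J₂_sextic (a b : K) (m n : K) (hm : m = b ^ 3 - 2 * (a * b) - 9) (hn : n = b ^ 3 - 27) :
    J₂ (sextic a b) = -2 * (2 * n ^ 2 - 4 * m * n - m ^ 2) := by
  obtain ⟨h0, h1, h2, h3, h4, h5, h6⟩ := coeff_sextic a b
  rw [J₂, h0, h1, h2, h3, h4, h5, h6, hm, hn]; ring

theorem J₄_sextic (a b : K) (m n : K) (hm : m = b ^ 3 - 2 * (a * b) - 9) (hn : n = b ^ 3 - 27) :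
    4 * J₄ (sextic a b) = (n - m) ^ 4 - 48 * resFG a b * (4 * n - m) := by
  obtain ⟨h0, h1, h2, h3, h4, h5, h6⟩ := coeff_sextic a b
  rw [J₄, h0, h1, h2, h3, h4, h5, h6, hm, hn, resFG]; ring

theorem J₆_sextic (a b : K) (m n : K) (hm : m = b ^ 3 - 2 * (a * b) - 9) (hn : n = b ^ 3 - 27) :
    24 * J₆ (sextic a b) = -4 * (2 * n ^ 2 - 4 * m * n - m ^ 2) *
      ((n - m) ^ 4 - 48 * resFG a b * (4 * n - m)) - ((n - m) ^ 6 + resFG a b *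
        (576 * n ^ 3 - 1080 * m * n ^ 2 + 432 * m ^ 2 * n + 72 * m ^ 3) + 864 * resFG a b ^ 2) := by
  obtain ⟨h0, h1, h2, h3, h4, h5, h6⟩ := coeff_sextic a b
  rw [J₆, h0, h1, h2, h3, h4, h5, h6, hm, hn, resFG]; ring

/-- The quadratic form on the right is `-J₂ / 2`, so as long as `m`, `n`, `R` are nonzero the poles
of the formulas at `rhoDen = 0` are exactly the zeros of `J₂`. -/
theorem rhoDen_eq [CharZero K] (m n R : K) (hm : m ≠ 0) (hn : n ≠ 0) (hR : R ≠ 0) :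
    rhoDen (m ^ 3 / (27 * R)) (m ^ 4 / (-1296 * R * n)) =
      m ^ 6 * (2 * n ^ 2 - 4 * m * n - m ^ 2) / (1458 * R ^ 2 * n ^ 2) := by
  rw [rhoDen]; field_simp; ring

end Formulas

/-! ### Resultants, the discriminant of a product, and the three formulas -/

section Formulas
variable {K : Type*} [Field K]

/-- Modulo `F` the derivative of `F G` is `F' G`, and the resultant is multiplicative. The remaining
work reconciles formal degrees, since `F'` is only known to have degree at most 2. -/
theorem resultant_derivative_mul (F G : K[X]) (hF : F.natDegree = 3) (hG : G.natDegree = 3) :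
    resultant (derivative (F * G)) F 5 3 = resultant (derivative F) F 2 3 * resultant G F 3 3 := by
  have h1 : derivative (F * G) = derivative F * G + F * derivative G := derivative_mul
  have hG' : (derivative G).natDegree ≤ 2 := (natDegree_derivative_le G).trans (by omega)
  have hF' : (derivative F).natDegree ≤ 2 := (natDegree_derivative_le F).trans (by omega)
  rw [h1, resultant_add_mul_left _ _ _ _ _ (by omega) hF.le]
  have h2 := resultant_mul_right F (derivative F) G 3 hF.le
  rw [hG] at h2
  obtain ⟨k, hk⟩ := Nat.exists_eq_add_of_le hF'
  rw [resultant_comm, resultant_comm (derivative F), resultant_comm G]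
  have h3 := resultant_add_right_deg F (derivative F) 3 _ k le_rfl
  have h4 := resultant_add_right_deg F (derivative F * G) 3 _ k
    (natDegree_mul_le.trans (by rw [hG]) : (derivative F * G).natDegree ≤
      (derivative F).natDegree + 3)
  rw [← hk] at h3
  rw [show (derivative F).natDegree + 3 + k = 5 by omega] at h4
  rw [h4, h3, h2]
  ring

theorem resultant_derivative_self_three (F : K[X]) (hF : F.natDegree = 3) :
    resultant (derivative F) F 2 3 = -(F.leadingCoeff * F.discr) := by
  have h := resultant_deriv (f := F) (by rw [← natDegree_pos_iff_degree_pos]; omega)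
  rw [hF] at h
  rw [resultant_comm, h]; norm_num

/-- Adding `X f'` to `6 f - X f'` does not change the resultant with `f'`; passing between formal
degrees 6 and 5 costs the top coefficient `6 a₆` of `f'`. -/
theorem J₁₀_mul_leadingCoeff [CharZero K] (f : K[X]) (hf : f.natDegree = 6) :
    J₁₀ f * f.coeff 6 = -resultant (derivative f) f 5 6 := by
  have hd : (derivative f).natDegree ≤ 5 := (natDegree_derivative_le f).trans (by omega)
  have hdeg : (6 * f - X * derivative f).natDegree ≤ 5 := by
    rw [natDegree_le_iff_coeff_eq_zero]
    rintro (_ | N) hN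
    · omega
    · rw [coeff_sub, coeff_X_mul, coeff_derivative, show (6 : K[X]) = C 6 from (map_ofNat C 6).symm, coeff_C_mul]
      by_cases h : N = 5
      · subst h; norm_num; ring
      · rw [coeff_eq_zero_of_natDegree_lt (p := f) (by omega)]; ring
  have h1 := resultant_add_right_deg (derivative f) (6 * f - X * derivative f) 5 5 1 hdeg
  have h2 := resultant_add_mul_right (derivative f) (C 6 * f) (-X) 5 6 (by simp) hd
  rw [show C 6 * f + derivative f * -X = 6 * f - X * derivative f by
    simp only [map_ofNat]; ring, h1, resultant_C_mul_right, coeff_derivative] at h2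
  rw [J₁₀]
  have h3 : f.coeff 6 * (((5 : ℕ) : K) + 1) = 6 * f.coeff 6 := by push_cast; ring
  rw [h3, pow_one] at h2
  field_simp
  linear_combination -h2 / 6

theorem J₁₀_mul [CharZero K] (F G : K[X]) (hF : F.natDegree = 3) (hG : G.natDegree = 3) :
    J₁₀ (F * G) = F.discr * G.discr * cubicR F G ^ 2 := by
  have hF0 : F ≠ 0 := by rintro rfl; simp at hF
  have hG0 : G ≠ 0 := by rintro rfl; simp at hG
  have hdeg : (F * G).natDegree = 6 := by rw [natDegree_mul hF0 hG0, hF, hG]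
  have hlead : (F * G).coeff 6 = F.leadingCoeff * G.leadingCoeff := by
    rw [← leadingCoeff_mul, leadingCoeff, hdeg]
  have h := J₁₀_mul_leadingCoeff (F * G) hdeg
  have h1 := resultant_mul_right (derivative (F * G)) F G 5
    ((natDegree_derivative_le _).trans (by omega))
  rw [hF, hG, resultant_derivative_mul F G hF hG, mul_comm F G,
    resultant_derivative_mul G F hG hF, mul_comm G F, resultant_derivative_self_three F hF,
    resultant_derivative_self_three G hG, resultant_comm F G] at h1
  rw [h1, hlead] at h
  have hne : F.leadingCoeff * G.leadingCoeff ≠ 0 :=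
    mul_ne_zero (leadingCoeff_ne_zero.2 hF0) (leadingCoeff_ne_zero.2 hG0)
  apply mul_right_cancel₀ hne
  rw [h, cubicR]
  norm_num
  ring

theorem cubicR_eq [CharZero K] (a b : K) : cubicR (cubicF a b) (cubicG b) = resFG a b := by
  -- Removing `4 F` from `G` leaves a quadratic, which reduces the Sylvester determinant to size 5.
  have hsub : cubicG b = (C (b ^ 2 - 4 * a) * X ^ 2 + C (-2 * b) * X + C (-3))
      + cubicF a b * C 4 := by
    simp only [cubicF, cubicG, map_sub, map_mul, map_pow, map_ofNat, map_neg]; ring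
  have hd : (C (b ^ 2 - 4 * a) * X ^ 2 + C (-2 * b) * X + C (-3)).natDegree ≤ 2 := by
    compute_degree!
  have hdrop := resultant_add_left_deg _ (cubicF a b) 2 3 1 hd
  rw [cubicR, hsub, resultant_add_mul_left _ _ _ _ _ (by simp) (natDegree_cubicF a b).le]
  refine hdrop.trans ?_
  obtain ⟨h0, h1, h2, h3⟩ := coeff_cubicF a b
  set q := (C (b ^ 2 - 4 * a) * X ^ 2 + C (-2 * b) * X + C (-3)) with hq
  have q0 : q.coeff 0 = -3 := by
    simp only [hq, coeff_add, coeff_C_mul, coeff_X_pow, coeff_X, coeff_C]; norm_num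
  have q1 : q.coeff 1 = -2 * b := by
    simp only [hq, coeff_add, coeff_C_mul, coeff_X_pow, coeff_X, coeff_C]; norm_num
  have q2 : q.coeff 2 = b ^ 2 - 4 * a := by
    simp only [hq, coeff_add, coeff_C_mul, coeff_X_pow, coeff_X, coeff_C]; norm_num
  have : sylvester q (cubicF a b) 2 3 = !![1, 0, -3, 0, 0; b, 1, -2*b, -3, 0;
      a, b, b^2-4*a, -2*b, -3; 1, a, 0, b^2-4*a, -2*b; 0, 1, 0, 0, b^2-4*a] := by
    ext i j
    fin_cases i <;> fin_cases j <;>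
      simp [sylvester, Fin.addCases, h0, h1, h2, h3, q0, q1, q2, Fin.castLT, Fin.subNat]
  rw [resultant, this, h3, resFG]
  simp [Matrix.det_succ_row_zero, Fin.sum_univ_succ, Fin.succAbove]
  ring

theorem J₁₀_sextic [CharZero K] (a b : K) :
    J₁₀ (sextic a b) = -16 * (b ^ 3 - 27) * resFG a b ^ 3 := by
  rw [sextic, J₁₀_mul _ _ (natDegree_cubicF a b) (natDegree_cubicG b), discr_cubicF, discr_cubicG,
    cubicR_eq]; ring

variable [CharZero K] (a b : K) (hm : b ^ 3 - 2 * (a * b) - 9 ≠ 0) (hn : b ^ 3 - 27 ≠ 0)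
  (hR : resFG a b ≠ 0)

theorem pairInv₁_eq : pairInv₁ (cubicF a b) (cubicG b) =
    (b ^ 3 - 2 * (a * b) - 9) ^ 3 / (27 * resFG a b) := by
  rw [pairInv₁, cubicH_eq, cubicR_eq]; rw [div_pow, div_div]; norm_num

theorem pairInv₂_eq : pairInv₂ (cubicF a b) (cubicG b) =
    (b ^ 3 - 2 * (a * b) - 9) ^ 4 / (-1296 * resFG a b * (b ^ 3 - 27)) := by
  rw [pairInv₂, cubicH_eq, discr_cubicF, discr_cubicG, div_pow, div_div]; congr 1; ring

theorem rho₁_sextic (hJ : J₂ (sextic a b) ≠ 0) (hm : b ^ 3 - 2 * (a * b) - 9 ≠ 0)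
    (hn : b ^ 3 - 27 ≠ 0) (hR : resFG a b ≠ 0) : absInv₁ (sextic a b) =
      rho₁ (pairInv₁ (cubicF a b) (cubicG b)) (pairInv₂ (cubicF a b) (cubicG b)) := by
  rw [pairInv₁_eq, pairInv₂_eq, rho₁, absInv₁]
  have h2 := J₂_sextic a b _ _ rfl rfl
  have h4 := J₄_sextic a b _ _ rfl rfl
  generalize b ^ 3 - 2 * (a * b) - 9 = m at *
  generalize b ^ 3 - 27 = n at *
  generalize resFG a b = R at *
  have hq : 2 * n ^ 2 - 4 * m * n - m ^ 2 ≠ 0 := by rintro h; simp [h2, h] at hJ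
  rw [rhoDen_eq m n R hm hn hR, h2, eq_div_of_mul_eq (by norm_num) ((mul_comm _ _).trans h4)]
  field_simp
  ring

theorem rho₂_sextic (hJ : J₂ (sextic a b) ≠ 0) (hm : b ^ 3 - 2 * (a * b) - 9 ≠ 0)
    (hn : b ^ 3 - 27 ≠ 0) (hR : resFG a b ≠ 0) : absInv₂ (sextic a b) =
      rho₂ (pairInv₁ (cubicF a b) (cubicG b)) (pairInv₂ (cubicF a b) (cubicG b)) := by
  rw [pairInv₁_eq, pairInv₂_eq, rho₂, absInv₂]
  have h2 := J₂_sextic a b _ _ rfl rfl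
  have h4 := J₄_sextic a b _ _ rfl rfl
  have h6 := J₆_sextic a b _ _ rfl rfl
  generalize b ^ 3 - 2 * (a * b) - 9 = m at *
  generalize b ^ 3 - 27 = n at *
  generalize resFG a b = R at *
  have hq : 2 * n ^ 2 - 4 * m * n - m ^ 2 ≠ 0 := by rintro h; simp [h2, h] at hJ
  rw [rhoDen_eq m n R hm hn hR, h2, eq_div_of_mul_eq (by norm_num) ((mul_comm _ _).trans h4),
    eq_div_of_mul_eq (by norm_num) ((mul_comm _ _).trans h6)]
  field_simp
  ring

theorem rho₃_sextic (hJ : J₂ (sextic a b) ≠ 0) (hm : b ^ 3 - 2 * (a * b) - 9 ≠ 0)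
    (hn : b ^ 3 - 27 ≠ 0) (hR : resFG a b ≠ 0) : absInv₃ (sextic a b) =
      rho₃ (pairInv₁ (cubicF a b) (cubicG b)) (pairInv₂ (cubicF a b) (cubicG b)) := by
  rw [pairInv₁_eq, pairInv₂_eq, rho₃, absInv₃, J₁₀_sextic]
  have h2 := J₂_sextic a b _ _ rfl rfl
  generalize b ^ 3 - 2 * (a * b) - 9 = m at *
  generalize b ^ 3 - 27 = n at *
  generalize resFG a b = R at *
  have hq : 2 * n ^ 2 - 4 * m * n - m ^ 2 ≠ 0 := by rintro h; simp [h2, h] at hJ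
  rw [rhoDen_eq m n R hm hn hR, h2]
  field_simp
  ring

end Formulas

/-! ### Tools for algebraic independence -/

open scoped algebraAdjoinAdjoin in
theorem isAlgebraic_algebra_adjoin {k L : Type*} [Field k] [Field L] [Algebra k L] {s : Set L}
    {x : L} (h : IsAlgebraic (adjoin k s) x) : IsAlgebraic (Algebra.adjoin k s) x :=
  (IsFractionRing.isAlgebraic_iff (Algebra.adjoin k s) (adjoin k s) L).2 h

open AlgebraicIndependent in
-- In the matroid of algebraic independence, the closure of the at most two values of `y` contains
-- an independent pair, so its rank is two; hence `y` is injective and its values are independent.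
theorem algebraicIndependent_of_isAlgebraic {k L : Type*} [Field k] [Field L] [Algebra k L]
    {x y : Fin 2 → L} (hx : AlgebraicIndependent k x)
    (h : ∀ i, IsAlgebraic (adjoin k (Set.range y)) (x i)) : AlgebraicIndependent k y := by
  have hsub : Set.range x ⊆ (matroid k L).closure (Set.range y) := by
    rw [matroid_closure_eq]
    rintro _ ⟨i, rfl⟩
    exact isAlgebraic_algebra_adjoin (h i)
  have hind : (matroid k L).Indep (Set.range x) := matroid_indep_iff.2 hx.to_subtype_range
  have h1 := hind.encard_le_eRk_of_subset hsub
  rw [Matroid.eRk_closure_eq] at h1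
  have h2 := (matroid k L).eRk_le_encard (Set.range y)
  have h3 : (Set.range y).encard ≤ 2 := by
    rw [← Set.image_univ]; refine (Set.encard_image_le _ _).trans ?_; simp
  replace h1 := (by simpa using hx.injective.encard_range : (2 : ℕ∞) ≤ (Set.range x).encard).trans h1
  have h5 : (matroid k L).Indep (Set.range y) :=
    (Matroid.indep_iff_eRk_eq_encard_of_finite (Set.finite_range y)).2 (le_antisymm h2 (h3.trans h1))
  have h6 : Function.Injective y := by
    have : (Set.univ : Set (Fin 2)).encard ≤ (y '' Set.univ).encard := by
      rw [Set.image_univ]; simpa using h1.trans h2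
    have := Set.finite_univ.injOn_of_encard_image_eq
      (le_antisymm (Set.encard_image_le _ _) this)
    exact Set.injOn_univ.1 this
  exact .of_subtype_range h6 (matroid_indep_iff.1 h5)

/-- Generic non-vanishing is certified by one rational point, which turns it into a numerical check.
-/
theorem aeval_ne_zero_of_eval_ne_zero {k L : Type*} [Field k] [Field L] [Algebra k L]
    {ι : Type*} {x : ι → L} (hx : AlgebraicIndependent k x) {P : MvPolynomial ι k} (p : ι → k)
    (h : MvPolynomial.eval p P ≠ 0) : MvPolynomial.aeval x P ≠ 0 := by
  intro h0
  rw [(injective_iff_map_eq_zero _).1 hx P h0] at h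
  simp at h

/-! ### The quadratic equation behind the involution -/

section Involution
variable {L : Type*} [Field L]

/-- The invariant `r₁` as a function of `u, v`. -/
def invUV₁ (u v : L) : L := (v - 2 * u - 9) ^ 3 * v / (27 * betaDen u v)

/-- The invariant `r₂` as a function of `u, v`. -/
def invUV₂ (u v : L) : L := -((v - 2 * u - 9) ^ 4 * v) / (1296 * betaDen u v * (v - 27))

/-- The linear polynomial over `k(r₁, r₂)` in `n = v - 27` with
`betaDen u v = n ^ 2 * (linear polynomial)`, in terms of `d = (2 u - 18) / n`. -/
def betaLin (d n : L) : L := d ^ 2 * (2 * d - 1) / 4 * n + (9 * d - 4) ^ 2 / 4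

theorem betaV_sub (u v : L) (hB : betaDen u v ≠ 0) :
    betaV u v - 27 = -(v * (9 * u - 2 * v - 27) ^ 2) / betaDen u v := by
  rw [betaV]; field_simp; rw [betaDen]; ring

variable [CharZero L]

/-- In the coordinates `d, n` one has `m = (1 - d) n`. Since `betaDen` is `n²` times a polynomial
linear in `n`, the equation expressing `r₁` becomes quadratic in `n` once `d` is regarded as a
constant. -/
theorem betaDen_eq_betaLin (d n : L) :
    betaDen ((d * n + 18) / 2) (n + 27) = n ^ 2 * betaLin d n := by
  simp only [betaDen, betaLin]; field_simp; ring

theorem invUV₁_eq_betaLin (d n : L) (hn : n ≠ 0) :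
    invUV₁ ((d * n + 18) / 2) (n + 27) = (1 - d) ^ 3 * n * (n + 27) / (27 * betaLin d n) := by
  rw [invUV₁, betaDen_eq_betaLin]
  rw [show n + 27 - 2 * ((d * n + 18) / 2) - 9 = (1 - d) * n by ring]
  field_simp

/-- The ratio `r₂ / r₁` is `-m / (48 n)`; equivalently `d = 1 + 48 r₂ / r₁`, which places `d` in
`k(r₁, r₂)`. -/
theorem invUV₂_eq (u v : L) (hn : v - 27 ≠ 0) :
    invUV₂ u v = -(invUV₁ u v * (1 - (2 * u - 18) / (v - 27)) / 48) := by
  rw [invUV₁, invUV₂]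
  rw [show (1 - (2 * u - 18) / (v - 27)) = (v - 2 * u - 9) / (v - 27) by field_simp; ring]
  by_cases hB : betaDen u v = 0
  · simp [hB]
  field_simp; ring

/-- The involution fixes `d`, so `β(u)` is determined by `β(v)` through the same affine relation
that ties `u` to `v`. -/
theorem betaU_eq (u v : L) (hB : betaDen u v ≠ 0) (hn : v - 27 ≠ 0) :
    betaU u v = ((2 * u - 18) / (v - 27) * (betaV u v - 27) + 18) / 2 := by
  rw [betaV_sub u v hB, betaU]; field_simp; rw [betaDen]; ring

/-- `v - 27` and `β(v) - 27` are the roots of the same quadratic polynomial. -/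
theorem betaV_root (u v : L) (hB : betaDen u v ≠ 0) (hn : v - 27 ≠ 0) (hv : v ≠ 0)
    (d : L) (hd : d = (2 * u - 18) / (v - 27)) :
    (1 - d) ^ 3 * (betaV u v - 27) * (betaV u v - 27 + 27) =
      27 * invUV₁ u v * betaLin d (betaV u v - 27) := by
  have h : d * (v - 27) = 2 * u - 18 := by rw [hd]; field_simp
  have hu : u = (d * (v - 27) + 18) / 2 := by rw [h]; ring
  have hB' := betaDen_eq_betaLin d (v - 27)
  rw [← hu, sub_add_cancel] at hB'
  have h1 := invUV₁_eq_betaLin d (v - 27) hn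
  rw [← hu, sub_add_cancel] at h1
  have hl : betaLin d (v - 27) ≠ 0 := by rintro h0; simp [hB', h0] at hB
  -- By Vieta the second root is the constant term over the leading coefficient and the first root;
  -- expressing `r₁` through `n` gives this value.
  have hn' : betaV u v - 27 = -(v * (9 * d - 4) ^ 2) / (4 * betaLin d (v - 27)) := by
    rw [betaV_sub u v hB, hB', hu]; field_simp; ring
  rw [hn', h1]
  obtain ⟨P, hP⟩ : ∃ P, P = d ^ 2 * (2 * d - 1) / 4 := ⟨_, rfl⟩
  obtain ⟨l, hl'⟩ : ∃ l, l = betaLin d (v - 27) := ⟨_, rfl⟩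
  have hq : (9 * d - 4) ^ 2 = 4 * (l - P * (v - 27)) := by rw [hl', betaLin, hP]; ring
  rw [← hl'] at hl ⊢
  rw [betaLin, ← hP, hq]
  field_simp
  ring

theorem v_root (u v : L) (hB : betaDen u v ≠ 0) (hn : v - 27 ≠ 0)
    (d : L) (hd : d = (2 * u - 18) / (v - 27)) :
    (1 - d) ^ 3 * (v - 27) * (v - 27 + 27) = 27 * invUV₁ u v * betaLin d (v - 27) := by
  have h : d * (v - 27) = 2 * u - 18 := by rw [hd]; field_simp
  have hu : u = (d * (v - 27) + 18) / 2 := by rw [h]; ring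
  have hB' := betaDen_eq_betaLin d (v - 27)
  rw [← hu, sub_add_cancel] at hB'
  have h1 := invUV₁_eq_betaLin d (v - 27) hn
  rw [← hu, sub_add_cancel] at h1
  have hl : betaLin d (v - 27) ≠ 0 := by rintro h0; simp [hB', h0] at hB
  rw [h1]; field_simp; ring

/-- Both roots satisfy the same quadratic with the same `d`, and this equation solved for `r₁` gives
the invariance of `r₁`; `r₂` is a function of `r₁` and `d`. -/
theorem invUV_beta (u v : L) (hB : betaDen u v ≠ 0) (hn : v - 27 ≠ 0) (hv : v ≠ 0)
    (hm : v - 2 * u - 9 ≠ 0) (h3 : v - 3 * u ≠ 0) (h9 : 9 * u - 2 * v - 27 ≠ 0) :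
    invUV₁ (betaU u v) (betaV u v) = invUV₁ u v ∧
      invUV₂ (betaU u v) (betaV u v) = invUV₂ u v := by
  obtain ⟨d, hd⟩ : ∃ d, d = (2 * u - 18) / (v - 27) := ⟨_, rfl⟩
  have hroot := betaV_root u v hB hn hv d hd
  have hu := betaU_eq u v hB hn
  rw [← hd] at hu
  have hn' : betaV u v - 27 ≠ 0 := by
    rw [betaV_sub u v hB]
    exact div_ne_zero (neg_ne_zero.2 (mul_ne_zero hv (pow_ne_zero _ h9))) hB
  have hv' : betaV u v ≠ 0 := by
    rw [betaV]
    exact div_ne_zero (neg_ne_zero.2 (mul_ne_zero (by norm_num) (pow_ne_zero _ h3))) hB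
  have hd1 : 1 - d ≠ 0 := by
    rw [show 1 - d = (v - 2 * u - 9) / (v - 27) by rw [hd]; field_simp; ring]
    exact div_ne_zero hm hn
  have h1 := invUV₁_eq_betaLin d (betaV u v - 27) hn'
  rw [← hu, sub_add_cancel] at h1
  rw [sub_add_cancel] at hroot
  have hl : betaLin d (betaV u v - 27) ≠ 0 := by
    intro h0
    rw [h0, mul_zero] at hroot
    exact mul_ne_zero (mul_ne_zero (pow_ne_zero _ hd1) hn') hv' hroot
  have e1 : invUV₁ (betaU u v) (betaV u v) = invUV₁ u v := by
    rw [h1, hroot]; field_simp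
  refine ⟨e1, ?_⟩
  rw [invUV₂_eq _ _ hn', invUV₂_eq _ _ hn, e1, ← hd, hu]
  congr 4
  field_simp; ring

variable {k : Type*} [Field k] [Algebra k L]

/-- A field containing `r₁, r₂` contains `d`, hence the coefficients of the quadratic for `n`; its
leading coefficient `(1 - d)³ = (m / n)³` is nonzero. -/
theorem isAlgebraic_of_invUV_mem (u v : L) (hB : betaDen u v ≠ 0) (hn : v - 27 ≠ 0)
    (hv : v ≠ 0) (hm : v - 2 * u - 9 ≠ 0) (I : IntermediateField k L) (h1 : invUV₁ u v ∈ I)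
    (h2 : invUV₂ u v ∈ I) : IsAlgebraic I u ∧ IsAlgebraic I v := by
  obtain ⟨d, hd⟩ : ∃ d, d = (2 * u - 18) / (v - 27) := ⟨_, rfl⟩
  have hr : invUV₁ u v ≠ 0 := by
    rw [invUV₁]
    exact div_ne_zero (mul_ne_zero (pow_ne_zero _ hm) hv) (mul_ne_zero (by norm_num) hB)
  have hdI : d ∈ I := by
    have : d = 1 + 48 * (invUV₂ u v / invUV₁ u v) := by
      rw [invUV₂_eq u v hn, ← hd]; field_simp; ring
    rw [this]
    exact I.add_mem I.one_mem (I.mul_mem (by exact_mod_cast I.natCast_mem 48) (I.div_mem h2 h1))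
  have hroot := v_root u v hB hn d hd
  have hd1 : 1 - d ≠ 0 := by
    rw [show 1 - d = (v - 2 * u - 9) / (v - 27) by rw [hd]; field_simp; ring]
    exact div_ne_zero hm hn
  have hnalg : IsAlgebraic I (v - 27) := by
    let d' : I := ⟨d, hdI⟩
    let r : I := ⟨invUV₁ u v, h1⟩
    refine ⟨C ((1 - d') ^ 3) * X ^ 2 + C (27 * (1 - d') ^ 3 - 27 * r *
      (d' ^ 2 * (2 * d' - 1) / 4)) * X + C (- (27 * r * ((9 * d' - 4) ^ 2 / 4))), ?_, ?_⟩
    · intro h0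
      have := congrArg (fun p => ((p.coeff 2 : I) : L)) h0
      simp only [coeff_add, coeff_C_mul, coeff_X_pow, coeff_X, coeff_C] at this
      norm_num [d'] at this
      exact hd1 this
    · have e1 : algebraMap I L d' = d := rfl
      have e2 : algebraMap I L r = invUV₁ u v := rfl
      simp only [map_add, map_sub, map_neg, map_one, map_ofNat, map_mul, map_pow, map_div₀,
        aeval_C, aeval_X, e1, e2]
      rw [betaLin] at hroot
      linear_combination hroot
  have h27 : IsAlgebraic I (27 : L) := by
    exact_mod_cast isAlgebraic_algebraMap (R := I) (A := L) (27 : I)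
  have hvalg : IsAlgebraic I v := by simpa using hnalg.add h27
  refine ⟨?_, hvalg⟩
  have hu : u = (d * (v - 27) + 18) * (1 / 2) := by rw [hd]; field_simp; ring
  have h18 : IsAlgebraic I (18 : L) := by
    exact_mod_cast isAlgebraic_algebraMap (R := I) (A := L) (18 : I)
  have hhalf : IsAlgebraic I (1 / 2 : L) := by
    have := isAlgebraic_algebraMap (R := I) (A := L) (1 / 2 : I)
    rwa [map_div₀, map_one, map_ofNat] at this
  have hdalg : IsAlgebraic I d := isAlgebraic_algebraMap (R := I) (A := L) ⟨d, hdI⟩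
  rw [hu]
  exact ((hdalg.mul hnalg).add h18).mul hhalf

end Involution

section Generic
variable {k L : Type*} [Field k] [Field L] [CharZero k] [Algebra k L]

open MvPolynomial (X) in
-- Every inequality is tested at the point `(u, v) = (0, 1)`.
theorem generic_ne_zero {u v : L} (h : AlgebraicIndependent k ![u, v]) :
    betaDen u v ≠ 0 ∧ v - 27 ≠ 0 ∧ v ≠ 0 ∧ v - 2 * u - 9 ≠ 0 ∧ v - 3 * u ≠ 0 ∧
      9 * u - 2 * v - 27 ≠ 0 ∧ betaV u v ≠ v := by
  obtain ⟨φ, h0, h1, key⟩ : ∃ φ : MvPolynomial (Fin 2) k →+* L, φ (X 0) = u ∧ φ (X 1) = v ∧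
      ∀ P : MvPolynomial (Fin 2) k, MvPolynomial.eval ![0, 1] P ≠ 0 → φ P ≠ 0 :=
    ⟨(MvPolynomial.aeval ![u, v] : MvPolynomial (Fin 2) k →ₐ[k] L).toRingHom,
      MvPolynomial.aeval_X _ _, MvPolynomial.aeval_X _ _,
      fun P hP => aeval_ne_zero_of_eval_ne_zero h _ hP⟩
  have hB : betaDen u v ≠ 0 := by
    have := key (4 * X 0 ^ 3 + 27 * X 1 - 18 * X 0 * X 1 - X 0 ^ 2 * X 1 + 4 * X 1 ^ 2)
      (by simp; norm_num)
    rw [map_add, map_sub, map_sub] at this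
    simpa [betaDen, h0, h1, map_ofNat φ] using this
  refine ⟨hB, ?_, ?_, ?_, ?_, ?_, fun he => ?_⟩
  · have := key (X 1 - 27) (by simp; norm_num)
    rw [map_sub] at this
    simpa [h1, map_ofNat φ] using this
  · simpa [h1] using key (X 1) (by simp)
  · have := key (X 1 - 2 * X 0 - 9) (by simp; norm_num)
    rw [map_sub, map_sub] at this
    simpa [h0, h1, map_ofNat φ] using this
  · have := key (X 1 - 3 * X 0) (by simp)
    rw [map_sub] at this
    simpa [h0, h1, map_ofNat φ] using this
  · have := key (9 * X 0 - 2 * X 1 - 27) (by simp; norm_num)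
    rw [map_sub, map_sub] at this
    simpa [h0, h1, map_ofNat φ] using this
  · have h2 := key (4 * (X 1 - 3 * X 0) ^ 3 + X 1 * (4 * X 0 ^ 3 + 27 * X 1 - 18 * X 0 * X 1
      - X 0 ^ 2 * X 1 + 4 * X 1 ^ 2)) (by simp; norm_num)
    rw [betaV, div_eq_iff hB, betaDen] at he
    apply h2
    simp only [map_sub, map_add, map_mul, map_pow, map_ofNat, h0, h1]
    linear_combination -he

end Generic

theorem mem_adjoin_fixed {k L : Type*} [Field k] [Field L] [Algebra k L]
    {V : IntermediateField k L} (σ : V →ₐ[k] L) {s : Set L} (hs : s ⊆ V)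
    (h : ∀ x (hx : x ∈ s), σ ⟨x, hs hx⟩ = x) (x : L) (hx : x ∈ adjoin k s) :
    ∃ hV : x ∈ V, σ ⟨x, hV⟩ = x := by
  induction hx using adjoin_induction with
  | mem x hx => exact ⟨hs hx, h x hx⟩
  | algebraMap x => exact ⟨V.algebraMap_mem x, σ.commutes x⟩
  | add x y _ _ hx hy =>
    obtain ⟨hx, ex⟩ := hx
    obtain ⟨hy, ey⟩ := hy
    exact ⟨V.add_mem hx hy, (map_add σ ⟨x, hx⟩ ⟨y, hy⟩).trans (by rw [ex, ey])⟩
  | inv x _ hx =>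
    obtain ⟨hx, ex⟩ := hx
    exact ⟨V.inv_mem hx, (map_inv₀ σ ⟨x, hx⟩).trans (by rw [ex])⟩
  | mul x y _ _ hx hy =>
    obtain ⟨hx, ex⟩ := hx
    obtain ⟨hy, ey⟩ := hy
    exact ⟨V.mul_mem hx hy, (map_mul σ ⟨x, hx⟩ ⟨y, hy⟩).trans (by rw [ex, ey])⟩

/-- Two algebraically independent pairs are related by an embedding of the fields they generate. -/
theorem exists_algHom_of_algebraicIndependent {k L ι : Type*} [Field k] [Field L] [Algebra k L]
    {x y : ι → L} (hx : AlgebraicIndependent k x) (hy : AlgebraicIndependent k y) :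
    ∃ σ : adjoin k (Set.range x) →ₐ[k] L,
      ∀ i, σ ⟨x i, subset_adjoin _ _ ⟨i, rfl⟩⟩ = y i := by
  let e : FractionRing (MvPolynomial ι k) ≃ₐ[k] adjoin k (Set.range x) := hx.aevalEquivField
  let e' : FractionRing (MvPolynomial ι k) ≃ₐ[k] adjoin k (Set.range y) := hy.aevalEquivField
  refine ⟨((adjoin k (Set.range y)).val.comp e'.toAlgHom).comp e.symm.toAlgHom, fun i => ?_⟩
  have h1 : e (algebraMap (MvPolynomial ι k) _ (MvPolynomial.X i)) =
      ⟨x i, subset_adjoin _ _ ⟨i, rfl⟩⟩ := by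
    ext; simp [e]
  have h2 : (e' (algebraMap (MvPolynomial ι k) _ (MvPolynomial.X i)) : L) = y i := by
    simp [e']
  rw [← h1]
  simpa using h2

/-! ### The Galois extension of degree two -/

section Degree
variable {k L : Type*} [Field k] [Field L] [Algebra k L]

theorem map_invUV₁ {M N : Type*} [Field M] [Field N] (φ : M →+* N) (u v : M) :
    φ (invUV₁ u v) = invUV₁ (φ u) (φ v) := by
  simp only [invUV₁, betaDen, map_div₀, map_mul, map_pow, map_sub, map_add, map_ofNat]

theorem map_invUV₂ {M N : Type*} [Field M] [Field N] (φ : M →+* N) (u v : M) :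
    φ (invUV₂ u v) = invUV₂ (φ u) (φ v) := by
  simp only [invUV₂, betaDen, map_div₀, map_mul, map_pow, map_sub, map_add, map_neg, map_ofNat]

theorem invUV₁_mem {V : IntermediateField k L} {u v : L} (hu : u ∈ V) (hv : v ∈ V) :
    invUV₁ u v ∈ V := by
  have := map_invUV₁ (V.val : V →+* L) ⟨u, hu⟩ ⟨v, hv⟩
  exact this ▸ Subtype.mem _

theorem invUV₂_mem {V : IntermediateField k L} {u v : L} (hu : u ∈ V) (hv : v ∈ V) :
    invUV₂ u v ∈ V := by
  have := map_invUV₂ (V.val : V →+* L) ⟨u, hu⟩ ⟨v, hv⟩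
  exact this ▸ Subtype.mem _

variable [CharZero k]

/-- The field `k(β(u), β(v))` contains `r₁, r₂`, so `u, v` are algebraic over it and `β(u), β(v)`
are independent. Hence `u ↦ β(u)`, `v ↦ β(v)` defines an embedding of `k(u, v)`; it fixes `k(r₁,
r₂)` pointwise and moves `v`. -/
theorem notMem_adjoin_invUV {u v : L} (h : AlgebraicIndependent k ![u, v]) :
    v ∉ adjoin k {invUV₁ u v, invUV₂ u v} := by
  have : CharZero L := charZero_of_injective_algebraMap (algebraMap k L).injective
  obtain ⟨hB, hn, hv, hm, h3, h9, hne⟩ := generic_ne_zero h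
  obtain ⟨e1, e2⟩ := invUV_beta u v hB hn hv hm h3 h9
  set W := adjoin k (Set.range ![betaU u v, betaV u v]) with hW
  have m1 : invUV₁ u v ∈ W :=
    e1 ▸ invUV₁_mem (subset_adjoin _ _ ⟨0, rfl⟩) (subset_adjoin _ _ ⟨1, rfl⟩)
  have m2 : invUV₂ u v ∈ W :=
    e2 ▸ invUV₂_mem (subset_adjoin _ _ ⟨0, rfl⟩) (subset_adjoin _ _ ⟨1, rfl⟩)
  obtain ⟨algu, algv⟩ := isAlgebraic_of_invUV_mem u v hB hn hv hm W m1 m2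
  have hind : AlgebraicIndependent k ![betaU u v, betaV u v] := by
    apply algebraicIndependent_of_isAlgebraic h
    intro i
    fin_cases i
    · exact algu
    · exact algv
  obtain ⟨σ, hσ⟩ := exists_algHom_of_algebraicIndependent h hind
  intro hvI
  have hu' : u ∈ adjoin k (Set.range ![u, v]) := subset_adjoin _ _ ⟨0, rfl⟩
  have hv' : v ∈ adjoin k (Set.range ![u, v]) := subset_adjoin _ _ ⟨1, rfl⟩
  have hσu : σ ⟨u, hu'⟩ = betaU u v := hσ 0
  have hσv : σ ⟨v, hv'⟩ = betaV u v := hσ 1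
  have hs : ({invUV₁ u v, invUV₂ u v} : Set L) ⊆ adjoin k (Set.range ![u, v]) := by
    rintro x (rfl | rfl)
    · exact invUV₁_mem hu' hv'
    · exact invUV₂_mem hu' hv'
  obtain ⟨_, h0⟩ := mem_adjoin_fixed σ hs (by
    rintro x (rfl | rfl)
    · have h1 := map_invUV₁ σ.toRingHom ⟨u, hu'⟩ ⟨v, hv'⟩
      have h2 := map_invUV₁ (adjoin k (Set.range ![u, v])).val.toRingHom ⟨u, hu'⟩ ⟨v, hv'⟩
      refine (congrArg σ (Subtype.ext h2.symm)).trans (h1.trans ?_)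
      exact (congrArg₂ invUV₁ hσu hσv).trans e1
    · have h1 := map_invUV₂ σ.toRingHom ⟨u, hu'⟩ ⟨v, hv'⟩
      have h2 := map_invUV₂ (adjoin k (Set.range ![u, v])).val.toRingHom ⟨u, hu'⟩ ⟨v, hv'⟩
      refine (congrArg σ (Subtype.ext h2.symm)).trans (h1.trans ?_)
      exact (congrArg₂ invUV₂ hσu hσv).trans e2) v hvI
  exact hne (hσv.symm.trans h0)

theorem finrank_adjoin_invUV {u v : L} (h : AlgebraicIndependent k ![u, v])
    (I V : IntermediateField k L) (hI : I = adjoin k {invUV₁ u v, invUV₂ u v})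
    (hV : V = adjoin k {u, v}) (hu : u ∈ V) (hv : v ∈ V) :
    ∃ h : I ≤ V, Module.finrank I (extendScalars h) = 2 ∧ IsGalois I (extendScalars h) ∧
      ∃ β : extendScalars h ≃ₐ[I] extendScalars h, (β ⟨u, hu⟩ : L) = betaU u v ∧
        (β ⟨v, hv⟩ : L) = betaV u v ∧ orderOf β = 2 ∧ Subgroup.zpowers β = ⊤ := by
  have : CharZero L := charZero_of_injective_algebraMap (algebraMap k L).injective
  obtain ⟨hB, hn, hv0, hm, h3, h9, hne⟩ := generic_ne_zero h
  have hIV : I ≤ V := by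
    rw [hI, adjoin_le_iff]
    rintro x (rfl | rfl)
    · exact invUV₁_mem hu hv
    · exact invUV₂_mem hu hv
  have m1 : invUV₁ u v ∈ I := hI ▸ subset_adjoin _ _ (by simp)
  have m2 : invUV₂ u v ∈ I := hI ▸ subset_adjoin _ _ (by simp)
  obtain ⟨d, hd⟩ : ∃ d, d = (2 * u - 18) / (v - 27) := ⟨_, rfl⟩
  have hr : invUV₁ u v ≠ 0 := by
    rw [invUV₁]
    exact div_ne_zero (mul_ne_zero (pow_ne_zero _ hm) hv0) (mul_ne_zero (by norm_num) hB)
  have hdI : d ∈ I := by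
    have : d = 1 + 48 * (invUV₂ u v / invUV₁ u v) := by
      rw [invUV₂_eq u v hn, ← hd]; field_simp; ring
    rw [this]
    exact I.add_mem I.one_mem (I.mul_mem (by exact_mod_cast I.natCast_mem 48) (I.div_mem m2 m1))
  have hroot := v_root u v hB hn d hd
  have hroot' := betaV_root u v hB hn hv0 d hd
  have hd1 : 1 - d ≠ 0 := by
    rw [show 1 - d = (v - 2 * u - 9) / (v - 27) by rw [hd]; field_simp; ring]
    exact div_ne_zero hm hn
  have hu' : u = (d * (v - 27) + 18) / 2 := by rw [hd]; field_simp; ring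
  -- uniqueness of the second root
  have huniq : ∀ w : L, w ≠ v → (1 - d) ^ 3 * (w - 27) * (w - 27 + 27) =
      27 * invUV₁ u v * betaLin d (w - 27) → w = betaV u v := by
    intro w hw hwr
    -- Subtracting the equations for `w` and `v` and cancelling `w - v` gives the sum of the two
    -- roots, which determines `w`.
    have e : ∀ w, (1 - d) ^ 3 * (w - 27) * (w - 27 + 27) = 27 * invUV₁ u v * betaLin d (w - 27) →
        w ≠ v → (1 - d) ^ 3 * (w + v - 27) = 27 * invUV₁ u v * (d ^ 2 * (2 * d - 1) / 4) := by
      intro w hwr hw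
      apply mul_right_cancel₀ (sub_ne_zero.2 hw)
      rw [betaLin] at hwr hroot
      linear_combination hwr - hroot
    have := (e w hwr hw).trans (e _ hroot' hne).symm
    have := mul_left_cancel₀ (pow_ne_zero 3 hd1) this
    linear_combination this
  let d' : I := ⟨d, hdI⟩
  let r : I := ⟨invUV₁ u v, m1⟩
  have e1 : algebraMap I L d' = d := rfl
  have e2 : algebraMap I L r = invUV₁ u v := rfl
  let p : I[X] := C ((1 - d') ^ 3) * X ^ 2 + C (-27 * (1 - d') ^ 3 - 27 * r *
      (d' ^ 2 * (2 * d' - 1) / 4)) * X +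
      C (27 * r * (27 * (d' ^ 2 * (2 * d' - 1) / 4) - (9 * d' - 4) ^ 2 / 4))
  have hp : ∀ w : L, aeval w p = (1 - d) ^ 3 * (w - 27) * (w - 27 + 27) -
      27 * invUV₁ u v * betaLin d (w - 27) := by
    intro w
    simp only [p, map_add, map_sub, map_neg, map_one, map_ofNat, map_mul, map_pow, map_div₀,
        aeval_C, aeval_X, e1, e2, betaLin]
    ring
  have hp0 : p ≠ 0 := by
    intro h0
    have := congrArg (fun p => ((p.coeff 2 : I) : L)) h0
    simp only [p, coeff_add, coeff_C_mul, coeff_X_pow, coeff_X, coeff_C] at this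
    norm_num [d'] at this
    exact hd1 this
  have hpdeg : p.natDegree ≤ 2 := by simp only [p]; compute_degree
  have hpv : aeval v p = 0 := by rw [hp, hroot, sub_self]
  have hint : IsIntegral I v := IsAlgebraic.isIntegral ⟨p, hp0, hpv⟩
  -- Since `u` is affine in `v` with coefficients in `k(d)`, the element `v` alone generates the
  -- extension.
  have hE : extendScalars hIV = adjoin I {v} := by
    apply le_antisymm
    · rw [extendScalars_le_iff, hV, adjoin_le_iff]
      have hvm : v ∈ adjoin I {v} := subset_adjoin _ _ rfl
      rintro x (rfl | rfl)
      · change x ∈ adjoin I {v}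
        have h2 : ∀ y ∈ I, y ∈ adjoin I {v} := fun y hy => (adjoin I {v}).algebraMap_mem ⟨y, hy⟩
        rw [hu']
        refine div_mem (add_mem (mul_mem (h2 _ hdI) (sub_mem hvm ?_)) ?_) ?_
        · exact_mod_cast (adjoin I {v}).natCast_mem 27
        · exact_mod_cast (adjoin I {v}).natCast_mem 18
        · exact_mod_cast (adjoin I {v}).natCast_mem 2
      · exact hvm
    · rw [adjoin_le_iff]
      rintro x rfl
      exact hv
  have hmin2 : 2 ≤ (minpoly I v).natDegree := by
    rw [minpoly.two_le_natDegree_iff hint]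
    rintro ⟨y, hy⟩
    exact notMem_adjoin_invUV h (hI ▸ hy ▸ y.2)
  have hfin : Module.finrank I (extendScalars hIV) = 2 := by
    rw [hE, adjoin.finrank hint]
    exact le_antisymm ((natDegree_le_of_dvd (minpoly.dvd I v hpv) hp0).trans hpdeg) hmin2
  have hq : Algebra.IsQuadraticExtension I (extendScalars hIV) := ⟨hfin⟩
  have hfd : FiniteDimensional I (extendScalars hIV) := .of_finrank_pos (by omega)
  have : CharZero I := charZero_of_injective_algebraMap (algebraMap k I).injective
  have hgal : IsGalois I (extendScalars hIV) := inferInstance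
  have hcard : Nat.card (extendScalars hIV ≃ₐ[I] extendScalars hIV) = 2 := by
    rw [IsGalois.card_aut_eq_finrank, hfin]
  have : Nontrivial (extendScalars hIV ≃ₐ[I] extendScalars hIV) :=
    Finite.one_lt_card_iff_nontrivial.1 (by rw [hcard]; norm_num)
  obtain ⟨β, hβ⟩ := exists_ne (1 : extendScalars hIV ≃ₐ[I] extendScalars hIV)
  have hβn : (β ⟨v, hv⟩ : L) ≠ v := by
    intro h0
    apply hβ
    have := algHom_ext_of_eq_adjoin I hE (φ₁ := β.toAlgHom) (φ₂ := AlgHom.id I _) (by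
      rintro x rfl
      exact Subtype.ext h0)
    exact AlgEquiv.ext fun x => DFunLike.congr_fun this x
  have hβroot : aeval (β ⟨v, hv⟩ : L) p = 0 := by
    let φ : extendScalars hIV →ₐ[I] L := (extendScalars hIV).val.comp β.toAlgHom
    have h1 : aeval (⟨v, hv⟩ : extendScalars hIV) p = 0 :=
      (map_eq_zero_iff _ (extendScalars hIV).val.injective).1
        ((aeval_algHom_apply (extendScalars hIV).val
          (⟨v, hv⟩ : extendScalars hIV) p).symm.trans hpv)
    have h2 := aeval_algHom_apply φ ⟨v, hv⟩ p
    rw [h1, map_zero] at h2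
    exact h2
  -- The non-trivial automorphism moves the generator `v` to a root of the same quadratic, hence to
  -- the other one.
  have hβv : (β ⟨v, hv⟩ : L) = betaV u v := huniq _ hβn (sub_eq_zero.1 (by rw [← hp, hβroot]))
  have hprime : Fact (Nat.Prime 2) := ⟨Nat.prime_two⟩
  have hz := zpowers_eq_top_of_prime_card hcard hβ
  refine ⟨hIV, hfin, hgal, β, ?_, hβv, ?_, hz⟩
  · let φ : extendScalars hIV →ₐ[I] L := (extendScalars hIV).val.comp β.toAlgHom
    have h1 : φ ⟨u, hu⟩ = (d * (φ ⟨v, hv⟩ - 27) + 18) / 2 := by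
      have : (⟨u, hu⟩ : extendScalars hIV) =
          (algebraMap I _ d' * (⟨v, hv⟩ - 27) + 18) / 2 := Subtype.ext hu'
      rw [this]
      simp only [map_div₀, map_add, map_mul, map_sub, map_ofNat, AlgHom.commutes, e1]
    change φ ⟨u, hu⟩ = _
    have h2 : φ ⟨v, hv⟩ = betaV u v := hβv
    rw [h1, h2, betaU_eq u v hB hn, hd]
  · rw [← Nat.card_zpowers, hz, Subgroup.card_top, hcard]

end Degree

/-! ### Recovering `r₁, r₂` from the absolute invariants -/

/-- If `y` is integral over `A` and congruent to `1` modulo a proper ideal `ker ev` of `A`, then `y`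
is a fraction of elements of `A` whose denominator is not in the ideal. -/
theorem exists_mul_eq_algebraMap {A S k : Type*} [CommRing A] [CommRing S] [Algebra A S]
    [CommRing k] (ev : A →+* k) (y : S) (hint : IsIntegral A y)
    (hy : y - 1 ∈ RingHom.ker ev • Subalgebra.toSubmodule (Algebra.adjoin A {y})) :
    ∃ a b : A, ev a = 1 ∧ algebraMap A S a * y = algebraMap A S b := by
  set M := Subalgebra.toSubmodule (Algebra.adjoin A {y}) with hM
  have hfg : M.FG := hint.fg_adjoin_singleton
  -- Each `P(y)` differs from the scalar `P(1)` by a multiple of `y - 1`, which lies in the ideal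
  -- times `A[y]`.
  have hle : M ≤ (1 : Submodule A S) ⊔ RingHom.ker ev • M := by
    intro x hx
    obtain ⟨P, rfl⟩ := Algebra.adjoin_mem_exists_aeval A y hx
    obtain ⟨R, hR⟩ := X_sub_C_dvd_sub_C_eval (p := P) (a := 1)
    have : aeval y P = algebraMap A S (P.eval 1) + (y - 1) * aeval y R := by
      have := congrArg (aeval y) hR
      simp only [map_sub, map_mul, aeval_C, aeval_X, map_one] at this
      linear_combination this
    rw [this]
    refine Submodule.add_mem_sup (Submodule.mem_one.2 ⟨_, rfl⟩) ?_
    have hRM : aeval y R ∈ Algebra.adjoin A {y} := aeval_mem_adjoin_singleton A y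
    refine Submodule.smul_induction_on hy (fun r hr n hn => ?_) (fun x z hx hz => ?_)
    · rw [smul_mul_assoc]
      exact Submodule.smul_mem_smul hr (Subalgebra.mul_mem _ hn hRM)
    · rw [add_mul]; exact add_mem hx hz
  -- Nakayama's lemma: some `a` congruent to 1 modulo the ideal multiplies `A[y]` into `A · 1`.
  obtain ⟨a, ha, haM⟩ := Submodule.exists_sub_one_mem_and_smul_le_of_fg_of_le_sup hfg le_rfl hle
  have hyM : y ∈ M := Algebra.self_mem_adjoin_singleton A y
  obtain ⟨b, hb⟩ := Submodule.mem_one.1 (haM (Submodule.smul_mem_pointwise_smul y a M hyM))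
  refine ⟨a, b, ?_, ?_⟩
  · rw [RingHom.mem_ker, map_sub, map_one, sub_eq_zero] at ha; exact ha
  · rw [hb, Algebra.smul_def]

/-- The equation satisfied by `y` over the field of absolute invariants has invertible leading
coefficient. -/
theorem isIntegral_of_invariant_equation {A S : Type*} [CommRing A] [CommRing S] [Algebra A S]
    (J I₂ w : A) (y T : S) (hw : w * (243 * (I₂ + J ^ 2)) = 1)
    (h1 : algebraMap A S J * (2 - 3 * y ^ 2) ^ 2 - 1 = T)
    (h2 : algebraMap A S I₂ * (2 - 3 * y ^ 2) ^ 3 * (4 - 3 * y) ^ 2 =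
      8 * (4 - 3 * y) ^ 2 + 12 * (9 * y - 8) * (4 - 3 * y) * T + 3 * T ^ 2) : IsIntegral A y := by
  nontriviality A
  -- Eliminating `T` between the two hypotheses gives an equation of degree 8 in `y` with leading
  -- coefficient `-243 (I₂ + J²)`; multiplying by `-w` makes it monic, and `q` collects the lower
  -- terms.
  let q : A[X] := C (-w * (128 * I₂ - 515 + 1560 * J - 48 * J ^ 2))
    + C (-w * (-192 * I₂ + 912 - 2880 * J)) * X ^ 1
    + C (-w * (-504 * I₂ - 396 - 3384 * J + 288 * J ^ 2)) * X ^ 2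
    + C (-w * (864 * I₂ + 8640 * J)) * X ^ 3
    + C (-w * (540 * I₂ - 378 * J - 648 * J ^ 2)) * X ^ 4
    + C (-w * (-1296 * I₂ - 6480 * J)) * X ^ 5
    + C (-w * (54 * I₂ + 2916 * J + 648 * J ^ 2)) * X ^ 6
    + C (-w * (648 * I₂)) * X ^ 7
  have hq : q.degree < 8 := by
    refine (degree_le_of_natDegree_le (n := 7) ?_).trans_lt (by norm_num)
    simp only [q]; compute_degree
  refine ⟨X ^ 8 + q, monic_X_pow_add hq, ?_⟩
  rw [← aeval_def]
  have hw' := congrArg (algebraMap A S) hw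
  simp only [map_mul, map_add, map_pow, map_ofNat, map_one] at hw'
  simp only [q, map_mul, map_add, map_sub, map_neg, map_pow, map_ofNat, aeval_C, aeval_X]
  rw [← h1] at h2
  linear_combination (-y ^ 8) * hw' - algebraMap A S w * h2


set_option maxHeartbeats 400000 in
/-- A rational parameter of the locus lies in the field generated by the invariants. -/
theorem mem_adjoin_of_parameters {k L : Type*} [Field k] [CharZero k] [Field L] [Algebra k L]
    {y T : L} (h : AlgebraicIndependent k ![y, T]) :
    y ∈ adjoin k {(1 + (4 - 3 * y) * T / 4) / (2 - 3 * y ^ 2) ^ 2,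
      (8 + 3 * (9 * y - 8) * T + 3 * T ^ 2 / 16) / (2 - 3 * y ^ 2) ^ 3,
      (1 - y) * T ^ 3 / (2 - 3 * y ^ 2) ^ 5} := by
  have : CharZero L := charZero_of_injective_algebraMap (algebraMap k L).injective
  let R := MvPolynomial (Fin 2) k
  -- At `(y, T) = (1, -4)` the first and third invariants vanish. On their common zeros the first
  -- one gives `(4 - 3y) T = -4`, so `T ≠ 0`, and then the third forces `y = 1`: the fibre has a
  -- single value of `y`.
  let e : R →ₐ[k] k := MvPolynomial.aeval ![1, -4]
  let f : R →ₐ[k] L := MvPolynomial.aeval ![y, T]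
  let Y : R := MvPolynomial.X 0
  let Z : R := MvPolynomial.X 1
  let q : R := MvPolynomial.C (1 / 4)
  have eY : e Y = 1 := MvPolynomial.aeval_X _ _
  have eZ : e Z = -4 := MvPolynomial.aeval_X _ _
  have eq : e q = 1 / 4 := MvPolynomial.aeval_C _ _
  have fY : f Y = y := MvPolynomial.aeval_X _ _
  have fZ : f Z = T := MvPolynomial.aeval_X _ _
  have fq : f q = 1 / 4 := (MvPolynomial.aeval_C _ _).trans (by
    rw [map_div₀, map_one, map_ofNat (algebraMap k L)])
  have q4 : 4 * q = 1 := by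
    have : (4 : R) = MvPolynomial.C 4 := (map_ofNat MvPolynomial.C 4).symm
    rw [this, ← map_mul]; norm_num
  let Q : R := 2 - 3 * Y ^ 2
  let NJ : R := 1 + (4 - 3 * Y) * Z * q
  let NI : R := 8 + 3 * (9 * Y - 8) * Z + 3 * Z ^ 2 * q ^ 2
  -- This is `Q⁴ (I₂ + J²)`. Inverting `Q N` makes the invariants regular and the leading
  -- coefficient of the equation for `y` a unit, and keeps the chosen point, where `Q = -1` and `N =
  -- 1`.
  let N : R := Q * NI + NJ ^ 2
  have eQ : e Q = -1 := by
    simp only [Q, map_sub, map_mul, map_pow, map_ofNat, eY]; norm_num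
  have eNJ : e NJ = 0 := by
    simp only [NJ, map_add, map_sub, map_mul, map_ofNat, map_one, eY, eZ, eq]; norm_num
  have eNI : e NI = -1 := by
    simp only [NI, map_add, map_sub, map_mul, map_pow, map_ofNat, eY, eZ, eq]; norm_num
  have eN : e N = 1 := by
    simp only [N, map_add, map_mul, map_pow, eQ, eNI, eNJ]; norm_num
  have fQ : f Q = 2 - 3 * y ^ 2 := by
    simp only [Q, map_sub, map_mul, map_pow, map_ofNat, fY]
  have hinj : Function.Injective f := h
  have hs0 : Q * N ≠ 0 := by
    intro h0
    have := congrArg e h0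
    rw [map_mul, eQ, eN, map_zero] at this
    norm_num at this
  let s : R := Q * N
  let S := Localization.Away s
  have hes : IsUnit (e s) := by
    simp only [s, map_mul, eQ, eN]; norm_num
  have hfs : IsUnit (f s) := by
    rw [isUnit_iff_ne_zero]; exact fun h0 => hs0 (hinj (h0.trans (map_zero f).symm))
  obtain ⟨ev, hev⟩ : ∃ ev : S →ₐ[k] k, ∀ r : R, ev (algebraMap R S r) = e r :=
    ⟨IsLocalization.Away.liftAlgHom (S := S) s (f := e) hes,
      fun r => IsLocalization.Away.lift_eq _ hes _⟩
  obtain ⟨ι, hι⟩ : ∃ ι : S →ₐ[k] L, ∀ r : R, ι (algebraMap R S r) = f r :=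
    ⟨IsLocalization.Away.liftAlgHom (S := S) s (f := f) hfs,
      fun r => IsLocalization.Away.lift_eq _ hfs _⟩
  have hιinj : Function.Injective ι := by
    rw [injective_iff_map_eq_zero]
    intro x hx
    obtain ⟨n, b, hb⟩ := IsLocalization.Away.surj s x
    have h1 := congrArg ι hb
    rw [map_mul, hx, zero_mul, hι] at h1
    have : b = 0 := hinj (h1.symm.trans (map_zero f).symm)
    rw [this, map_zero] at hb
    exact ((IsLocalization.Away.algebraMap_isUnit s).pow n).mul_left_eq_zero.1 hb
  have hunit : IsUnit (algebraMap R S (Q * N)) := IsLocalization.Away.algebraMap_isUnit s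
  rw [map_mul, IsUnit.mul_iff] at hunit
  obtain ⟨⟨uQ, huQ⟩, ⟨uN, huN⟩⟩ := hunit
  let iQ : S := ↑uQ⁻¹
  let iN : S := ↑uN⁻¹
  have hiQ : algebraMap R S Q * iQ = 1 := by rw [← huQ]; exact uQ.mul_inv
  have hiN : algebraMap R S N * iN = 1 := by rw [← huN]; exact uN.mul_inv
  let c243 : S := algebraMap k S (1 / 243)
  have hc : c243 * 243 = 1 := by
    have : (243 : S) = algebraMap k S 243 := (map_ofNat (algebraMap k S) 243).symm
    rw [this, ← map_mul]; norm_num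
  let J : S := algebraMap R S NJ * iQ ^ 2
  let I₂ : S := algebraMap R S NI * iQ ^ 3
  let I₃ : S := algebraMap R S ((1 - Y) * Z ^ 3) * iQ ^ 5
  let w : S := c243 * algebraMap R S Q ^ 4 * iN
  let A := Algebra.adjoin k {J, I₂, I₃, w}
  let J' : A := ⟨J, Algebra.subset_adjoin (by simp)⟩
  let I₂' : A := ⟨I₂, Algebra.subset_adjoin (by simp)⟩
  let I₃' : A := ⟨I₃, Algebra.subset_adjoin (by simp)⟩
  let w' : A := ⟨w, Algebra.subset_adjoin (by simp)⟩
  let y' : S := algebraMap R S Y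
  let z' : S := algebraMap R S Z
  let q' : S := algebraMap R S q
  have q4' : 4 * q' = 1 := by
    have := congrArg (algebraMap R S) q4
    rwa [map_mul, map_ofNat, map_one] at this
  have aQ : algebraMap R S Q = 2 - 3 * y' ^ 2 := by
    simp only [Q, map_sub, map_mul, map_pow, map_ofNat]; rfl
  have aNJ : algebraMap R S NJ = 1 + (4 - 3 * y') * z' * q' := by
    simp only [NJ, map_add, map_sub, map_mul, map_one, map_ofNat]; rfl
  have aNI : algebraMap R S NI = 8 + 3 * (9 * y' - 8) * z' + 3 * z' ^ 2 * q' ^ 2 := by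
    simp only [NI, map_add, map_sub, map_mul, map_pow, map_ofNat]; rfl
  have aN : algebraMap R S N = algebraMap R S Q * algebraMap R S NI + algebraMap R S NJ ^ 2 := by
    simp only [N, map_add, map_mul, map_pow]
  have eJ : algebraMap A S J' = algebraMap R S NJ * iQ ^ 2 := rfl
  have eI₂ : algebraMap A S I₂' = algebraMap R S NI * iQ ^ 3 := rfl
  have hQJ : algebraMap R S Q ^ 2 * algebraMap A S J' = algebraMap R S NJ := by
    rw [eJ]; linear_combination algebraMap R S NJ * (algebraMap R S Q * iQ + 1) * hiQ
  have hQI₂ : algebraMap R S Q ^ 3 * algebraMap A S I₂' = algebraMap R S NI := by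
    rw [eI₂]
    linear_combination algebraMap R S NI * (algebraMap R S Q ^ 2 * iQ ^ 2
      + algebraMap R S Q * iQ + 1) * hiQ
  have hQI₃ : algebraMap R S Q ^ 5 * algebraMap A S I₃' = (1 - y') * z' ^ 3 := by
    have e1 : algebraMap A S I₃' = algebraMap R S ((1 - Y) * Z ^ 3) * iQ ^ 5 := rfl
    have e2 : algebraMap R S ((1 - Y) * Z ^ 3) = (1 - y') * z' ^ 3 := by
      simp only [map_mul, map_sub, map_one, map_pow]; rfl
    rw [e1, e2, mul_comm, mul_assoc, ← mul_pow, mul_comm iQ, hiQ, one_pow, mul_one]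
  have hw : w' * (243 * (I₂' + J' ^ 2)) = 1 := by
    apply FaithfulSMul.algebraMap_injective A S
    simp only [map_mul, map_add, map_pow, map_ofNat, map_one]
    have e1 : algebraMap A S w' = c243 * algebraMap R S Q ^ 4 * iN := rfl
    rw [e1]
    have : algebraMap R S N = algebraMap R S Q ^ 4 * (algebraMap A S I₂' + algebraMap A S J' ^ 2) := by
      rw [aN, ← hQI₂, ← hQJ]; ring
    rw [this] at hiN
    linear_combination hiN + algebraMap R S Q ^ 4 * (algebraMap A S I₂' + algebraMap A S J' ^ 2)
      * iN * hc
  have hint : IsIntegral A y' := by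
    refine isIntegral_of_invariant_equation J' I₂' w' y' ((4 - 3 * y') * z' * q') hw ?_ ?_
    · rw [← aQ, mul_comm, hQJ, aNJ]; ring
    · rw [← aQ, mul_comm (algebraMap A S I₂'), hQI₂, aNI]
      linear_combination (-3) * (9 * y' - 8) * (4 - 3 * y') ^ 2 * z' * q4'
  let ev' : A →+* k := (ev : S →+* k).comp (algebraMap A S)
  have hJker : J' ∈ RingHom.ker ev' := by
    have : ev' J' = ev J := rfl
    rw [RingHom.mem_ker, this, map_mul, hev, eNJ, zero_mul]
  have hIker : I₃' ∈ RingHom.ker ev' := by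
    have : ev' I₃' = ev I₃ := rfl
    rw [RingHom.mem_ker, this, map_mul, hev, map_mul, map_sub, eY, map_one, sub_self, zero_mul, zero_mul]
  let M := Algebra.adjoin A {y'}
  have hyM : y' ∈ M := Algebra.self_mem_adjoin_singleton A y'
  have hQM : algebraMap R S Q ∈ M := by
    rw [aQ]
    exact sub_mem (ofNat_mem M 2) (mul_mem (ofNat_mem M 3) (pow_mem hyM 2))
  have h43 : 4 - 3 * y' ∈ M := sub_mem (ofNat_mem M 4) (mul_mem (ofNat_mem M 3) hyM)
  have hqM : q' ∈ M := by
    have : q' = algebraMap A S (algebraMap k A (1 / 4)) := by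
      rw [← IsScalarTower.algebraMap_apply k A S, IsScalarTower.algebraMap_apply k R S]; rfl
    rw [this]; exact M.algebraMap_mem _
  have hJM : algebraMap A S J' ∈ M := M.algebraMap_mem _
  have hmem : y' - 1 ∈ RingHom.ker ev' • Subalgebra.toSubmodule M := by
    -- Cube `Q² J - 1 = (4 - 3y) T / 4`, multiply by `1 - y` and replace `(1 - y) T³` by `Q⁵ I₃`.
    -- The left side is `(1 - y)(-1 + J · …)`, so `y - 1` lies in the ideal generated by `J` and
    -- `I₃`.
    have key : y' - 1 = J' • ((y' - 1) * (algebraMap A S J' ^ 2 * algebraMap R S Q ^ 6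
        - 3 * algebraMap A S J' * algebraMap R S Q ^ 4 + 3 * algebraMap R S Q ^ 2))
        + I₃' • (algebraMap R S Q ^ 5 * (4 - 3 * y') ^ 3 * q' ^ 3) := by
      rw [Algebra.smul_def, Algebra.smul_def]
      have e1 : algebraMap R S Q ^ 2 * algebraMap A S J' - 1 = (4 - 3 * y') * z' * q' := by
        rw [hQJ, aNJ]; ring
      have e2 : (algebraMap R S Q ^ 2 * algebraMap A S J' - 1) ^ 3
          = ((4 - 3 * y') * z' * q') ^ 3 := by rw [e1]
      linear_combination (1 - y') * e2 - (4 - 3 * y') ^ 3 * q' ^ 3 * hQI₃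
    have m1 : (y' - 1) * (algebraMap A S J' ^ 2 * algebraMap R S Q ^ 6
        - 3 * algebraMap A S J' * algebraMap R S Q ^ 4 + 3 * algebraMap R S Q ^ 2) ∈ M :=
      mul_mem (sub_mem hyM (one_mem M)) (add_mem (sub_mem
        (mul_mem (pow_mem hJM 2) (pow_mem hQM 6))
        (mul_mem (mul_mem (ofNat_mem M 3) hJM) (pow_mem hQM 4)))
        (mul_mem (ofNat_mem M 3) (pow_mem hQM 2)))
    have m2 : algebraMap R S Q ^ 5 * (4 - 3 * y') ^ 3 * q' ^ 3 ∈ M :=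
      mul_mem (mul_mem (pow_mem hQM 5) (pow_mem h43 3)) (pow_mem hqM 3)
    rw [key]
    exact add_mem (Submodule.smul_mem_smul hJker m1) (Submodule.smul_mem_smul hIker m2)
  obtain ⟨a, b, ha, hab⟩ := exists_mul_eq_algebraMap ev' y' hint hmem
  have ha0 : ι (algebraMap A S a) ≠ 0 := by
    intro h0
    have h1 : algebraMap A S a = 0 := hιinj (h0.trans (map_zero ι).symm)
    have h2 : ev' a = 0 := by
      change ev (algebraMap A S a) = 0
      rw [h1, map_zero]
    rw [ha] at h2
    exact one_ne_zero h2
  set F := adjoin k {(1 + (4 - 3 * y) * T / 4) / (2 - 3 * y ^ 2) ^ 2,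
      (8 + 3 * (9 * y - 8) * T + 3 * T ^ 2 / 16) / (2 - 3 * y ^ 2) ^ 3,
      (1 - y) * T ^ 3 / (2 - 3 * y ^ 2) ^ 5} with hF
  have ιQ : ι iQ = (2 - 3 * y ^ 2)⁻¹ := by
    have := congrArg ι hiQ
    rw [map_mul, hι, fQ, map_one] at this
    exact eq_inv_of_mul_eq_one_right this
  have fNJ : f NJ = 1 + (4 - 3 * y) * T / 4 := by
    simp only [NJ, map_add, map_sub, map_mul, map_ofNat, map_one, fY, fZ, fq]; ring
  have fNI : f NI = 8 + 3 * (9 * y - 8) * T + 3 * T ^ 2 / 16 := by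
    simp only [NI, map_add, map_sub, map_mul, map_pow, map_ofNat, fY, fZ, fq]; ring
  have ιJ : ι J ∈ F := by
    have : ι J = (1 + (4 - 3 * y) * T / 4) / (2 - 3 * y ^ 2) ^ 2 := by
      rw [map_mul, hι, fNJ, map_pow, ιQ, inv_pow, ← div_eq_mul_inv]
    rw [this]; exact subset_adjoin _ _ (by simp)
  have ιI₂ : ι I₂ ∈ F := by
    have : ι I₂ = (8 + 3 * (9 * y - 8) * T + 3 * T ^ 2 / 16) / (2 - 3 * y ^ 2) ^ 3 := by
      rw [map_mul, hι, fNI, map_pow, ιQ, inv_pow, ← div_eq_mul_inv]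
    rw [this]; exact subset_adjoin _ _ (by simp)
  have ιI₃ : ι I₃ ∈ F := by
    have : ι I₃ = (1 - y) * T ^ 3 / (2 - 3 * y ^ 2) ^ 5 := by
      simp only [I₃, map_mul, map_pow, map_sub, map_one, hι, fY, fZ, ιQ]; rw [inv_pow, div_eq_mul_inv]
    rw [this]; exact subset_adjoin _ _ (by simp)
  have ιw : ι w ∈ F := by
    have h1 := congrArg (fun x : A => ι (algebraMap A S x)) hw
    simp only [map_mul, map_add, map_pow, map_ofNat, map_one] at h1
    have : ι w = (243 * (ι I₂ + ι J ^ 2))⁻¹ := eq_inv_of_mul_eq_one_left h1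
    rw [this]
    exact inv_mem (mul_mem (ofNat_mem F 243) (add_mem ιI₂ (pow_mem ιJ 2)))
  have hAF : A ≤ F.toSubalgebra.comap ι := by
    refine Algebra.adjoin_le ?_
    rintro x (rfl | rfl | rfl | rfl)
    exacts [ιJ, ιI₂, ιI₃, ιw]
  have hfin : ι (algebraMap A S a) * y = ι (algebraMap A S b) := by
    rw [← hab, map_mul]; congr 1; exact ((hι Y).trans fY).symm
  rw [eq_div_of_mul_eq ha0 ((mul_comm _ _).trans hfin)]
  exact div_mem (hAF b.2) (hAF a.2)

/-- On the generic pair `y = m / (m - n)` and `T = 192 R / (m - n)³`. With this normalization `J₂ =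
-2 (m - n)² (2 - 3y²)` and `4 J₄ = (m - n)⁴ (1 + (4 - 3y) T / 4)`, which explains the shape of the
left-hand sides. -/
theorem rho_eq_parameters {L : Type*} [Field L] [CharZero L] (r₁ r₂ y T : L) (h1 : r₁ ≠ 0)
    (h48 : r₁ + 48 * r₂ ≠ 0) (hd : rhoDen r₁ r₂ ≠ 0) (hy : y = 48 * r₂ / (r₁ + 48 * r₂))
    (hT : T = 64 / 9 * y ^ 3 / r₁) :
    (1 + (4 - 3 * y) * T / 4) / (2 - 3 * y ^ 2) ^ 2 = rho₁ r₁ r₂ / 9 ∧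
    (8 + 3 * (9 * y - 8) * T + 3 * T ^ 2 / 16) / (2 - 3 * y ^ 2) ^ 3 = 8 / 27 * rho₂ r₁ r₂ ∧
    (1 - y) * T ^ 3 / (2 - 3 * y ^ 2) ^ 5 = -(48 ^ 9 * (64 / 9) ^ 3 / 32 / 521838526464) * rho₃ r₁ r₂ := by
  have hQ : 2 - 3 * y ^ 2 = 2 * rhoDen r₁ r₂ / (r₁ + 48 * r₂) ^ 2 := by
    rw [hy, rhoDen]; field_simp; ring
  rw [hQ]
  obtain ⟨d, hdd⟩ : ∃ d, d = rhoDen r₁ r₂ := ⟨_, rfl⟩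
  rw [← hdd] at hd
  rw [rho₁, rho₂, rho₃, ← hdd]
  rw [rhoDen] at hdd
  rw [hT, hy]
  refine ⟨?_, ?_, ?_⟩
  · field_simp; ring
  · field_simp; ring
  · field_simp; ring

/-- The pairs `(r₁, r₂)` and `(y, T)` determine each other rationally, so `y, T` are independent and
`y` is rational in the invariants. Then `T` follows, because it occurs linearly in the first
invariant. -/
theorem mem_adjoin_rho {k L : Type*} [Field k] [CharZero k] [Field L] [Algebra k L]
    {r₁ r₂ : L} (h : AlgebraicIndependent k ![r₁, r₂]) :
    r₁ ≠ 0 ∧ rhoDen r₁ r₂ ≠ 0 ∧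
    r₁ ∈ adjoin k {rho₁ r₁ r₂, rho₂ r₁ r₂, rho₃ r₁ r₂} ∧
    r₂ ∈ adjoin k {rho₁ r₁ r₂, rho₂ r₁ r₂, rho₃ r₁ r₂} := by
  have : CharZero L := charZero_of_injective_algebraMap (algebraMap k L).injective
  obtain ⟨φ, h0, h1, key⟩ : ∃ φ : MvPolynomial (Fin 2) k →+* L,
      φ (MvPolynomial.X 0) = r₁ ∧ φ (MvPolynomial.X 1) = r₂ ∧
      ∀ P : MvPolynomial (Fin 2) k, MvPolynomial.eval ![1, 1] P ≠ 0 → φ P ≠ 0 :=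
    ⟨(MvPolynomial.aeval ![r₁, r₂] : MvPolynomial (Fin 2) k →ₐ[k] L).toRingHom,
      MvPolynomial.aeval_X _ _, MvPolynomial.aeval_X _ _,
      fun P hP => aeval_ne_zero_of_eval_ne_zero h _ hP⟩
  have hr₁ : r₁ ≠ 0 := by
    have := key (MvPolynomial.X 0) (by simp)
    rwa [h0] at this
  have hr₂ : r₂ ≠ 0 := by
    have := key (MvPolynomial.X 1) (by simp)
    rwa [h1] at this
  have h48 : r₁ + 48 * r₂ ≠ 0 := by
    have := key (MvPolynomial.X 0 + 48 * MvPolynomial.X 1) (by simp; norm_num)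
    simpa only [map_add, map_mul, h0, h1, map_ofNat] using this
  have h12 : r₁ + 12 * r₂ ≠ 0 := by
    have := key (MvPolynomial.X 0 + 12 * MvPolynomial.X 1) (by simp; norm_num)
    simpa only [map_add, map_mul, h0, h1, map_ofNat] using this
  have hd : rhoDen r₁ r₂ ≠ 0 := by
    have := key (-(1152 * MvPolynomial.X 1 ^ 2) + 96 * MvPolynomial.X 1 * MvPolynomial.X 0
      + MvPolynomial.X 0 ^ 2) (by simp; norm_num)
    simp only [map_add, map_neg, map_mul, map_pow, h0, h1, map_ofNat] at this
    rw [rhoDen]; convert this using 1; ring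
  obtain ⟨y, hy⟩ : ∃ y, y = 48 * r₂ / (r₁ + 48 * r₂) := ⟨_, rfl⟩
  obtain ⟨T, hT⟩ : ∃ T, T = 64 / 9 * y ^ 3 / r₁ := ⟨_, rfl⟩
  have hy0 : y ≠ 0 := by
    rw [hy]; exact div_ne_zero (mul_ne_zero (by norm_num) hr₂) h48
  have hT0 : T ≠ 0 := by
    rw [hT]; exact div_ne_zero (mul_ne_zero (by norm_num) (pow_ne_zero _ hy0)) hr₁
  have e1 : r₁ = 64 * y ^ 3 / (9 * T) := by rw [hT]; field_simp
  have h1y : 1 - y = r₁ / (r₁ + 48 * r₂) := by rw [hy]; field_simp; ring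
  have h43 : 4 - 3 * y = 4 * (r₁ + 12 * r₂) / (r₁ + 48 * r₂) := by rw [hy]; field_simp; ring
  have h43' : 4 - 3 * y ≠ 0 := by
    rw [h43]; exact div_ne_zero (mul_ne_zero (by norm_num) h12) h48
  have e2 : r₂ = y * r₁ / (48 * (1 - y)) := by 
    have : ∀ s : L, s ≠ 0 → r₂ = 48 * r₂ / s * r₁ / (48 * (r₁ / s)) := fun s hs => by field_simp
    rw [h1y, hy]; exact this _ h48
  have hmem : ∀ F : IntermediateField k L, y ∈ F → T ∈ F → r₁ ∈ F ∧ r₂ ∈ F := by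
    intro F hyF hTF
    have : r₁ ∈ F := by
      rw [e1]; exact div_mem (mul_mem (ofNat_mem F 64) (pow_mem hyF 3)) (mul_mem (ofNat_mem F 9) hTF)
    refine ⟨this, ?_⟩
    rw [e2]
    exact div_mem (mul_mem hyF this) (mul_mem (ofNat_mem F 48) (sub_mem (one_mem F) hyF))
  have hyT : AlgebraicIndependent k ![y, T] := by
    refine algebraicIndependent_of_isAlgebraic h fun i => ?_
    obtain ⟨m1, m2⟩ := hmem (adjoin k (Set.range ![y, T]))
      (subset_adjoin _ _ ⟨0, rfl⟩) (subset_adjoin _ _ ⟨1, rfl⟩)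
    fin_cases i
    · exact isAlgebraic_algebraMap (⟨r₁, m1⟩ : adjoin k (Set.range ![y, T]))
    · exact isAlgebraic_algebraMap (⟨r₂, m2⟩ : adjoin k (Set.range ![y, T]))
  obtain ⟨f1, f2, f3⟩ := rho_eq_parameters r₁ r₂ y T hr₁ h48 hd hy hT
  set F := adjoin k {rho₁ r₁ r₂, rho₂ r₁ r₂, rho₃ r₁ r₂} with hF
  have n1 : rho₁ r₁ r₂ / 9 ∈ F := div_mem (subset_adjoin _ _ (by simp)) (ofNat_mem F 9)
  have n2 : 8 / 27 * rho₂ r₁ r₂ ∈ F :=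
    mul_mem (div_mem (ofNat_mem F 8) (ofNat_mem F 27)) (subset_adjoin _ _ (by simp))
  have n3 : -(48 ^ 9 * (64 / 9) ^ 3 / 32 / 521838526464) * rho₃ r₁ r₂ ∈ F := by
    refine mul_mem (neg_mem (div_mem (div_mem (mul_mem (pow_mem (ofNat_mem F 48) _)
      (pow_mem (div_mem (ofNat_mem F 64) (ofNat_mem F 9)) _)) (ofNat_mem F 32)) (ofNat_mem F _)))
      (subset_adjoin _ _ (by simp))
  have hyF : y ∈ F := by
    refine (adjoin_le_iff.2 ?_) (mem_adjoin_of_parameters hyT)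
    rintro x (rfl | rfl | rfl)
    · rw [f1]; exact n1
    · rw [f2]; exact n2
    · rw [f3]; exact n3
  have hQ : 2 - 3 * y ^ 2 = 2 * rhoDen r₁ r₂ / (r₁ + 48 * r₂) ^ 2 := by
    rw [hy, rhoDen]; field_simp; ring
  have hQ0 : 2 - 3 * y ^ 2 ≠ 0 := by
    rw [hQ]; exact div_ne_zero (mul_ne_zero (by norm_num) hd) (pow_ne_zero _ h48)
  have hTF : T ∈ F := by
    have : T = 4 * (rho₁ r₁ r₂ / 9 * (2 - 3 * y ^ 2) ^ 2 - 1) / (4 - 3 * y) := by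
      rw [← f1]; field_simp; ring
    rw [this]
    exact div_mem (mul_mem (ofNat_mem F 4) (sub_mem (mul_mem n1 (pow_mem (sub_mem (ofNat_mem F 2)
      (mul_mem (ofNat_mem F 3) (pow_mem hyF 2))) 2)) (one_mem F)))
      (sub_mem (ofNat_mem F 4) (mul_mem (ofNat_mem F 3) hyF))
  exact ⟨hr₁, hd, hmem F hyF hTF⟩

theorem adjoin_rho_eq {k L : Type*} [Field k] [CharZero k] [Field L] [Algebra k L]
    {r₁ r₂ : L} (h : AlgebraicIndependent k ![r₁, r₂]) :
    adjoin k {rho₁ r₁ r₂, rho₂ r₁ r₂, rho₃ r₁ r₂} = adjoin k {r₁, r₂} := by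
  obtain ⟨-, -, m1, m2⟩ := mem_adjoin_rho h
  apply le_antisymm
  · rw [adjoin_le_iff]
    have m1 : r₁ ∈ adjoin k {r₁, r₂} := subset_adjoin _ _ (by simp)
    have m2 : r₂ ∈ adjoin k {r₁, r₂} := subset_adjoin _ _ (by simp)
    have e1 : rho₁ r₁ r₂ = algebraMap (adjoin k {r₁, r₂}) L (rho₁ ⟨r₁, m1⟩ ⟨r₂, m2⟩) := by
      simp only [rho₁, rhoDen, map_div₀, map_mul, map_add, map_neg, map_pow, map_ofNat]; rfl
    have e2 : rho₂ r₁ r₂ = algebraMap (adjoin k {r₁, r₂}) L (rho₂ ⟨r₁, m1⟩ ⟨r₂, m2⟩) := by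
      simp only [rho₂, rhoDen, map_div₀, map_mul, map_add, map_sub, map_neg, map_pow, map_ofNat]; rfl
    have e3 : rho₃ r₁ r₂ = algebraMap (adjoin k {r₁, r₂}) L (rho₃ ⟨r₁, m1⟩ ⟨r₂, m2⟩) := by
      simp only [rho₃, rhoDen, map_div₀, map_mul, map_add, map_neg, map_pow, map_ofNat]; rfl
    rintro x (rfl | rfl | rfl)
    · rw [e1]; exact Subtype.mem _
    · rw [e2]; exact Subtype.mem _
    · rw [e3]; exact Subtype.mem _
  · rw [adjoin_le_iff]
    rintro x (rfl | rfl)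
    exacts [m1, m2]

/-! ### Back to the generic pair `F, G` -/

section GenericPair
variable {k L : Type*} [Field k] [CharZero k] [Field L] [Algebra k L]

theorem betaDen_mul_pow {L : Type*} [Field L] (a b : L) :
    betaDen (a * b) (b ^ 3) = b ^ 3 * resFG a b := by
  rw [betaDen, resFG]; ring

theorem pairInv₁_eq_invUV {L : Type*} [Field L] [CharZero L] (a b : L) (hb : b ≠ 0) :
    pairInv₁ (cubicF a b) (cubicG b) = invUV₁ (a * b) (b ^ 3) := by
  rw [pairInv₁_eq, invUV₁, betaDen_mul_pow,
    show b ^ 3 - 2 * (a * b) - 9 = b ^ 3 - 2 * (a * b) - 9 from rfl,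
    show 27 * (b ^ 3 * resFG a b) = (27 * resFG a b) * b ^ 3 by ring,
    mul_div_mul_right _ _ (pow_ne_zero 3 hb)]

theorem pairInv₂_eq_invUV {L : Type*} [Field L] [CharZero L] (a b : L) (hb : b ≠ 0) :
    pairInv₂ (cubicF a b) (cubicG b) = invUV₂ (a * b) (b ^ 3) := by
  rw [pairInv₂_eq, invUV₂, betaDen_mul_pow,
    show 1296 * (b ^ 3 * resFG a b) * (b ^ 3 - 27) =
      -(-1296 * resFG a b * (b ^ 3 - 27)) * b ^ 3 by ring, ← neg_mul,
    mul_div_mul_right _ _ (pow_ne_zero 3 hb), neg_div_neg_eq]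

theorem algebraicIndependent_uv {a b : L} (h : AlgebraicIndependent k ![a, b]) :
    AlgebraicIndependent k ![a * b, b ^ 3] := by
  have hb : b ≠ 0 := h.ne_zero 1
  refine algebraicIndependent_of_isAlgebraic h fun i => ?_
  set I := adjoin k (Set.range ![a * b, b ^ 3])
  have m1 : a * b ∈ I := subset_adjoin _ _ ⟨0, rfl⟩
  have m2 : b ^ 3 ∈ I := subset_adjoin _ _ ⟨1, rfl⟩
  have hbI : IsAlgebraic I b :=
    IsAlgebraic.of_pow (by norm_num : 0 < 3) (isAlgebraic_algebraMap (⟨_, m2⟩ : I))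
  fin_cases i
  · change IsAlgebraic I a
    have : a = a * b * b⁻¹ := by field_simp
    rw [this]
    exact (isAlgebraic_algebraMap (⟨_, m1⟩ : I)).mul hbI.inv
  · exact hbI

theorem algebraicIndependent_invUV {u v : L} (h : AlgebraicIndependent k ![u, v]) :
    AlgebraicIndependent k ![invUV₁ u v, invUV₂ u v] := by
  have : CharZero L := charZero_of_injective_algebraMap (algebraMap k L).injective
  obtain ⟨hB, hn, hv, hm, -⟩ := generic_ne_zero h
  refine algebraicIndependent_of_isAlgebraic h fun i => ?_
  obtain ⟨h1, h2⟩ := isAlgebraic_of_invUV_mem u v hB hn hv hm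
    (adjoin k (Set.range ![invUV₁ u v, invUV₂ u v]))
    (subset_adjoin _ _ ⟨0, rfl⟩) (subset_adjoin _ _ ⟨1, rfl⟩)
  fin_cases i
  exacts [h1, h2]

theorem algebraicIndependent_pairInv {a b : L} (h : AlgebraicIndependent k ![a, b]) :
    AlgebraicIndependent k
      ![pairInv₁ (cubicF a b) (cubicG b), pairInv₂ (cubicF a b) (cubicG b)] := by
  have : CharZero L := charZero_of_injective_algebraMap (algebraMap k L).injective
  have hb : b ≠ 0 := h.ne_zero 1
  rw [pairInv₁_eq_invUV a b hb, pairInv₂_eq_invUV a b hb]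
  exact algebraicIndependent_invUV (algebraicIndependent_uv h)

theorem generic_pair_ne_zero {a b : L} (h : AlgebraicIndependent k ![a, b]) :
    b ≠ 0 ∧ b ^ 3 - 2 * (a * b) - 9 ≠ 0 ∧ b ^ 3 - 27 ≠ 0 ∧ resFG a b ≠ 0 ∧
      J₂ (sextic a b) ≠ 0 := by
  have : CharZero L := charZero_of_injective_algebraMap (algebraMap k L).injective
  obtain ⟨hB, hn, hv, hm, -⟩ := generic_ne_zero (algebraicIndependent_uv h)
  have hR : resFG a b ≠ 0 := by
    rw [betaDen_mul_pow] at hB; exact right_ne_zero_of_mul hB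
  refine ⟨h.ne_zero 1, hm, hn, hR, fun hJ => ?_⟩
  -- A vanishing `J₂` would make `rhoDen` vanish at the independent elements `r₁, r₂`.
  have hd := (mem_adjoin_rho (algebraicIndependent_pairInv h)).2.1
  rw [J₂_sextic a b _ _ rfl rfl, mul_eq_zero] at hJ
  rw [pairInv₁_eq, pairInv₂_eq, rhoDen_eq _ _ _ hm hn hR, hJ.resolve_left (by norm_num)] at hd
  simp at hd

theorem absInv_sextic {a b : L} (h : AlgebraicIndependent k ![a, b]) (r₁ r₂ : L)
    (hr₁ : r₁ = pairInv₁ (cubicF a b) (cubicG b)) (hr₂ : r₂ = pairInv₂ (cubicF a b) (cubicG b)) :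
    absInv₁ (sextic a b) = rho₁ r₁ r₂ ∧ absInv₂ (sextic a b) = rho₂ r₁ r₂ ∧
      absInv₃ (sextic a b) = rho₃ r₁ r₂ := by
  have : CharZero L := charZero_of_injective_algebraMap (algebraMap k L).injective
  obtain ⟨-, hm, hn, hR, hJ⟩ := generic_pair_ne_zero h
  rw [hr₁, hr₂]
  exact ⟨rho₁_sextic a b hJ hm hn hR, rho₂_sextic a b hJ hm hn hR, rho₃_sextic a b hJ hm hn hR⟩

theorem fieldI_eq_fieldR {a b : L} (h : AlgebraicIndependent k ![a, b]) :
    fieldI k a b = fieldR k a b := by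
  obtain ⟨h1, h2, h3⟩ := absInv_sextic h _ _ rfl rfl
  rw [fieldI, fieldR, h1, h2, h3]
  exact adjoin_rho_eq (algebraicIndependent_pairInv h)

theorem fieldUV_galois {a b : L} (hab : AlgebraicIndependent k ![a, b]) :
    ∃ h : fieldI k a b ≤ fieldUV k a b,
      Module.finrank (fieldI k a b) (extendScalars h) = 2 ∧
      IsGalois (fieldI k a b) (extendScalars h) ∧
      ∃ β : extendScalars h ≃ₐ[fieldI k a b] extendScalars h,
        (β ⟨a * b, u_mem k a b⟩ : L) = betaU (a * b) (b ^ 3) ∧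
        (β ⟨b ^ 3, v_mem k a b⟩ : L) = betaV (a * b) (b ^ 3) ∧
        orderOf β = 2 ∧ Subgroup.zpowers β = ⊤ := by
  have : CharZero L := charZero_of_injective_algebraMap (algebraMap k L).injective
  have hb : b ≠ 0 := hab.ne_zero 1
  refine finrank_adjoin_invUV (algebraicIndependent_uv hab) _ _ ?_ rfl _ _
  rw [fieldI_eq_fieldR hab, fieldR, pairInv₁_eq_invUV a b hb, pairInv₂_eq_invUV a b hb]

end GenericPair

/-! ### The rational inverse of `rho` on points -/

section Inverse
universe u
variable {k : Type u} [Field k]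

/-- The exponent `M` and the numerator `Q` depend neither on `K` nor on `φ`, so one identity serves
both at the generic point and at every rational point. -/
theorem exists_clear_denominators {m n : ℕ} (N : Fin n → MvPolynomial (Fin m) k)
    (D : MvPolynomial (Fin m) k) (P : MvPolynomial (Fin n) k) :
    ∃ (M : ℕ) (Q : MvPolynomial (Fin m) k), ∀ (K : Type u) [Field K] [Algebra k K]
      (φ : MvPolynomial (Fin m) k →ₐ[k] K), φ D ≠ 0 →
      MvPolynomial.aeval (fun j => φ (N j) / φ D) P * φ D ^ M = φ Q := by
  induction P using MvPolynomial.induction_on with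
  | C c =>
    refine ⟨0, MvPolynomial.C c, fun K _ _ φ _ => ?_⟩
    rw [MvPolynomial.aeval_C, pow_zero, mul_one]
    exact (φ.commutes c).symm
  | add p q hp hq =>
    obtain ⟨a, P, hP⟩ := hp
    obtain ⟨b, Q, hQ⟩ := hq
    refine ⟨a + b, P * D ^ b + Q * D ^ a, fun K _ _ φ h => ?_⟩
    rw [map_add, map_add, map_mul, map_mul, map_pow, map_pow, ← hP K φ h, ← hQ K φ h]
    ring
  | mul_X p j hp =>
    obtain ⟨a, P, hP⟩ := hp
    refine ⟨a + 1, P * N j, fun K _ _ φ h => ?_⟩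
    rw [map_mul, map_mul, MvPolynomial.aeval_X, ← hP K φ h]
    field_simp
    ring

variable [CharZero k]

variable (k) in
/-- Numerators and common denominator of the coordinates of `rho`. -/
theorem exists_rho_fractions : ∃ (N : Fin 3 → MvPolynomial (Fin 2) k) (D : MvPolynomial (Fin 2) k),
    D ≠ 0 ∧ ∀ (K : Type u) [Field K] [Algebra k K] (φ : MvPolynomial (Fin 2) k →ₐ[k] K),
      φ D ≠ 0 → φ (.X 0) ≠ 0 ∧ rhoDen (φ (.X 0)) (φ (.X 1)) ≠ 0 ∧
        ∀ j, ![rho₁ (φ (.X 0)) (φ (.X 1)), rho₂ (φ (.X 0)) (φ (.X 1)),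
          rho₃ (φ (.X 0)) (φ (.X 1))] j = φ (N j) / φ D := by
  let x : MvPolynomial (Fin 2) k := .X 0
  let y : MvPolynomial (Fin 2) k := .X 1
  let d : MvPolynomial (Fin 2) k := -1152 * y ^ 2 + 96 * y * x + x ^ 2
  let D : MvPolynomial (Fin 2) k := 8 * x ^ 2 * d ^ 5
  let N : Fin 3 → MvPolynomial (Fin 2) k := ![
    18 * (13824 * x ^ 3 * y ^ 2 + 442368 * x ^ 2 * y ^ 3 + 5308416 * x * y ^ 4
    + 192 * x ^ 4 * y + x ^ 5 + 786432 * x * y ^ 3 + 9437184 * y ^ 4) * x * d ^ 3,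
    27 * (79626240 * x ^ 4 * y ^ 4
    - 4076863488 * x ^ 2 * y ^ 5 + 34560 * x ^ 6 * y ^ 2 + 12230590464 * x ^ 2 * y ^ 6
    + 32614907904 * x * y ^ 6 + 14495514624 * y ^ 6 + 288 * x ^ 7 * y
    + 2211840 * x ^ 5 * y ^ 3 + x ^ 8 - 212336640 * x ^ 3 * y ^ 4
    + 1528823808 * x ^ 3 * y ^ 5 - 2359296 * x ^ 4 * y ^ 3) * d ^ 2,
    -4174708211712 * y ^ 9]
  have key : ∀ (K : Type u) [Field K] [Algebra k K] (φ : MvPolynomial (Fin 2) k →ₐ[k] K),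
      φ D = 8 * φ x ^ 2 * rhoDen (φ x) (φ y) ^ 5 := by
    intro K _ _ φ
    simp only [D, d, map_mul, map_add, map_neg, map_pow, map_ofNat, rhoDen]
  refine ⟨N, D, ?_, ?_⟩
  · intro h0
    have h := key k (MvPolynomial.aeval ![1, 1])
    have hx : (MvPolynomial.aeval ![1, 1] : MvPolynomial (Fin 2) k →ₐ[k] k) x = 1 :=
      MvPolynomial.aeval_X _ _
    have hy : (MvPolynomial.aeval ![1, 1] : MvPolynomial (Fin 2) k →ₐ[k] k) y = 1 :=
      MvPolynomial.aeval_X _ _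
    rw [h0, map_zero, hx, hy, rhoDen] at h
    norm_num at h
  · intro K _ _ φ hD
    have : CharZero K := charZero_of_injective_algebraMap (algebraMap k K).injective
    rw [key] at hD
    have hx : φ x ≠ 0 := by
      rintro h; rw [h] at hD; simp at hD
    have hd : rhoDen (φ x) (φ y) ≠ 0 := by
      rintro h; rw [h] at hD; simp at hD
    refine ⟨hx, hd, ?_⟩
    have hφd : φ d = rhoDen (φ x) (φ y) := by
      simp only [d, map_mul, map_add, map_neg, map_pow, map_ofNat, rhoDen]
    rw [key]
    change ∀ j, ![rho₁ (φ x) (φ y), rho₂ (φ x) (φ y), rho₃ (φ x) (φ y)] j = _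
    rw [Fin.forall_fin_succ, Fin.forall_fin_two]
    refine ⟨?_, ?_, ?_⟩
    · change rho₁ (φ x) (φ y) = φ (N 0) / _
      simp only [N, Matrix.cons_val_zero, map_mul, map_add, map_pow, map_ofNat, hφd, rho₁]
      field_simp
      ring
    · change rho₂ (φ x) (φ y) = φ (N 1) / _
      simp only [N, Matrix.cons_val_one, Matrix.cons_val_zero, map_mul, map_add, map_sub, map_pow,
        map_ofNat, hφd, rho₂]
      field_simp
    · change rho₃ (φ x) (φ y) = φ (N 2) / _
      simp only [N, Matrix.cons_val, map_mul, map_neg, map_pow, map_ofNat, rho₃]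
      field_simp
      ring

theorem range_vec_three {α : Type*} (a b c : α) : Set.range ![a, b, c] = {a, b, c} := by
  ext x
  rw [Set.mem_range, Fin.exists_fin_succ, Fin.exists_fin_two]
  simp only [Set.mem_insert_iff, Set.mem_singleton_iff, eq_comm (a := x)]
  rfl

/-- In the rational function field the coordinates are quotients `A / B` of polynomials in the `iⱼ`.
Cleared of denominators this is a polynomial identity, which specializes wherever the common
denominator `D` and the numerator of `B` do not vanish. -/
theorem exists_rho_inverse : ∃ g : MvPolynomial (Fin 2) k, g ≠ 0 ∧
    ∃ A B : Fin 2 → MvPolynomial (Fin 3) k, ∀ p, MvPolynomial.eval p g ≠ 0 → ∀ j,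
      MvPolynomial.eval (rho p) (B j) ≠ 0 ∧
      p j = MvPolynomial.eval (rho p) (A j) / MvPolynomial.eval (rho p) (B j) := by
  obtain ⟨N, D, hD0, hND⟩ := exists_rho_fractions k
  let L := FractionRing (MvPolynomial (Fin 2) k)
  let φ : MvPolynomial (Fin 2) k →ₐ[k] L := IsScalarTower.toAlgHom k _ L
  have hφ : Function.Injective φ := IsFractionRing.injective (MvPolynomial (Fin 2) k) L
  have hφX : (fun i => φ (.X i)) = ![φ (.X 0), φ (.X 1)] := by
    ext i; fin_cases i <;> rfl
  have hind : AlgebraicIndependent k ![φ (.X 0), φ (.X 1)] := by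
    rw [← hφX]
    exact (MvPolynomial.algebraicIndependent_X (Fin 2) k).map' hφ
  have hφD : φ D ≠ 0 := fun h => hD0 (hφ (h.trans (map_zero φ).symm))
  obtain ⟨-, -, m0, m1⟩ := mem_adjoin_rho hind
  obtain ⟨-, -, hj⟩ := hND L φ hφD
  have hrange : ({rho₁ (φ (.X 0)) (φ (.X 1)), rho₂ (φ (.X 0)) (φ (.X 1)),
      rho₃ (φ (.X 0)) (φ (.X 1))} : Set L) = Set.range (fun j => φ (N j) / φ D) := by
    rw [← funext hj, range_vec_three]
  have key : ∀ j : Fin 2, ∃ (A B : MvPolynomial (Fin 3) k) (g : MvPolynomial (Fin 2) k), g ≠ 0 ∧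
      ∀ p, MvPolynomial.eval p g ≠ 0 → MvPolynomial.eval (rho p) B ≠ 0 ∧
        p j = MvPolynomial.eval (rho p) A / MvPolynomial.eval (rho p) B := by
    intro j
    have hmem : φ (.X j) ∈ adjoin k (Set.range (fun j => φ (N j) / φ D)) := by
      rw [← hrange]; fin_cases j
      exacts [m0, m1]
    obtain ⟨A, B, hAB⟩ := (mem_adjoin_range_iff k _ _).1 hmem
    obtain ⟨a, A', hA⟩ := exists_clear_denominators N D A
    obtain ⟨b, B', hB⟩ := exists_clear_denominators N D B
    have hX0 : φ (.X j) ≠ 0 := by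
      intro h; exact MvPolynomial.X_ne_zero j (hφ (h.trans (map_zero φ).symm))
    have hBne : MvPolynomial.aeval (fun j => φ (N j) / φ D) B ≠ 0 := by
      intro h; rw [h, div_zero] at hAB; exact hX0 hAB
    have hB' : B' ≠ 0 := by
      intro h
      have := hB L φ hφD
      rw [h, map_zero, mul_eq_zero] at this
      exact this.elim hBne (pow_ne_zero _ hφD)
    have hid : .X j * B' * D ^ a = A' * D ^ b := by
      apply hφ
      rw [map_mul, map_mul, map_mul, map_pow, map_pow, ← hA L φ hφD, ← hB L φ hφD, hAB,
        ← mul_assoc, div_mul_cancel₀ _ hBne, mul_right_comm]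
    refine ⟨A, B, B' * D, mul_ne_zero hB' hD0, fun p hp => ?_⟩
    let ψ : MvPolynomial (Fin 2) k →ₐ[k] k := MvPolynomial.aeval p
    have hψ : ∀ q, ψ q = MvPolynomial.eval p q := fun q => MvPolynomial.aeval_eq_eval p ▸ rfl
    rw [map_mul, mul_ne_zero_iff, ← hψ, ← hψ] at hp
    have hrho : rho p = fun j => ψ (N j) / ψ D := by
      ext i
      rw [← (hND k ψ hp.2).2.2 i, hψ, hψ, MvPolynomial.eval_X, MvPolynomial.eval_X]
      rfl
    have eA : MvPolynomial.eval (rho p) A * ψ D ^ a = ψ A' := by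
      rw [← hA k ψ hp.2, hrho, MvPolynomial.aeval_eq_eval]; rfl
    have eB : MvPolynomial.eval (rho p) B * ψ D ^ b = ψ B' := by
      rw [← hB k ψ hp.2, hrho, MvPolynomial.aeval_eq_eval]; rfl
    have hBp : MvPolynomial.eval (rho p) B ≠ 0 := by
      intro h; rw [h, zero_mul] at eB; exact hp.1 eB.symm
    refine ⟨hBp, ?_⟩
    have := congrArg ψ hid
    rw [map_mul, map_mul, map_mul, map_pow, map_pow, ← eA, ← eB, hψ (.X j), MvPolynomial.eval_X]
      at this
    rw [eq_div_iff hBp]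
    apply mul_right_cancel₀ (pow_ne_zero (a + b) hp.2)
    linear_combination this
  choose A B g hg h using key
  refine ⟨g 0 * g 1, mul_ne_zero (hg 0) (hg 1), A, B, fun p hp => ?_⟩
  rw [map_mul, mul_ne_zero_iff] at hp
  rw [Fin.forall_fin_two]
  exact ⟨h 0 p hp.1, h 1 p hp.2⟩

end Inverse

/-! ### Hyperelliptic function fields and degrees of subfields -/

section FunctionField
variable {k K : Type*} [Field k] [Field K] [Algebra k K] {x : K}

theorem aeval_ne_zero_of_transcendental (hx : Transcendental k x) {p : k[X]} (hp : p ≠ 0) :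
    aeval x p ≠ 0 := fun h => hx ⟨p, hp, h⟩

theorem aeval_mem_adjoin (p : k[X]) : aeval x p ∈ adjoin k {x} := by
  have : aeval x p = algebraMap (adjoin k {x}) K (aeval (⟨x, mem_adjoin_simple_self k x⟩ :
    adjoin k {x}) p) := by rw [← aeval_algebraMap_apply]; rfl
  rw [this]; exact Subtype.mem _

/-- Every element of `k(x)` is a quotient of coprime polynomials in `x`. -/
theorem exists_coprime_of_mem_adjoin (hx : Transcendental k x) {s : K} (hs : s ∈ adjoin k {x}) :
    ∃ P Q : k[X], IsCoprime P Q ∧ Q ≠ 0 ∧ s = aeval x P / aeval x Q := by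
  let e := RatFunc.algEquivOfTranscendental x hx
  obtain ⟨f, hf⟩ := e.surjective ⟨s, hs⟩
  refine ⟨f.num, f.denom, f.isCoprime_num_denom, f.denom_ne_zero, ?_⟩
  rw [← RatFunc.algEquivOfTranscendental_apply x hx]
  exact (congrArg Subtype.val hf).symm

theorem natDegree_eq_of_coprime {P Q A B : k[X]} (h : IsCoprime P Q) (h' : IsCoprime A B)
    (he : A * Q = P * B) :
    P.natDegree = A.natDegree ∧ Q.natDegree = B.natDegree := by
  have h1 : Associated P A := associated_of_dvd_dvd
    (h.dvd_of_dvd_mul_right (he ▸ dvd_mul_right P B))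
    (h'.dvd_of_dvd_mul_right (he ▸ dvd_mul_right A Q))
  have h2 : Associated Q B := associated_of_dvd_dvd
    (h.symm.dvd_of_dvd_mul_left (he ▸ dvd_mul_left Q A))
    (h'.symm.dvd_of_dvd_mul_left (he.symm ▸ dvd_mul_left B P))
  exact ⟨natDegree_eq_of_degree_eq (degree_eq_degree_of_associated h1),
    natDegree_eq_of_degree_eq (degree_eq_degree_of_associated h2)⟩

/-- The degree of `k(x)` over `k(P(x)/Q(x))`. -/
theorem relfinrank_adjoin_div (hx : Transcendental k x) {P Q : k[X]} (h : IsCoprime P Q)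
    (hQ : Q ≠ 0) : relfinrank (adjoin k {aeval x P / aeval x Q}) (adjoin k {x}) =
      max P.natDegree Q.natDegree := by
  let e := RatFunc.algEquivOfTranscendental x hx
  let ι : RatFunc k →ₐ[k] K := (adjoin k {x}).val.comp e.toAlgHom
  let f : RatFunc k := algebraMap k[X] (RatFunc k) P / algebraMap k[X] (RatFunc k) Q
  have hι : ∀ p : k[X], ι (algebraMap k[X] (RatFunc k) p) = aeval x p := by
    intro p
    have : ι (algebraMap k[X] (RatFunc k) p) = algebraMap (adjoin k {x}) K
      (aeval (AdjoinSimple.gen k x) p) := congrArg Subtype.val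
        (RatFunc.algEquivOfTranscendental_algebraMap x hx p)
    rw [this, ← aeval_algebraMap_apply]; rfl
  have hf : ι f = aeval x P / aeval x Q := by rw [map_div₀, hι, hι]
  have h1 : (adjoin k {f}).map ι = adjoin k {aeval x P / aeval x Q} := by
    rw [adjoin_map, Set.image_singleton, hf]
  have h2 : (⊤ : IntermediateField k (RatFunc k)).map ι = adjoin k {x} := by
    rw [← AlgHom.fieldRange_eq_map]
    ext z
    constructor
    · rintro ⟨w, rfl⟩; exact (e w).2
    · intro hz
      obtain ⟨w, hw⟩ := e.surjective ⟨z, hz⟩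
      exact ⟨w, congrArg Subtype.val hw⟩
  rw [← h1, ← h2, relfinrank_map_map, relfinrank_top_right, RatFunc.finrank_eq_max_natDegree]
  have he : f.num * Q = P * f.denom := (RatFunc.num_mul_eq_mul_denom_iff hQ).2 rfl
  obtain ⟨e1, e2⟩ := natDegree_eq_of_coprime h f.isCoprime_num_denom he
  rw [e1, e2]

/-- Adjoining a square root to an intermediate field. -/
theorem finrank_adjoin_sqrt {F : IntermediateField k K} {y : K} (hy : y ∉ F) (hy2 : y ^ 2 ∈ F) :
    Module.finrank F (adjoin F {y}) = 2 := by
  let c : F := ⟨y ^ 2, hy2⟩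
  have hroot : aeval y (X ^ 2 - C c) = 0 := by simp [c]
  have hmon : (X ^ 2 - C c).Monic := monic_X_pow_sub_C c two_ne_zero
  have hint : IsIntegral F y := ⟨_, hmon, hroot⟩
  rw [adjoin.finrank hint]
  apply le_antisymm
  · have := natDegree_le_of_dvd (minpoly.dvd F y hroot) hmon.ne_zero
    rwa [natDegree_X_pow_sub_C] at this
  · rw [minpoly.two_le_natDegree_iff hint]
    rintro ⟨z, rfl⟩
    exact hy z.2

theorem relfinrank_adjoin_sqrt {S : Set K} {F : IntermediateField k K} {y : K} (hy : y ∉ F)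
    (hy2 : y ^ 2 ∈ F) (hF : F = adjoin k S) : relfinrank F (adjoin k (insert y S)) = 2 := by
  have hle : F ≤ adjoin k (insert y S) := by
    rw [hF]; exact adjoin.mono _ _ _ (Set.subset_insert _ _)
  rw [relfinrank_eq_finrank_of_le hle, ← finrank_adjoin_sqrt hy hy2]
  have : extendScalars hle = adjoin F {y} := by
    apply restrictScalars_injective k
    rw [extendScalars_restrictScalars, restrictScalars_adjoin, hF]
    apply le_antisymm
    · rw [adjoin_le_iff, Set.insert_subset_iff]
      exact ⟨subset_adjoin _ _ (Or.inr rfl), (subset_adjoin k S).trans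
        (Set.subset_union_left.trans (subset_adjoin _ _))⟩
    · rw [adjoin_le_iff, Set.union_subset_iff]
      refine ⟨?_, ?_⟩
      · exact adjoin.mono k _ _ (Set.subset_insert y S)
      · rintro _ rfl; exact subset_adjoin _ _ (Set.mem_insert _ _)
  rw [this]

section Model
variable {f : k[X]} {y : K}

/-- If `P / Q` in lowest terms were a square root of `f`, then `Q` would be a unit and `P²` would
divide the squarefree `f`, making `f` constant. -/
theorem GenusTwo.IsGenusTwoModel.notMem (h : IsGenusTwoModel f x y) : y ∉ adjoin k {x} := by
  intro hy
  obtain ⟨P, Q, hPQ, hQ, rfl⟩ := exists_coprime_of_mem_adjoin h.transcendental hy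
  have h1 := h.equation
  have hQ' := aeval_ne_zero_of_transcendental h.transcendental hQ
  rw [div_pow, div_eq_iff (pow_ne_zero 2 hQ'), ← map_pow, ← map_pow, ← map_mul] at h1
  have h2 : P ^ 2 = f * Q ^ 2 := by
    by_contra hne
    refine aeval_ne_zero_of_transcendental h.transcendental (sub_ne_zero.2 hne) ?_
    rw [map_sub, h1, sub_self]
  have hcop : IsCoprime (P ^ 2) (Q ^ 2) := hPQ.pow
  have hu : IsUnit (Q ^ 2) := hcop.isUnit_of_dvd' (Dvd.intro_left f h2.symm) dvd_rfl
  have hPf : P ^ 2 ∣ f := by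
    obtain ⟨w, hw⟩ := hu
    exact ⟨↑w⁻¹, by rw [h2, mul_assoc, ← hw, Units.mul_inv, mul_one]⟩
  have hPu : IsUnit P := h.separable.squarefree P (by rwa [← sq])
  have : (P ^ 2).natDegree = (f * Q ^ 2).natDegree := by rw [h2]
  rw [natDegree_mul h.separable.ne_zero (pow_ne_zero 2 hQ), natDegree_eq_zero_of_isUnit hu,
    natDegree_pow, natDegree_eq_zero_of_isUnit hPu] at this
  rcases h.natDegree_eq with h5 | h5 <;> omega

theorem GenusTwo.IsGenusTwoModel.finrank_eq_two (h : IsGenusTwoModel f x y) :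
    Module.finrank (adjoin k {x}) K = 2 := by
  have h1 := relfinrank_adjoin_sqrt (S := {x}) h.notMem
    (by rw [h.equation]; exact aeval_mem_adjoin f) rfl
  rw [Set.pair_comm, h.adjoin_eq_top, relfinrank_top_right] at h1
  exact h1

/-- Rational functions `s = P/Q` and `t = y·L/M` with `t² = g(s)` give an elliptic subfield. -/
theorem GenusTwo.IsGenusTwoModel.hasDegreeThreeEllipticSubfield (h : IsGenusTwoModel f x y)
    {P Q L M g : k[X]} (hPQ : IsCoprime P Q) (hQ : Q ≠ 0) (hdeg : max P.natDegree Q.natDegree = 3)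
    (hL : L ≠ 0) (hM : M ≠ 0) (hg : g.Separable) (hg3 : g.natDegree = 3)
    (heq : (y * (aeval x L / aeval x M)) ^ 2 = aeval (aeval x P / aeval x Q) g) :
    HasDegreeThreeEllipticSubfield k K := by
  have hx := h.transcendental
  obtain ⟨s, hs⟩ : ∃ s, s = aeval x P / aeval x Q := ⟨_, rfl⟩
  obtain ⟨t, ht⟩ : ∃ t, t = y * (aeval x L / aeval x M) := ⟨_, rfl⟩
  rw [← hs, ← ht] at heq
  have hs_mem : s ∈ adjoin k {x} := by
    rw [hs]; exact div_mem (aeval_mem_adjoin P) (aeval_mem_adjoin Q)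
  have hle : adjoin k {s} ≤ adjoin k {x} := by
    rw [adjoin_le_iff]; rintro _ rfl; exact hs_mem
  have hr : relfinrank (adjoin k {s}) (adjoin k {x}) = 3 := by
    rw [hs, relfinrank_adjoin_div hx hPQ hQ, hdeg]
  -- The degree 6 is 3 for `k(x)` over `k(s)` times 2 for `K` over `k(x)`. As `k(s, t)` has degree 2
  -- over `k(s)`, degree 3 remains for `K` over `k(s, t)`.
  have h6 : Module.finrank (adjoin k {s}) K = 6 := by
    rw [← relfinrank_mul_finrank_top hle, hr, h.finrank_eq_two]
  have hyt : y = t * (aeval x M / aeval x L) := by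
    have := aeval_ne_zero_of_transcendental hx hL
    have := aeval_ne_zero_of_transcendental hx hM
    rw [ht]; field_simp
  have ht_not : t ∉ adjoin k {s} := by
    intro hm
    apply h.notMem
    rw [hyt]
    exact mul_mem (hle hm) (div_mem (aeval_mem_adjoin M) (aeval_mem_adjoin L))
  have h2 := relfinrank_adjoin_sqrt (S := {s}) ht_not
    (by rw [heq]; exact aeval_mem_adjoin g) rfl
  rw [Set.pair_comm] at h2
  -- If `s` were algebraic, then `K`, being finite over `k(s)`, would be finite over `k`.
  have hs_tr : Transcendental k s := by
    intro halg
    have : FiniteDimensional k (adjoin k {s}) := adjoin.finiteDimensional halg.isIntegral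
    have : FiniteDimensional (adjoin k {s}) K := Module.finite_of_finrank_pos (by rw [h6]; norm_num)
    have : FiniteDimensional k K := Module.Finite.trans (adjoin k {s}) K
    exact hx (Algebra.IsAlgebraic.isAlgebraic x)
  refine ⟨adjoin k {s, t}, ⟨g, s, t, hg, hg3, hs_tr, heq, rfl⟩, ?_⟩
  have h7 := relfinrank_mul_finrank_top (show adjoin k {s} ≤ adjoin k {s, t} from
    adjoin.mono _ _ _ (by simp))
  rw [h2, h6] at h7
  omega

end Model

universe u in
/-- Every separable polynomial of degree 5 or 6 defines a genus 2 function field. -/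
theorem exists_isGenusTwoModel {k : Type u} [Field k] {f : k[X]} (hf : f.Separable)
    (hdeg : f.natDegree = 5 ∨ f.natDegree = 6) :
    ∃ (K : Type u) (_ : Field K) (_ : Algebra k K) (x y : K), IsGenusTwoModel f x y := by
  let Ω := AlgebraicClosure (RatFunc k)
  let ξ : Ω := algebraMap (RatFunc k) Ω RatFunc.X
  obtain ⟨η, hη⟩ := IsAlgClosed.exists_pow_nat_eq (aeval ξ f) (n := 2) (by norm_num)
  let K := adjoin k {ξ, η}
  let x : K := ⟨ξ, subset_adjoin _ _ (by simp)⟩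
  let y : K := ⟨η, subset_adjoin _ _ (by simp)⟩
  refine ⟨K, inferInstance, inferInstance, x, y, hf, hdeg, ?_, ?_, ?_⟩
  · rw [← transcendental_algebraMap_iff (algebraMap K Ω).injective]
    change Transcendental k ξ
    rw [transcendental_algebraMap_iff (algebraMap (RatFunc k) Ω).injective]
    exact RatFunc.transcendental_X
  · apply (algebraMap K Ω).injective
    rw [map_pow, ← aeval_algebraMap_apply]
    exact hη
  · apply map_injective K.val
    rw [adjoin_map, ← AlgHom.fieldRange_eq_map, fieldRange_val, Set.image_pair]
    rfl

end FunctionField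

/-! ### The curves `Y² = F G` lie on the locus -/

section LocusPoints

theorem separable_of_discr_ne_zero {k : Type*} [Field k] {f : k[X]} (hf : f.natDegree = 3)
    (h : f.discr ≠ 0) : f.Separable := by
  have hf0 : f ≠ 0 := by rintro rfl; simp at hf
  have h1 := resultant_derivative_self_three f hf
  have h2 : resultant (derivative f) f 2 3 ≠ 0 := by
    rw [h1]; exact neg_ne_zero.2 (mul_ne_zero (leadingCoeff_ne_zero.2 hf0) h)
  obtain ⟨p, q, -, -, hpq⟩ := exists_mul_add_mul_eq_C_resultant (derivative f) f
    ((natDegree_derivative_le f).trans (by omega) : (derivative f).natDegree ≤ 2) hf.le (by norm_num)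
  refine ⟨C (resultant (derivative f) f 2 3)⁻¹ * q, C (resultant (derivative f) f 2 3)⁻¹ * p, ?_⟩
  have : C (resultant (derivative f) f 2 3)⁻¹ * C (resultant (derivative f) f 2 3) = 1 := by
    rw [← C_mul, inv_mul_cancel₀ h2, C_1]
  linear_combination C (resultant (derivative f) f 2 3)⁻¹ * hpq + this

variable {k : Type*} [Field k] [CharZero k] {a b : k}

theorem isCoprime_cubicF_cubicG (hR : resFG a b ≠ 0) : IsCoprime (cubicF a b) (cubicG b) := by
  rw [← cubicR_eq, cubicR] at hR
  obtain ⟨p, q, -, -, hpq⟩ := exists_mul_add_mul_eq_C_resultant (cubicG b) (cubicF a b)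
    (natDegree_cubicG b).le (natDegree_cubicF a b).le (by norm_num)
  refine ⟨C (resultant (cubicG b) (cubicF a b) 3 3)⁻¹ * q,
    C (resultant (cubicG b) (cubicF a b) 3 3)⁻¹ * p, ?_⟩
  have : C (resultant (cubicG b) (cubicF a b) 3 3)⁻¹ * C (resultant (cubicG b) (cubicF a b) 3 3)
    = 1 := by rw [← C_mul, inv_mul_cancel₀ hR, C_1]
  linear_combination C (resultant (cubicG b) (cubicF a b) 3 3)⁻¹ * hpq + this

theorem separable_sextic (hn : b ^ 3 - 27 ≠ 0) (hR : resFG a b ≠ 0) :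
    (sextic a b).Separable := by
  refine (separable_of_discr_ne_zero (natDegree_cubicF a b) ?_).mul
    (separable_of_discr_ne_zero (natDegree_cubicG b) ?_) (isCoprime_cubicF_cubicG hR)
  · rw [discr_cubicF]; exact neg_ne_zero.2 hR
  · rw [discr_cubicG]; exact mul_ne_zero (by norm_num) hn

theorem natDegree_sextic (a b : k) : (sextic a b).natDegree = 6 := by
  rw [sextic_eq]; compute_degree!

/-- The elliptic subfield of degree 3 of `Y² = F(X) G(X)`. -/
theorem hasDegreeThreeEllipticSubfield_sextic {K : Type*} [Field K] [Algebra k K] {x y : K}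
    (h : IsGenusTwoModel (sextic a b) x y) (hn : b ^ 3 - 27 ≠ 0) (hR : resFG a b ≠ 0) :
    HasDegreeThreeEllipticSubfield k K := by
  -- The subfield is generated by `s = x² / F` and `t = y L / F²` with `L = X³ - bX - 2`, where `-X
  -- L / F²` is the derivative of `X² / F`. The cubic `g` is the one with `G L² = F³ g(X² / F)`; its
  -- discriminant is `16 (b³ - 27)³`.
  let g : k[X] := C (-resFG a b) * X ^ 3 + C (12 * a ^ 2 - 2 * a * b ^ 2 - 18 * b) * X ^ 2
    + C (b ^ 2 - 12 * a) * X + C 4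
  have hR' : -resFG a b ≠ 0 := neg_ne_zero.2 hR
  have hg3 : g.natDegree = 3 := natDegree_cubic hR'
  have hgd : g.discr ≠ 0 := by
    rw [discr_of_degree_eq_three (degree_cubic hR')]
    have c0 : g.coeff 0 = 4 := by simp [g, -map_sub, -map_mul, -map_neg]
    have c1 : g.coeff 1 = b ^ 2 - 12 * a := by
      simp [g, -map_sub, -map_mul, -map_neg, coeff_C]
    have c2 : g.coeff 2 = 12 * a ^ 2 - 2 * a * b ^ 2 - 18 * b := by
      simp [g, -map_sub, -map_mul, -map_neg]
    have c3 : g.coeff 3 = -resFG a b := by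
      simp [g, -map_sub, -map_mul, -map_neg]
    rw [c0, c1, c2, c3]
    have : 16 * (b ^ 3 - 27) ^ 3 ≠ 0 := mul_ne_zero (by norm_num) (pow_ne_zero 3 hn)
    convert this using 1
    rw [resFG]; ring
  have hF0 : cubicF a b ≠ 0 := by
    intro h0; have := natDegree_cubicF a b; rw [h0] at this; simp at this
  have hcop : IsCoprime (X ^ 2) (cubicF a b) := by
    refine IsCoprime.pow_left ⟨-(X ^ 2 + C a * X + C b), 1, ?_⟩
    rw [cubicF]; ring
  let L : k[X] := X ^ 3 - C b * X - C 2
  have hL : L ≠ 0 := by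
    have : L.natDegree = 3 := by simp only [L]; compute_degree!
    intro h0; rw [h0] at this; simp at this
  refine h.hasDegreeThreeEllipticSubfield hcop hF0 ?_ hL (pow_ne_zero 2 hF0)
    (separable_of_discr_ne_zero hg3 hgd) hg3 ?_
  · rw [natDegree_X_pow, natDegree_cubicF]; norm_num
  · have hF := aeval_ne_zero_of_transcendental h.transcendental hF0
    have heq := h.equation
    rw [sextic, map_mul] at heq
    have key : cubicG b * L ^ 2 = C (-resFG a b) * X ^ 6
        + C (12 * a ^ 2 - 2 * a * b ^ 2 - 18 * b) * X ^ 4 * cubicF a b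
        + C (b ^ 2 - 12 * a) * X ^ 2 * cubicF a b ^ 2 + C 4 * cubicF a b ^ 3 := by
      simp only [L, cubicF, cubicG, resFG, map_sub, map_mul, map_add, map_pow, map_neg, map_ofNat]
      ring
    have key' := congrArg (aeval x) key
    simp only [map_mul, map_add, map_pow, aeval_C, aeval_X] at key'
    simp only [g, map_mul, map_add, map_pow, aeval_C, aeval_X]
    rw [mul_pow, heq]
    generalize aeval x (cubicF a b) = φ at *
    generalize aeval x (cubicG b) = γ at *
    generalize aeval x L = l at *
    generalize algebraMap k K (12 * a ^ 2 - 2 * a * b ^ 2 - 18 * b) = c₂ at *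
    generalize algebraMap k K (b ^ 2 - 12 * a) = c₁ at *
    field_simp
    linear_combination key'

/-- The curves `Y² = F(X) G(X)` give points of the locus. -/
theorem absInv_sextic_mem_locusL₃ (hn : b ^ 3 - 27 ≠ 0) (hR : resFG a b ≠ 0)
    (hJ : J₂ (sextic a b) ≠ 0) :
    ![absInv₁ (sextic a b), absInv₂ (sextic a b), absInv₃ (sextic a b)] ∈ locusL₃ k := by
  obtain ⟨K, _, _, x, y, h⟩ := exists_isGenusTwoModel (separable_sextic hn hR)
    (Or.inr (natDegree_sextic a b))
  exact ⟨K, _, _, sextic a b, x, y, h, hasDegreeThreeEllipticSubfield_sextic h hn hR, hJ, rfl⟩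

/-- Almost all pairs `(r₁, r₂)` are the invariants of a pair `(F, G)`. -/
theorem exists_pairInv_eq [IsAlgClosed k] {r₁ r₂ : k} (h1 : r₁ ≠ 0) (h2 : r₂ ≠ 0)
    (h3 : 5 * r₁ + 432 * r₂ ≠ 0) (h4 : r₁ + 144 * r₂ ≠ 0) :
    ∃ a b : k, b ≠ 0 ∧ b ^ 3 - 2 * (a * b) - 9 ≠ 0 ∧ b ^ 3 - 27 ≠ 0 ∧ resFG a b ≠ 0 ∧
      pairInv₁ (cubicF a b) (cubicG b) = r₁ ∧ pairInv₂ (cubicF a b) (cubicG b) = r₂ := by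
  -- The value of `m / n` is forced by `r₂ / r₁`; thus `d = 1 - c`.
  obtain ⟨c, hc⟩ : ∃ c, c = -48 * r₂ / r₁ := ⟨_, rfl⟩
  have hcr : c * r₁ = -48 * r₂ := by rw [hc]; field_simp
  have hc0 : c ≠ 0 := by
    rintro rfl; apply h2; linear_combination (1 / 48) * hcr
  have h9 : 9 * (1 - c) - 4 ≠ 0 := by
    intro h; apply h3; linear_combination r₁ * h + 9 * hcr
  have h32 : 3 * (1 - c) - 2 ≠ 0 := by
    intro h; apply h4; linear_combination r₁ * h + 3 * hcr
  -- It remains to solve the quadratic for `n`. The root `n = 0` requires `9d - 4 = 0` and the root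
  -- `n = -27`, that is `v = 0`, requires `3d - 2 = 0`; `h3` and `h4` exclude both.
  obtain ⟨n, hn⟩ : ∃ n, c ^ 3 * n * (n + 27) = 27 * r₁ * betaLin (1 - c) n := by
    let p : k[X] := C (c ^ 3) * X ^ 2
      + C (27 * c ^ 3 - 27 * r₁ * ((1 - c) ^ 2 * (2 * (1 - c) - 1) / 4)) * X
      + C (-(27 * r₁ * ((9 * (1 - c) - 4) ^ 2 / 4)))
    have hp : p.degree = 2 := degree_quadratic (pow_ne_zero 3 hc0)
    obtain ⟨n, hn⟩ := IsAlgClosed.exists_root p (by rw [hp]; norm_num)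
    refine ⟨n, ?_⟩
    simp only [p, IsRoot.def, eval_add, eval_mul, eval_C, eval_X, eval_pow] at hn
    rw [betaLin]; linear_combination hn
  have hn0 : n ≠ 0 := by
    rintro rfl
    have : 27 * r₁ * ((9 * (1 - c) - 4) ^ 2 / 4) ≠ 0 :=
      mul_ne_zero (mul_ne_zero (by norm_num) h1) (div_ne_zero (pow_ne_zero 2 h9) (by norm_num))
    apply this; rw [betaLin] at hn; linear_combination -hn
  have hv : n + 27 ≠ 0 := by
    intro hv
    have hn27 : n = -27 := by linear_combination hv
    rw [hn27, betaLin] at hn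
    have : 27 * r₁ * (3 * (1 - c) - 2) ^ 3 ≠ 0 :=
      mul_ne_zero (mul_ne_zero (by norm_num) h1) (pow_ne_zero 3 h32)
    apply this; linear_combination 2 * hn
  have hβ : betaLin (1 - c) n ≠ 0 := by
    intro h
    rw [h, mul_zero] at hn
    exact mul_ne_zero (mul_ne_zero (pow_ne_zero 3 hc0) hn0) hv hn
  obtain ⟨b, hb⟩ := IsAlgClosed.exists_pow_nat_eq (n + 27) (n := 3) (by norm_num)
  have hb0 : b ≠ 0 := by rintro rfl; apply hv; rw [← hb]; norm_num
  obtain ⟨u, hu⟩ : ∃ u, u = ((1 - c) * n + 18) / 2 := ⟨_, rfl⟩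
  have hab : u / b * b = u := by field_simp
  have hm : n + 27 - 2 * u - 9 = c * n := by rw [hu]; ring
  have hB := betaDen_eq_betaLin (1 - c) n
  have hr1 := invUV₁_eq_betaLin (1 - c) n hn0
  have hr2 := invUV₂_eq u (n + 27) (by simpa using hn0)
  rw [← hu] at hB hr1
  have hr1' : invUV₁ u (n + 27) = r₁ := by
    rw [hr1, div_eq_iff (mul_ne_zero (by norm_num) hβ)]; linear_combination hn
  have hr2' : invUV₂ u (n + 27) = r₂ := by
    rw [hr2, hr1', show (2 * u - 18) / (n + 27 - 27) = 1 - c by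
      rw [hu, add_sub_cancel_right]; field_simp; ring]
    linear_combination (-1 / 48) * hcr
  refine ⟨u / b, b, hb0, ?_, ?_, ?_, ?_, ?_⟩
  · rw [hab, hb, hm]; exact mul_ne_zero hc0 hn0
  · rw [hb]; simpa using hn0
  · have := betaDen_mul_pow (u / b) b
    rw [hab, hb, hB] at this
    exact right_ne_zero_of_mul (this ▸ mul_ne_zero (pow_ne_zero 2 hn0) hβ)
  · rw [pairInv₁_eq_invUV _ _ hb0, hab, hb, hr1']
  · rw [pairInv₂_eq_invUV _ _ hb0, hab, hb, hr2']

variable (k) in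
theorem exists_rho_mem_locusL₃ [IsAlgClosed k] : ∃ g : MvPolynomial (Fin 2) k, g ≠ 0 ∧
    ∀ p, MvPolynomial.eval p g ≠ 0 → rho p ∈ locusL₃ k := by
  let x : MvPolynomial (Fin 2) k := .X 0
  let y : MvPolynomial (Fin 2) k := .X 1
  let g := x * y * (5 * x + 432 * y) * (x + 144 * y) * (-1152 * y ^ 2 + 96 * y * x + x ^ 2)
  have hg : ∀ p, MvPolynomial.eval p g = p 0 * p 1 * (5 * p 0 + 432 * p 1) * (p 0 + 144 * p 1) *
      rhoDen (p 0) (p 1) := by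
    intro p
    simp only [g, x, y, map_mul, map_add, map_neg, map_pow, map_ofNat, MvPolynomial.eval_X, rhoDen]
  refine ⟨g, ?_, fun p hp => ?_⟩
  · intro h0
    have := hg ![1, 1]
    rw [h0, map_zero] at this
    simp [rhoDen] at this
    norm_num at this
  · rw [hg] at hp
    simp only [mul_ne_zero_iff] at hp
    obtain ⟨⟨⟨⟨h1, h2⟩, h3⟩, h4⟩, h5⟩ := hp
    obtain ⟨a, b, -, hm, hn, hR, e1, e2⟩ := exists_pairInv_eq h1 h2 h3 h4
    have hJ : J₂ (sextic a b) ≠ 0 := by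
      rw [J₂_sextic a b _ _ rfl rfl]
      rw [← e1, ← e2, pairInv₁_eq, pairInv₂_eq, rhoDen_eq _ _ _ hm hn hR] at h5
      refine mul_ne_zero (by norm_num) fun h => h5 ?_
      rw [h, mul_zero, zero_div]
    have := absInv_sextic_mem_locusL₃ hn hR hJ
    rwa [rho₁_sextic a b hJ hm hn hR, rho₂_sextic a b hJ hm hn hR, rho₃_sextic a b hJ hm hn hR,
      e1, e2] at this

end LocusPoints

/-! ### Covariance of the invariants of a binary sextic -/

section Covariance
variable {k : Type*} [Field k]

theorem coeff_taylor_of_natDegree_le {f : k[X]} {n : ℕ} (hf : f.natDegree ≤ n) (c : k) :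
    (taylor c f).coeff n = f.coeff n := by
  rcases hf.eq_or_lt with h | h
  · subst h
    conv_lhs => rw [← natDegree_taylor f c]
    rw [coeff_natDegree, leadingCoeff_taylor, coeff_natDegree]
  · rw [coeff_eq_zero_of_natDegree_lt h,
      coeff_eq_zero_of_natDegree_lt (by rwa [natDegree_taylor])]

theorem resultant_taylor_of_natDegree_le {f g : k[X]} {m n : ℕ} (hf : f.natDegree ≤ m)
    (hg : g.natDegree ≤ n) (c : k) :
    resultant (taylor c f) (taylor c g) m n = resultant f g m n := by
  obtain ⟨i, rfl⟩ := Nat.exists_eq_add_of_le hf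
  obtain ⟨j, rfl⟩ := Nat.exists_eq_add_of_le hg
  have h := resultant_taylor f g c
  rw [natDegree_taylor, natDegree_taylor] at h
  rw [resultant_add_left_deg _ _ _ _ _ (natDegree_taylor f c).le,
    resultant_add_right_deg _ _ _ _ _ (natDegree_taylor g c).le,
    resultant_add_left_deg _ _ _ _ _ le_rfl, resultant_add_right_deg _ _ _ _ _ le_rfl, h,
    coeff_taylor_of_natDegree_le hg, coeff_taylor_of_natDegree_le le_rfl]

/-- Reversing the order of all rows and all columns of the Sylvester matrix reverses the
coefficients and exchanges its two blocks; this simultaneous permutation preserves the determinant.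
-/
theorem resultant_reflect (f g : k[X]) (n : ℕ) :
    resultant (reflect n f) (reflect n g) n n = resultant g f n n := by
  rw [resultant, resultant, ← Matrix.det_reindex_self (Fin.revPerm (n := n + n))]
  congr 1
  ext i j
  rw [Matrix.reindex_apply, Matrix.submatrix_apply, Fin.revPerm_symm, Fin.revPerm_apply,
    Fin.revPerm_apply]
  induction j using Fin.addCases with
  | left j =>
    have : (Fin.castAdd n j).rev = Fin.natAdd n j.rev := by
      ext; simp only [Fin.val_rev, Fin.val_castAdd, Fin.val_natAdd]; omega
    rw [this]
    simp only [sylvester, Matrix.of_apply, Fin.addCases_left, Fin.addCases_right, Set.mem_Icc,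
      Fin.val_rev, coeff_reflect]
    have hi := i.2
    have hj := j.2
    split_ifs with h1 h2 h2
    · rw [revAt_le (by omega)]; congr 1; omega
    · omega
    · omega
    · rfl
  | right j =>
    have : (Fin.natAdd n j).rev = Fin.castAdd n j.rev := by
      ext; simp only [Fin.val_rev, Fin.val_castAdd, Fin.val_natAdd]; omega
    rw [this]
    simp only [sylvester, Matrix.of_apply, Fin.addCases_left, Fin.addCases_right, Set.mem_Icc,
      Fin.val_rev, coeff_reflect]
    have hi := i.2
    have hj := j.2
    split_ifs with h1 h2 h2
    · rw [revAt_le (by omega)]; congr 1; omega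
    · omega
    · omega
    · rfl

theorem natDegree_six_mul_sub_le {f : k[X]} (hf : f.natDegree ≤ 6) :
    (6 * f - X * derivative f).natDegree ≤ 5 := by
  rw [natDegree_le_iff_coeff_eq_zero]
  rintro (_ | N) hN
  · omega
  · rw [coeff_sub, coeff_X_mul, coeff_derivative, show (6 : k[X]) = C 6 from (map_ofNat C 6).symm,
      coeff_C_mul]
    by_cases h : N = 5
    · subst h; push_cast; ring
    · rw [coeff_eq_zero_of_natDegree_lt (by omega)]; ring

theorem natDegree_derivative_le_five {f : k[X]} (hf : f.natDegree ≤ 6) :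
    (derivative f).natDegree ≤ 5 := (natDegree_derivative_le f).trans (by omega)

/-- A translation by `c` changes the second partial derivative by `c` times the first, which the
resultant does not see. -/
theorem J₁₀_taylor {f : k[X]} (hf : f.natDegree ≤ 6) (c : k) : J₁₀ (taylor c f) = J₁₀ f := by
  have h1 : derivative (taylor c f) = taylor c (derivative f) := by
    simp [taylor_apply, derivative_comp]
  have h2 : 6 * taylor c f - X * derivative (taylor c f) =
      taylor c ((6 * f - X * derivative f) + derivative f * C c) := by
    rw [h1, map_add, map_sub, taylor_mul, taylor_mul, taylor_mul, taylor_X, taylor_C,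
      show (6 : k[X]) = C 6 from (map_ofNat C 6).symm, taylor_C]
    ring
  have hd := natDegree_derivative_le_five hf
  rw [J₁₀, J₁₀, h2, h1, resultant_taylor_of_natDegree_le hd ?_, resultant_add_mul_right _ _ _ _ _ _ hd]
  · simp
  · refine (natDegree_add_le_of_degree_le (natDegree_six_mul_sub_le hf) ?_)
    exact (natDegree_mul_C_le _ _).trans hd

/-- Reversing the coefficients interchanges the two partial derivatives of the binary form, up to
reversal in degree 5. -/
theorem J₁₀_reflect {f : k[X]} (hf : f.natDegree ≤ 6) : J₁₀ (reflect 6 f) = J₁₀ f := by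
  have h1 : derivative (reflect 6 f) = reflect 5 (6 * f - X * derivative f) := by
    ext i
    rw [coeff_derivative, coeff_reflect, coeff_reflect, coeff_sub,
      show (6 : k[X]) = C 6 from (map_ofNat C 6).symm, coeff_C_mul]
    by_cases hi : i ≤ 5
    · rw [revAt_le hi, revAt_le (by omega)]
      have e : 6 - (i + 1) = 5 - i := by omega
      rw [e]
      rcases Nat.lt_or_ge i 5 with h | h
      · obtain ⟨j, hj⟩ : ∃ j, 5 - i = j + 1 := ⟨4 - i, by omega⟩
        have : (6 : k) = (j : k) + 1 + (i + 1) := by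
          have : 6 = j + 1 + (i + 1) := by omega
          exact_mod_cast congrArg (Nat.cast : ℕ → k) this
        rw [hj, coeff_X_mul, coeff_derivative, this]; ring
      · obtain rfl : i = 5 := by omega
        simp; ring
    · rw [revAt_eq_self_of_lt (by omega), revAt_eq_self_of_lt (by omega),
        coeff_eq_zero_of_natDegree_lt (by omega)]
      obtain ⟨j, rfl⟩ : ∃ j, i = j + 1 := ⟨i - 1, by omega⟩
      rw [coeff_X_mul, coeff_derivative]
      by_cases h : j = 5
      · subst h; push_cast; ring
      · rw [coeff_eq_zero_of_natDegree_lt (by omega)]; ring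
  have h2 : 6 * reflect 6 f - X * derivative (reflect 6 f) = reflect 5 (derivative f) := by
    ext i
    rw [coeff_sub, show (6 : k[X]) = C 6 from (map_ofNat C 6).symm, coeff_C_mul, coeff_reflect,
      coeff_reflect, coeff_derivative]
    rcases i with _ | i
    · rw [coeff_X_mul_zero, revAt_le (by norm_num), revAt_le (by norm_num)]; push_cast; ring
    · rw [coeff_X_mul, coeff_derivative, coeff_reflect]
      by_cases hi : i + 1 ≤ 5
      · rw [revAt_le hi, revAt_le (by omega)]
        have : 5 - (i + 1) + 1 = 6 - (i + 1) := by omega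
        rw [this]
        have : (6 : k) = ((5 - (i + 1) : ℕ) : k) + 1 + (i + 1) := by
          have : 6 = 5 - (i + 1) + 1 + (i + 1) := by omega
          exact_mod_cast congrArg (Nat.cast : ℕ → k) this
        rw [this]; ring
      · rw [revAt_eq_self_of_lt (i := i + 1) (N := 5) (by omega),
          coeff_eq_zero_of_natDegree_lt (n := i + 1 + 1) (by omega)]
        by_cases h : i = 5
        · subst h; push_cast; ring
        · rw [revAt_eq_self_of_lt (by omega), coeff_eq_zero_of_natDegree_lt (by omega)]; ring
  rw [J₁₀, J₁₀, h2, h1, resultant_reflect]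

end Covariance

section Covariance
variable {k : Type*} [Field k]

/-- The new Sylvester matrix arises by multiplying row `i` by `rⁱ` and column `j` of each block by
`r⁻ʲ`, for a total exponent `45 - 20`. -/
theorem resultant_comp_C_mul_X (f g : k[X]) {r : k} (hr : r ≠ 0) :
    resultant (f.comp (C r * X)) (g.comp (C r * X)) 5 5 = r ^ 25 * resultant f g 5 5 := by
  let w : Fin (5 + 5) → k := fun j => Fin.addCases (fun j : Fin 5 => (r ^ (j : ℕ))⁻¹)
    (fun j : Fin 5 => (r ^ (j : ℕ))⁻¹) j
  have h : sylvester (f.comp (C r * X)) (g.comp (C r * X)) 5 5 =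
      Matrix.of fun i j => w j * (Matrix.of fun (i j : Fin (5 + 5)) =>
        r ^ (i : ℕ) * sylvester f g 5 5 i j) i j := by
    ext i j
    induction j using Fin.addCases with
    | left j =>
      simp only [w, sylvester, Matrix.of_apply, Fin.addCases_left, Set.mem_Icc,
        comp_C_mul_X_coeff]
      split_ifs with h1
      · obtain ⟨l, hl⟩ := Nat.exists_eq_add_of_le h1.1
        rw [hl, Nat.add_sub_cancel_left]; field_simp; ring
      · simp
    | right j =>
      simp only [w, sylvester, Matrix.of_apply, Fin.addCases_right, Set.mem_Icc,
        comp_C_mul_X_coeff]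
      split_ifs with h1
      · obtain ⟨l, hl⟩ := Nat.exists_eq_add_of_le h1.1
        rw [hl, Nat.add_sub_cancel_left]; field_simp; ring
      · simp
  rw [resultant, resultant, h, Matrix.det_mul_row, Matrix.det_mul_column, Fin.prod_univ_add]
  simp only [w, Fin.addCases_left, Fin.addCases_right, Fin.prod_univ_succ]
  simp
  field_simp

theorem J₁₀_comp_C_mul_X (f : k[X]) {r : k} (hr : r ≠ 0) :
    J₁₀ (f.comp (C r * X)) = r ^ 30 * J₁₀ f := by
  have h1 : derivative (f.comp (C r * X)) = C r * (derivative f).comp (C r * X) := by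
    rw [derivative_comp]; simp
  have h2 : 6 * f.comp (C r * X) - X * derivative (f.comp (C r * X)) =
      (6 * f - X * derivative f).comp (C r * X) := by
    rw [h1, sub_comp, mul_comp, mul_comp, X_comp]
    simp; ring
  rw [J₁₀, J₁₀, h2, h1, resultant_C_mul_left, resultant_comp_C_mul_X _ _ hr]
  ring

theorem J₁₀_C_mul (f : k[X]) (c : k) : J₁₀ (C c * f) = c ^ 10 * J₁₀ f := by
  have h2 : 6 * (C c * f) - X * derivative (C c * f) = C c * (6 * f - X * derivative f) := by
    rw [derivative_C_mul]; ring
  rw [J₁₀, J₁₀, h2, derivative_C_mul, resultant_C_mul_left, resultant_C_mul_right]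
  ring

theorem coeff_taylor_of_natDegree_le_six {f : k[X]} (hf : f.natDegree ≤ 6) (c : k) :
    let a := f.coeff
    let g := taylor c f
    g.coeff 0 = a 0 + a 1 * c + a 2 * c ^ 2 + a 3 * c ^ 3 + a 4 * c ^ 4 + a 5 * c ^ 5 + a 6 * c ^ 6 ∧
    g.coeff 1 = a 1 + 2 * a 2 * c + 3 * a 3 * c ^ 2 + 4 * a 4 * c ^ 3 + 5 * a 5 * c ^ 4
      + 6 * a 6 * c ^ 5 ∧
    g.coeff 2 = a 2 + 3 * a 3 * c + 6 * a 4 * c ^ 2 + 10 * a 5 * c ^ 3 + 15 * a 6 * c ^ 4 ∧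
    g.coeff 3 = a 3 + 4 * a 4 * c + 10 * a 5 * c ^ 2 + 20 * a 6 * c ^ 3 ∧
    g.coeff 4 = a 4 + 5 * a 5 * c + 15 * a 6 * c ^ 2 ∧
    g.coeff 5 = a 5 + 6 * a 6 * c ∧ g.coeff 6 = a 6 := by
  intro a g
  have key : g = ∑ i ∈ Finset.range 7, C (a i) * (X + C c) ^ i := by
    have : f = ∑ i ∈ Finset.range 7, C (a i) * X ^ i :=
      (as_sum_range_C_mul_X_pow' f (by omega : f.natDegree < 7))
    change taylor c f = _
    conv_lhs => rw [this]
    simp [taylor_apply]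
  have key2 : g = C (a 6) * X ^ 6 + C (a 5 + 6 * a 6 * c) * X ^ 5
      + C (a 4 + 5 * a 5 * c + 15 * a 6 * c ^ 2) * X ^ 4
      + C (a 3 + 4 * a 4 * c + 10 * a 5 * c ^ 2 + 20 * a 6 * c ^ 3) * X ^ 3
      + C (a 2 + 3 * a 3 * c + 6 * a 4 * c ^ 2 + 10 * a 5 * c ^ 3 + 15 * a 6 * c ^ 4) * X ^ 2
      + C (a 1 + 2 * a 2 * c + 3 * a 3 * c ^ 2 + 4 * a 4 * c ^ 3 + 5 * a 5 * c ^ 4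
      + 6 * a 6 * c ^ 5) * X
      + C (a 0 + a 1 * c + a 2 * c ^ 2 + a 3 * c ^ 3 + a 4 * c ^ 4 + a 5 * c ^ 5 + a 6 * c ^ 6) := by
    rw [key]
    simp only [Finset.sum_range_succ, Finset.sum_range_zero, map_add, map_mul, map_pow, map_ofNat]
    ring
  clear_value g
  rw [key2]
  refine ⟨?_, ?_, ?_, ?_, ?_, ?_, ?_⟩ <;>
    simp only [coeff_add, coeff_C_mul, coeff_X_pow, coeff_X, coeff_C] <;> norm_num

theorem J₂_taylor {f : k[X]} (hf : f.natDegree ≤ 6) (c : k) : J₂ (taylor c f) = J₂ f := by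
  obtain ⟨h0, h1, h2, h3, h4, h5, h6⟩ := coeff_taylor_of_natDegree_le_six hf c
  rw [J₂, J₂, h0, h1, h2, h3, h4, h5, h6]; ring

theorem J₄_taylor {f : k[X]} (hf : f.natDegree ≤ 6) (c : k) : J₄ (taylor c f) = J₄ f := by
  obtain ⟨h0, h1, h2, h3, h4, h5, h6⟩ := coeff_taylor_of_natDegree_le_six hf c
  rw [J₄, J₄, h0, h1, h2, h3, h4, h5, h6]; ring

end Covariance

section Covariance
variable {k : Type*} [Field k]

set_option maxHeartbeats 4000000 in
theorem J₆_taylor {f : k[X]} (hf : f.natDegree ≤ 6) (c : k) : J₆ (taylor c f) = J₆ f := by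
  obtain ⟨h0, h1, h2, h3, h4, h5, h6⟩ := coeff_taylor_of_natDegree_le_six hf c
  rw [J₆, J₆, h0, h1, h2, h3, h4, h5, h6]; ring

end Covariance

section Covariance
variable {k : Type*} [Field k]

theorem J_reflect (f : k[X]) : J₂ (reflect 6 f) = J₂ f ∧ J₄ (reflect 6 f) = J₄ f ∧
    J₆ (reflect 6 f) = J₆ f := by
  have h : ∀ i j : ℕ, i + j = 6 → (reflect 6 f).coeff i = f.coeff j := by
    intro i j hij
    rw [coeff_reflect, revAt_le (by omega)]; congr 1; omega
  have h0 := h 0 6 rfl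
  have h1 := h 1 5 rfl
  have h2 := h 2 4 rfl
  have h3 := h 3 3 rfl
  have h4 := h 4 2 rfl
  have h5 := h 5 1 rfl
  have h6 := h 6 0 rfl
  refine ⟨?_, ?_, ?_⟩
  · rw [J₂, J₂, h0, h1, h2, h3, h4, h5, h6]; ring
  · rw [J₄, J₄, h0, h1, h2, h3, h4, h5, h6]; ring
  · rw [J₆, J₆, h0, h1, h2, h3, h4, h5, h6]; ring

theorem J_comp_C_mul_X (f : k[X]) (r : k) : J₂ (f.comp (C r * X)) = r ^ 6 * J₂ f ∧
    J₄ (f.comp (C r * X)) = r ^ 12 * J₄ f ∧ J₆ (f.comp (C r * X)) = r ^ 18 * J₆ f := by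
  refine ⟨?_, ?_, ?_⟩
  · simp only [J₂, comp_C_mul_X_coeff]; ring
  · simp only [J₄, comp_C_mul_X_coeff]; ring
  · simp only [J₆, comp_C_mul_X_coeff]; ring

theorem J_C_mul (f : k[X]) (c : k) : J₂ (C c * f) = c ^ 2 * J₂ f ∧
    J₄ (C c * f) = c ^ 4 * J₄ f ∧ J₆ (C c * f) = c ^ 6 * J₆ f := by
  refine ⟨?_, ?_, ?_⟩
  · simp only [J₂, coeff_C_mul]; ring
  · simp only [J₄, coeff_C_mul]; ring
  · simp only [J₆, coeff_C_mul]; ring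

/-- The triple of absolute invariants of a sextic. -/
noncomputable def absTriple (f : k[X]) : Fin 3 → k := ![absInv₁ f, absInv₂ f, absInv₃ f]

/-- Two sextics with the same absolute invariants. -/
def SameInvariants (f g : k[X]) : Prop := (J₂ f ≠ 0 → J₂ g ≠ 0) ∧ absTriple f = absTriple g

theorem SameInvariants.trans {f g h : k[X]} (h1 : SameInvariants f g) (h2 : SameInvariants g h) :
    SameInvariants f h := ⟨fun h => h2.1 (h1.1 h), h1.2.trans h2.2⟩

/-- The absolute invariants have weight zero, so `r` cancels. When `J₂ = 0` both triples are zero by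
the convention for division by zero. -/
theorem sameInvariants_of_weights {f g : k[X]} {r : k} (hr : r ≠ 0) (h2 : J₂ g = r * J₂ f)
    (h4 : J₄ g = r ^ 2 * J₄ f) (h6 : J₆ g = r ^ 3 * J₆ f) (h10 : J₁₀ g = r ^ 5 * J₁₀ f) :
    SameInvariants f g := by
  refine ⟨fun h => h2 ▸ mul_ne_zero hr h, ?_⟩
  rw [absTriple, absTriple, absInv₁, absInv₁, absInv₂, absInv₂, absInv₃, absInv₃, h2, h4, h6, h10]
  by_cases h : J₂ f = 0
  · simp [h]
  congr 1
  · field_simp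
  congr 1
  · field_simp
  congr 1
  · field_simp

theorem sameInvariants_taylor {f : k[X]} (hf : f.natDegree ≤ 6) (c : k) :
    SameInvariants f (taylor c f) :=
  sameInvariants_of_weights one_ne_zero (by rw [J₂_taylor hf, one_mul])
    (by rw [J₄_taylor hf]; ring) (by rw [J₆_taylor hf]; ring) (by rw [J₁₀_taylor hf]; ring)

theorem sameInvariants_reflect {f : k[X]} (hf : f.natDegree ≤ 6) :
    SameInvariants f (reflect 6 f) := by
  obtain ⟨h2, h4, h6⟩ := J_reflect f
  exact sameInvariants_of_weights one_ne_zero (by rw [h2, one_mul])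
    (by rw [h4]; ring) (by rw [h6]; ring) (by rw [J₁₀_reflect hf]; ring)

theorem sameInvariants_comp_C_mul_X (f : k[X]) {r : k} (hr : r ≠ 0) :
    SameInvariants f (f.comp (C r * X)) := by
  obtain ⟨h2, h4, h6⟩ := J_comp_C_mul_X f r
  exact sameInvariants_of_weights (pow_ne_zero 6 hr) h2
    (by rw [h4]; ring) (by rw [h6]; ring) (by rw [J₁₀_comp_C_mul_X f hr]; ring)

theorem sameInvariants_C_mul (f : k[X]) {c : k} (hc : c ≠ 0) : SameInvariants f (C c * f) := by
  obtain ⟨h2, h4, h6⟩ := J_C_mul f c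
  exact sameInvariants_of_weights (pow_ne_zero 2 hc) h2
    (by rw [h4]; ring) (by rw [h6]; ring) (by rw [J₁₀_C_mul f c]; ring)

end Covariance

/-! ### An elliptic curve has no non-constant points over `k(x)` -/

section Squares
variable {k : Type*} [Field k]

/-- A pencil of polynomials with four squares is constant. -/
theorem natDegree_eq_zero_of_four_squares [CharZero k] {A B b₀ b₁ b₂ b₃ : k[X]}
    (hAB : IsCoprime A B) {e₁ e₂ e₃ : k} (h12 : e₁ ≠ e₂) (h13 : e₁ ≠ e₃) (h23 : e₂ ≠ e₃)
    (h0 : b₀ ^ 2 = B) (h1 : b₁ ^ 2 = A - C e₁ * B) (h2 : b₂ ^ 2 = A - C e₂ * B)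
    (h3 : b₃ ^ 2 = A - C e₃ * B) : A.natDegree = 0 ∧ B.natDegree = 0 := by
  -- A square `b²` leaves the factor `b` in its derivative.
  have dvd_w : ∀ b S T : k[X], b ^ 2 = S → b ∣ wronskian S T := by
    rintro b S T rfl
    exact ⟨b * derivative T - 2 * derivative b * T, by rw [wronskian, derivative_sq]; rw [C_ofNat]; ring⟩
  have c0 : ∀ e b : k[X], ∀ e', b ^ 2 = A - C e' * B → IsCoprime b₀ b := by
    intro _ b e' hb
    rw [← IsCoprime.pow_iff (m := 2) (n := 2) (by norm_num) (by norm_num), h0, hb]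
    obtain ⟨u, v, huv⟩ := hAB
    exact ⟨v + u * C e', u, by linear_combination huv⟩
  have cij : ∀ b b' : k[X], ∀ e e', e ≠ e' → b ^ 2 = A - C e * B → b' ^ 2 = A - C e' * B →
      IsCoprime b b' := by
    intro b b' e e' he hb hb'
    rw [← IsCoprime.pow_iff (m := 2) (n := 2) (by norm_num) (by norm_num), hb, hb']
    obtain ⟨u, v, huv⟩ := hAB
    have hc : C (e' - e)⁻¹ * C (e' - e) = 1 := by
      rw [← C_mul, inv_mul_cancel₀ (sub_ne_zero.2 he.symm), C_1]
    rw [C_sub] at hc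
    refine ⟨C (e' - e)⁻¹ * (u * C e' + v), -C (e' - e)⁻¹ * (u * C e + v), ?_⟩
    linear_combination huv + (u * A + v * B) * hc
  by_cases hW : wronskian A B = 0
  · rw [wronskian, sub_eq_zero] at hW
    have hdvd : B ∣ derivative B := hAB.symm.dvd_of_dvd_mul_left ⟨derivative A, by rw [hW]; ring⟩
    have hdvd' : A ∣ derivative A := hAB.dvd_of_dvd_mul_right ⟨derivative B, by rw [← hW]⟩
    have aux : ∀ p : k[X], p ∣ derivative p → p.natDegree = 0 := by
      intro p hp
      by_contra hne
      refine hne (derivative_eq_zero.1 (eq_zero_of_dvd_of_natDegree_lt hp ?_))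
      exact natDegree_derivative_lt hne
    exact ⟨aux A hdvd', aux B hdvd⟩
  exfalso
  have w01 : wronskian B (A - C e₁ * B) = -wronskian A B := by
    simp only [wronskian, derivative_sub, derivative_C_mul]; ring
  have w23 : wronskian (A - C e₂ * B) (A - C e₃ * B) = C (e₂ - e₃) * wronskian A B := by
    simp only [wronskian, derivative_sub, derivative_C_mul, C_sub]; ring
  have w1 : wronskian (A - C e₁ * B) B = wronskian A B := by
    simp only [wronskian, derivative_sub, derivative_C_mul]; ring
  have w2 : wronskian (A - C e₂ * B) B = wronskian A B := by
    simp only [wronskian, derivative_sub, derivative_C_mul]; ring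
  have w3 : wronskian (A - C e₃ * B) B = wronskian A B := by
    simp only [wronskian, derivative_sub, derivative_C_mul]; ring
  have d0 : b₀ ∣ wronskian A B := by
    have := dvd_w b₀ B A h0
    rwa [← wronskian_neg_eq, dvd_neg] at this
  have d1 : b₁ ∣ wronskian A B := w1 ▸ dvd_w b₁ _ B h1
  have d2 : b₂ ∣ wronskian A B := w2 ▸ dvd_w b₂ _ B h2
  have d3 : b₃ ∣ wronskian A B := w3 ▸ dvd_w b₃ _ B h3
  have c01 := c0 0 b₁ e₁ h1
  have c02 := c0 0 b₂ e₂ h2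
  have c03 := c0 0 b₃ e₃ h3
  have c12 := cij b₁ b₂ e₁ e₂ h12 h1 h2
  have c13 := cij b₁ b₃ e₁ e₃ h13 h1 h3
  have c23 := cij b₂ b₃ e₂ e₃ h23 h2 h3
  -- All pairs from the pencil have the same Wronskian up to a nonzero constant. Its degree is at
  -- least the sum of the four `deg bᵢ`, but less than `2 (deg b₀ + deg b₁)` and less than `2 (deg
  -- b₂ + deg b₃)`; adding these bounds gives a contradiction.
  have hprod : b₀ * (b₁ * (b₂ * b₃)) ∣ wronskian A B :=
    (IsCoprime.mul_right c01 (c02.mul_right c03)).mul_dvd d0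
      ((c12.mul_right c13).mul_dvd d1 (c23.mul_dvd d2 d3))
  have hne := ne_zero_of_dvd_ne_zero hW hprod
  simp only [mul_ne_zero_iff] at hne
  obtain ⟨n0, n1, n2, n3⟩ := hne
  have hdeg := natDegree_le_of_dvd hprod hW
  rw [natDegree_mul n0 (by simp [n1, n2, n3]), natDegree_mul n1 (by simp [n2, n3]),
    natDegree_mul n2 n3] at hdeg
  have l1 := natDegree_wronskian_lt_add (a := B) (b := A - C e₁ * B)
    (by rw [w01]; exact neg_ne_zero.2 hW)
  have l2 := natDegree_wronskian_lt_add (a := A - C e₂ * B) (b := A - C e₃ * B)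
    (by rw [w23]; exact mul_ne_zero (C_ne_zero.2 (sub_ne_zero.2 h23)) hW)
  rw [w01, natDegree_neg] at l1
  rw [w23, natDegree_C_mul (sub_ne_zero.2 h23)] at l2
  have g0 : B.natDegree = 2 * b₀.natDegree := by rw [← h0, natDegree_pow]
  have g1 : (A - C e₁ * B).natDegree = 2 * b₁.natDegree := by rw [← h1, natDegree_pow]
  have g2 : (A - C e₂ * B).natDegree = 2 * b₂.natDegree := by rw [← h2, natDegree_pow]
  have g3 : (A - C e₃ * B).natDegree = 2 * b₃.natDegree := by rw [← h3, natDegree_pow]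
  omega

theorem exists_sq_of_associated [IsAlgClosed k] {a d : k[X]} (h : Associated (d ^ 2) a) :
    ∃ b : k[X], b ^ 2 = a := by
  obtain ⟨u, rfl⟩ := h
  obtain ⟨c, hc, hcu⟩ := isUnit_iff.1 u.isUnit
  obtain ⟨r, hr⟩ := IsAlgClosed.exists_pow_nat_eq c (n := 2) (by norm_num)
  exact ⟨d * C r, by rw [mul_pow, ← C_pow, hr, hcu]⟩

theorem exists_sq_of_coprime_mul [IsAlgClosed k] {a b c : k[X]} (h : IsCoprime a b)
    (hc : a * b = c ^ 2) : (∃ d : k[X], d ^ 2 = a) ∧ ∃ d : k[X], d ^ 2 = b := by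
  obtain ⟨d, hd⟩ := exists_associated_pow_of_mul_eq_pow' h hc
  obtain ⟨d', hd'⟩ := exists_associated_pow_of_mul_eq_pow' h.symm ((mul_comm _ _).trans hc)
  exact ⟨exists_sq_of_associated hd, exists_sq_of_associated hd'⟩

variable {K : Type*} [Field K] [Algebra k K] {x : K}

theorem aeval_injective_of_transcendental (hx : Transcendental k x) {p q : k[X]}
    (h : aeval x p = aeval x q) : p = q := by
  by_contra hne
  refine aeval_ne_zero_of_transcendental hx (sub_ne_zero.2 hne) ?_
  rw [map_sub, h, sub_self]

/-- If `f z²` is a polynomial in `x` for `f` squarefree and `z ∈ k(x)`, then `z` is a polynomial. -/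
theorem exists_aeval_of_squarefree_mul_sq (hx : Transcendental k x) {f N : k[X]}
    (hf : Squarefree f) {z : K} (hz : z ∈ adjoin k {x}) (h : aeval x f * z ^ 2 = aeval x N) :
    ∃ S : k[X], z = aeval x S ∧ f * S ^ 2 = N := by
  obtain ⟨A, B, hAB, hB, rfl⟩ := exists_coprime_of_mem_adjoin hx hz
  have hB' := aeval_ne_zero_of_transcendental hx hB
  have h2 : f * A ^ 2 = N * B ^ 2 := by
    apply aeval_injective_of_transcendental hx
    simp only [map_mul, map_pow, ← h]
    field_simp
  have hcop : IsCoprime (B ^ 2) (A ^ 2) := hAB.symm.pow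
  have hBf : B * B ∣ f := by
    rw [← sq]; exact hcop.dvd_of_dvd_mul_right (Dvd.intro_left N h2.symm)
  have hu : IsUnit B := hf B hBf
  obtain ⟨c, hc, rfl⟩ := isUnit_iff.1 hu
  have hS : aeval x A / aeval x (C c) = aeval x (C c⁻¹ * A) := by
    rw [map_mul, aeval_C, aeval_C, map_inv₀, div_eq_inv_mul]
  refine ⟨C c⁻¹ * A, hS, ?_⟩
  apply aeval_injective_of_transcendental hx
  rw [← h, hS, map_mul, map_pow]

/-- The elliptic curve `q² = (p - e₁)(p - e₂)(p - e₃)` has no non-constant point over `k(x)`. -/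
theorem mem_bot_of_elliptic_equation [IsAlgClosed k] [CharZero k] (hx : Transcendental k x)
    {e₁ e₂ e₃ : k} (h12 : e₁ ≠ e₂) (h13 : e₁ ≠ e₃) (h23 : e₂ ≠ e₃) {p q : K}
    (hp : p ∈ adjoin k {x}) (hq : q ∈ adjoin k {x})
    (h : q ^ 2 = (p - algebraMap k K e₁) * (p - algebraMap k K e₂) * (p - algebraMap k K e₃)) :
    ∃ c, p = algebraMap k K c := by
  obtain ⟨A, B, hAB, hB, rfl⟩ := exists_coprime_of_mem_adjoin hx hp
  have hB' := aeval_ne_zero_of_transcendental hx hB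
  -- Multiplying the equation by `B⁴` makes the product of the coprime polynomials `B` and `A - eᵢ
  -- B` the square of `q B²`; then each of the four is a square.
  obtain ⟨S, -, hS⟩ := exists_aeval_of_squarefree_mul_sq (f := 1)
    (N := B * ((A - C e₁ * B) * ((A - C e₂ * B) * (A - C e₃ * B)))) hx squarefree_one
    (z := q * aeval x B ^ 2) (mul_mem hq (pow_mem (aeval_mem_adjoin B) 2)) (by
      simp only [map_mul, map_sub, aeval_C, map_one]
      rw [one_mul, mul_pow, h]
      field_simp)
  rw [one_mul] at hS
  have c0 : ∀ e, IsCoprime B (A - C e * B) := by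
    intro e
    obtain ⟨u, v, huv⟩ := hAB
    exact ⟨v + u * C e, u, by linear_combination huv⟩
  have cij : ∀ e e', e ≠ e' → IsCoprime (A - C e * B) (A - C e' * B) := by
    intro e e' he
    obtain ⟨u, v, huv⟩ := hAB
    have hc : C (e' - e)⁻¹ * C (e' - e) = 1 := by
      rw [← C_mul, inv_mul_cancel₀ (sub_ne_zero.2 he.symm), C_1]
    rw [C_sub] at hc
    refine ⟨C (e' - e)⁻¹ * (u * C e' + v), -C (e' - e)⁻¹ * (u * C e + v), ?_⟩
    linear_combination huv + (u * A + v * B) * hc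
  obtain ⟨⟨b₀, h0⟩, ⟨m, hm⟩⟩ := exists_sq_of_coprime_mul
    ((c0 e₁).mul_right ((c0 e₂).mul_right (c0 e₃))) hS.symm
  obtain ⟨⟨b₁, h1⟩, ⟨m', hm'⟩⟩ := exists_sq_of_coprime_mul
    ((cij e₁ e₂ h12).mul_right (cij e₁ e₃ h13)) hm.symm
  obtain ⟨⟨b₂, h2⟩, ⟨b₃, h3⟩⟩ := exists_sq_of_coprime_mul (cij e₂ e₃ h23) hm'.symm
  obtain ⟨hA0, hB0⟩ := natDegree_eq_zero_of_four_squares hAB h12 h13 h23 h0 h1 h2 h3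
  obtain ⟨α, rfl⟩ := natDegree_eq_zero.1 hA0
  obtain ⟨β, rfl⟩ := natDegree_eq_zero.1 hB0
  exact ⟨α / β, by rw [aeval_C, aeval_C, map_div₀]⟩

end Squares

/-! ### Halving and translating points -/

section EllipticCurve
open WeierstrassCurve WeierstrassCurve.Affine

variable {k : Type*} [Field k]

/-- The curve `Y² = (X - e₁)(X - e₂)(X - e₃)`. -/
def curveOfRoots (e₁ e₂ e₃ : k) : WeierstrassCurve k :=
  ⟨0, -(e₁ + e₂ + e₃), 0, e₁ * e₂ + e₁ * e₃ + e₂ * e₃, -(e₁ * e₂ * e₃)⟩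

variable (e₁ e₂ e₃ : k) {K : Type*} [Field K] [Algebra k K]

theorem curveOfRoots_equation_iff (s t : K) :
    ((curveOfRoots e₁ e₂ e₃)⁄K).Equation s t ↔ t ^ 2 = (s - algebraMap k K e₁) *
      (s - algebraMap k K e₂) * (s - algebraMap k K e₃) := by
  rw [Affine.equation_iff]
  simp only [curveOfRoots, WeierstrassCurve.baseChange, WeierstrassCurve.map, map_zero, map_neg, map_add, map_mul]
  constructor <;> intro h <;> linear_combination h

variable {e₁ e₂ e₃}

theorem curveOfRoots_nonsingular [CharZero k] (h12 : e₁ ≠ e₂) (h13 : e₁ ≠ e₃) (h23 : e₂ ≠ e₃)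
    {s t : K} (h : t ^ 2 = (s - algebraMap k K e₁) *
      (s - algebraMap k K e₂) * (s - algebraMap k K e₃)) :
    ((curveOfRoots e₁ e₂ e₃)⁄K).Nonsingular s t := by
  have : CharZero K := charZero_of_injective_algebraMap (algebraMap k K).injective
  refine (Affine.equation_iff_nonsingular_of_Δ_ne_zero ?_).1
    ((curveOfRoots_equation_iff e₁ e₂ e₃ s t).2 h)
  have : ((curveOfRoots e₁ e₂ e₃)⁄K).Δ =
      algebraMap k K (16 * (e₁ - e₂) ^ 2 * (e₁ - e₃) ^ 2 * (e₂ - e₃) ^ 2) := by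
    simp only [WeierstrassCurve.Δ, b₂, b₄, b₆, b₈, curveOfRoots, WeierstrassCurve.baseChange,
      WeierstrassCurve.map, map_zero, map_neg, map_add, map_mul, map_sub, map_pow, map_ofNat]
    ring
  rw [this]
  refine (_root_.map_ne_zero _).2 (mul_ne_zero (mul_ne_zero (mul_ne_zero (by norm_num) ?_) ?_) ?_) <;>
    exact pow_ne_zero 2 (sub_ne_zero.2 ‹_›)

open Classical in
-- Choose square roots `rᵢ` of `p - eᵢ` with `r₁ r₂ r₃ = q`. The point with `x - eᵢ = (rᵢ + rⱼ)(rᵢ +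
-- rₗ)` and `y` the product of the three sums has tangent slope `r₁ + r₂ + r₃`, and its double is
-- `(p, q)`.
theorem exists_half_point [IsAlgClosed k] [CharZero k] (h12 : e₁ ≠ e₂) (h13 : e₁ ≠ e₃)
    (h23 : e₂ ≠ e₃) (T : ((curveOfRoots e₁ e₂ e₃)⁄k).Point) : ∃ R, R + R = T := by
  rcases T with _ | ⟨p, q, hT⟩
  · exact ⟨0, add_zero _⟩
  have hq := (curveOfRoots_equation_iff e₁ e₂ e₃ p q).1 hT.1
  simp only [Algebra.algebraMap_self, RingHom.id_apply] at hq
  obtain ⟨r₁, h1⟩ := IsAlgClosed.exists_pow_nat_eq (p - e₁) (n := 2) (by norm_num)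
  obtain ⟨r₂, h2⟩ := IsAlgClosed.exists_pow_nat_eq (p - e₂) (n := 2) (by norm_num)
  obtain ⟨r₃, h3, hr⟩ : ∃ r₃, r₃ ^ 2 = p - e₃ ∧ r₁ * r₂ * r₃ = q := by
    obtain ⟨r₃, h3⟩ := IsAlgClosed.exists_pow_nat_eq (p - e₃) (n := 2) (by norm_num)
    have : (r₁ * r₂ * r₃) ^ 2 = q ^ 2 := by
      rw [hq, mul_pow, mul_pow, h1, h2, h3]
    rcases sq_eq_sq_iff_eq_or_eq_neg.1 this with h | h
    · exact ⟨r₃, h3, h⟩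
    · exact ⟨-r₃, by rw [neg_sq, h3], by linear_combination -h⟩
  have g12 : r₁ + r₂ ≠ 0 := fun h => h12 (by linear_combination h1 - h2 - (r₁ - r₂) * h)
  have g13 : r₁ + r₃ ≠ 0 := fun h => h13 (by linear_combination h1 - h3 - (r₁ - r₃) * h)
  have g23 : r₂ + r₃ ≠ 0 := fun h => h23 (by linear_combination h2 - h3 - (r₂ - r₃) * h)
  obtain ⟨x, hx⟩ : ∃ x, x = p + r₁ * r₂ + r₁ * r₃ + r₂ * r₃ := ⟨_, rfl⟩
  obtain ⟨y, hy⟩ : ∃ y, y = (r₁ + r₂) * (r₁ + r₃) * (r₂ + r₃) := ⟨_, rfl⟩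
  have hy0 : y ≠ 0 := hy ▸ mul_ne_zero (mul_ne_zero g12 g13) g23
  have x1 : x - e₁ = (r₁ + r₂) * (r₁ + r₃) := by rw [hx]; linear_combination -h1
  have x2 : x - e₂ = (r₁ + r₂) * (r₂ + r₃) := by rw [hx]; linear_combination -h2
  have x3 : x - e₃ = (r₁ + r₃) * (r₂ + r₃) := by rw [hx]; linear_combination -h3
  have hxy : y ^ 2 = (x - algebraMap k k e₁) * (x - algebraMap k k e₂) * (x - algebraMap k k e₃) := by
    simp only [Algebra.algebraMap_self, RingHom.id_apply]
    rw [x1, x2, x3, hy]; ring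
  have hneg : y ≠ ((curveOfRoots e₁ e₂ e₃)⁄k).negY x y := by
    rw [negY]
    simp only [curveOfRoots, WeierstrassCurve.baseChange, WeierstrassCurve.map, map_zero]
    intro h
    apply hy0
    linear_combination (1 / 2) * h
  refine ⟨.some x y (curveOfRoots_nonsingular h12 h13 h23 hxy), ?_⟩
  have hsl : ((curveOfRoots e₁ e₂ e₃)⁄k).slope x x y y = r₁ + r₂ + r₃ := by
    rw [slope_of_Y_ne rfl hneg, negY]
    simp only [curveOfRoots, WeierstrassCurve.baseChange, WeierstrassCurve.map, map_zero, map_neg,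
      map_add, map_mul, Algebra.algebraMap_self, RingHom.id_apply]
    rw [div_eq_iff (by intro h; apply hy0; linear_combination (1 / 2) * h)]
    have : 3 * x ^ 2 + 2 * -(e₁ + e₂ + e₃) * x + (e₁ * e₂ + e₁ * e₃ + e₂ * e₃) =
      (x - e₁) * (x - e₂) + (x - e₁) * (x - e₃) + (x - e₂) * (x - e₃) := by ring
    rw [x1, x2, x3] at this
    rw [hy]
    linear_combination this
  have hX : ((curveOfRoots e₁ e₂ e₃)⁄k).addX x x (r₁ + r₂ + r₃) = p := by
    rw [addX]
    simp only [curveOfRoots, WeierstrassCurve.baseChange, WeierstrassCurve.map, map_zero, map_neg,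
      map_add, map_mul, Algebra.algebraMap_self, RingHom.id_apply]
    rw [hx]
    linear_combination h1 + h2 + h3
  rw [Point.add_self_of_Y_ne hneg, Point.some.injEq]
  refine ⟨by rw [hsl, hX], ?_⟩
  rw [hsl, addY, negAddY, hX, negY]
  simp only [curveOfRoots, WeierstrassCurve.baseChange, WeierstrassCurve.map, map_zero]
  rw [hx, hy]
  linear_combination hr

end EllipticCurve

section Translation
open WeierstrassCurve WeierstrassCurve.Affine

variable {k : Type*} [Field k] {e₁ e₂ e₃ : k} {K : Type*} [Field K] [Algebra k K]

open Classical in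
-- The group law is compatible with field extension, so the sum with a constant point can be formed
-- over `k(s, t)` already.
theorem adjoin_le_of_translate {s t s' t' : K}
    (h : ((curveOfRoots e₁ e₂ e₃)⁄K).Nonsingular s t)
    (h' : ((curveOfRoots e₁ e₂ e₃)⁄K).Nonsingular s' t')
    (R : ((curveOfRoots e₁ e₂ e₃)⁄k).Point)
    (he : Point.some s t h + Point.map (Algebra.ofId k K) R = .some s' t' h') :
    adjoin k {s', t'} ≤ adjoin k {s, t} := by
  obtain ⟨E, hE⟩ : ∃ E, E = adjoin k {s, t} := ⟨_, rfl⟩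
  have hs : s ∈ E := hE ▸ subset_adjoin k _ (by simp)
  have ht : t ∈ E := hE ▸ subset_adjoin k _ (by simp)
  have hn : ((curveOfRoots e₁ e₂ e₃)⁄E).Nonsingular ⟨s, hs⟩ ⟨t, ht⟩ :=
    (baseChange_nonsingular (curveOfRoots e₁ e₂ e₃) (f := E.val) E.val.injective ⟨s, hs⟩ ⟨t, ht⟩).1 h
  have h1 : Point.some s t h = Point.map E.val (Point.some _ _ hn) := by
    rw [Point.map_some]; rfl
  have h2 : Point.map (Algebra.ofId k K) R =
      Point.map (W' := curveOfRoots e₁ e₂ e₃) E.val (Point.map (Algebra.ofId k E) R) := by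
    rw [Point.map_map]; rfl
  rw [h1, h2, ← map_add] at he
  rw [← hE]
  rcases hQ : Point.some _ _ hn + Point.map (Algebra.ofId k E) R with _ | ⟨p, q, hpq⟩
  · rw [hQ] at he
    exact absurd he.symm (Point.some_ne_zero _)
  · rw [hQ, Point.map_some, Point.some.injEq] at he
    rw [adjoin_le_iff]
    rintro z (rfl | rfl)
    · rw [← he.1]; exact p.2
    · rw [← he.2]; exact q.2

open Classical in
/-- A point on a constant elliptic curve can be translated by a constant point so that the
given involution acts on it as negation. -/
theorem exists_antiinvariant_translate [IsAlgClosed k] [CharZero k] (h12 : e₁ ≠ e₂) (h13 : e₁ ≠ e₃)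
    (h23 : e₂ ≠ e₃) (σ : K →ₐ[k] K) (hσ : ∀ z, σ (σ z) = z)
    (hfix : ∀ p q, σ p = p → σ q = q → q ^ 2 = (p - algebraMap k K e₁) *
      (p - algebraMap k K e₂) * (p - algebraMap k K e₃) →
      ∃ c d, p = algebraMap k K c ∧ q = algebraMap k K d)
    {s t : K} (hs : Transcendental k s) (h : t ^ 2 = (s - algebraMap k K e₁) *
      (s - algebraMap k K e₂) * (s - algebraMap k K e₃)) :
    ∃ s' t', t' ^ 2 = (s' - algebraMap k K e₁) *
      (s' - algebraMap k K e₂) * (s' - algebraMap k K e₃) ∧ σ s' = s' ∧ σ t' = -t' ∧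
      adjoin k {s', t'} = adjoin k {s, t} := by
  have hP := curveOfRoots_nonsingular h12 h13 h23 h
  obtain ⟨P, hPdef⟩ : ∃ P, P = Point.some s t hP := ⟨_, rfl⟩
  have hσσ : ∀ Q : ((curveOfRoots e₁ e₂ e₃)⁄K).Point, Point.map σ (Point.map σ Q) = Q := by
    intro Q
    rw [Point.map_map, show σ.comp σ = AlgHom.id k K from AlgHom.ext hσ]
    rcases Q with _ | ⟨p, q, hQ⟩
    · rfl
    · rfl
  have hσc : ∀ Q : ((curveOfRoots e₁ e₂ e₃)⁄k).Point,
      Point.map σ (Point.map (Algebra.ofId k K) Q) = Point.map (Algebra.ofId k K) Q := by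
    intro Q
    rw [Point.map_map, show σ.comp (Algebra.ofId k K) = Algebra.ofId k K from Subsingleton.elim _ _]
  -- This sum is invariant under the involution, hence a constant point by `hfix`. With `T = 2R`,
  -- the point `P - R` satisfies `σ(P - R) = T - P - R = -(P - R)`.
  obtain ⟨T, hT⟩ : ∃ T, T = P + Point.map σ P := ⟨_, rfl⟩
  have hTσ : Point.map σ T = T := by rw [hT, map_add, hσσ, add_comm]
  obtain ⟨T₀, hT₀⟩ : ∃ T₀, Point.map (Algebra.ofId k K) T₀ = T := by
    rcases T with _ | ⟨p, q, hpq⟩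
    · exact ⟨0, rfl⟩
    · rw [Point.map_some, Point.some.injEq] at hTσ
      have heq := (curveOfRoots_equation_iff e₁ e₂ e₃ p q).1 hpq.1
      obtain ⟨c, d, rfl, rfl⟩ := hfix p q hTσ.1 hTσ.2 heq
      have : d ^ 2 = (c - algebraMap k k e₁) * (c - algebraMap k k e₂) * (c - algebraMap k k e₃) := by
        apply (algebraMap k K).injective
        simpa using heq
      exact ⟨.some c d (curveOfRoots_nonsingular h12 h13 h23 this), rfl⟩
  obtain ⟨R, hR⟩ := exists_half_point h12 h13 h23 T₀
  obtain ⟨P', hP'⟩ : ∃ P', P' = P - Point.map (Algebra.ofId k K) R := ⟨_, rfl⟩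
  have hneg : Point.map σ P' = -P' := by
    have : Point.map σ P = T - P := by rw [hT]; abel
    rw [hP', map_sub, hσc, this, ← hT₀, ← hR, map_add]; abel
  rcases hP'c : P' with _ | ⟨s', t', hn'⟩
  · exfalso
    have : Point.map (Algebra.ofId k K) R = P := by
      have h0 : P' = 0 := hP'c
      rw [hP', sub_eq_zero] at h0; exact h0.symm
    rcases R with _ | ⟨c, d, hcd⟩
    · rw [hPdef] at this; exact absurd this.symm (Point.some_ne_zero _)
    · rw [hPdef, Point.map_some, Point.some.injEq] at this
      apply hs
      rw [← this.1]
      exact isAlgebraic_algebraMap c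
  · refine ⟨s', t', (curveOfRoots_equation_iff e₁ e₂ e₃ s' t').1 hn'.1, ?_, ?_, ?_⟩
    · rw [hP'c, Point.map_some, Point.neg_some, Point.some.injEq] at hneg
      exact hneg.1
    · rw [hP'c, Point.map_some, Point.neg_some, Point.some.injEq] at hneg
      rw [hneg.2, negY]
      simp [curveOfRoots, WeierstrassCurve.baseChange, WeierstrassCurve.map]
    · apply le_antisymm
      · refine adjoin_le_of_translate hP hn' (-R) ?_
        rw [← hPdef, ← hP'c, hP', map_neg]; abel
      · refine adjoin_le_of_translate hn' hP R ?_
        rw [← hPdef, ← hP'c, hP']; abel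

end Translation

/-! ### From an elliptic subfield to a cubic map -/

section Cover
variable {k : Type*} [Field k] {K : Type*} [Field K] [Algebra k K] {f : k[X]} {x y : K}

theorem exists_roots_of_separable_cubic [IsAlgClosed k] {g : k[X]} (hg : g.Separable)
    (hg3 : g.natDegree = 3) : ∃ c e₁ e₂ e₃ : k, c ≠ 0 ∧ e₁ ≠ e₂ ∧ e₁ ≠ e₃ ∧ e₂ ≠ e₃ ∧
      g = C c * ((X - C e₁) * (X - C e₂) * (X - C e₃)) := by
  have hs := IsAlgClosed.splits g
  have hcard : g.roots.card = 3 := by rw [← hs.natDegree_eq_card_roots, hg3]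
  obtain ⟨e₁, e₂, e₃, he⟩ := Multiset.card_eq_three.1 hcard
  have hnd := nodup_roots hg
  rw [he] at hnd
  simp only [Multiset.insert_eq_cons, Multiset.nodup_cons, Multiset.mem_cons,
    Multiset.mem_singleton, not_or] at hnd
  refine ⟨g.leadingCoeff, e₁, e₂, e₃, leadingCoeff_ne_zero.2 hg.ne_zero, hnd.1.1, hnd.1.2,
    hnd.2.1, ?_⟩
  conv_lhs => rw [hs.eq_prod_roots, he]
  simp [mul_assoc]

/-- The hyperelliptic involution. -/
theorem GenusTwo.IsGenusTwoModel.exists_involution [CharZero k] (h : IsGenusTwoModel f x y) :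
    ∃ σ : K →ₐ[k] K, (∀ z, σ (σ z) = z) ∧ σ y = -y ∧ ∀ z, σ z = z ↔ z ∈ adjoin k {x} := by
  obtain ⟨F, hF⟩ : ∃ F, F = adjoin k {x} := ⟨_, rfl⟩
  have hfin : Module.finrank F K = 2 := hF ▸ h.finrank_eq_two
  have hq : Algebra.IsQuadraticExtension F K := ⟨hfin⟩
  have hfd : FiniteDimensional F K := .of_finrank_pos (by omega)
  have : CharZero F := charZero_of_injective_algebraMap (algebraMap k F).injective
  have hgal : IsGalois F K := inferInstance
  have hcard : Nat.card (K ≃ₐ[F] K) = 2 := by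
    rw [IsGalois.card_aut_eq_finrank, hfin]
  have : Nontrivial (K ≃ₐ[F] K) :=
    Finite.one_lt_card_iff_nontrivial.1 (by rw [hcard]; norm_num)
  obtain ⟨σ, hσ1⟩ := exists_ne (1 : K ≃ₐ[F] K)
  have hσσ : σ * σ = 1 := by
    rw [← sq, ← hcard, pow_card_eq_one']
  have hall : ∀ τ : K ≃ₐ[F] K, τ = 1 ∨ τ = σ := by
    intro τ
    classical
    have := Fintype.ofFinite (K ≃ₐ[F] K)
    by_contra hne
    push Not at hne
    have h3 := Finset.card_le_univ ({1, σ, τ} : Finset (K ≃ₐ[F] K))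
    rw [Finset.card_eq_three.2 ⟨1, σ, τ, hσ1.symm, hne.1.symm, hne.2.symm, rfl⟩,
      ← Nat.card_eq_fintype_card, hcard] at h3
    omega
  have hfix : ∀ z, σ z = z ↔ z ∈ F := by
    intro z
    constructor
    · intro hz
      have := (IsGalois.mem_range_algebraMap_iff_fixed (F := F) (E := K) z).2 (by
        intro τ
        rcases hall τ with rfl | rfl
        · rfl
        · exact hz)
      obtain ⟨w, rfl⟩ := this
      exact w.2
    · intro hz
      exact σ.commutes ⟨z, hz⟩
  refine ⟨(σ.restrictScalars k).toAlgHom, fun z => ?_, ?_, hF ▸ hfix⟩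
  · exact congrArg (fun τ : K ≃ₐ[F] K => τ z) hσσ
  · have h2 : σ y ^ 2 = y ^ 2 := by
      rw [← map_pow]
      exact (hfix _).2 (by rw [h.equation, hF]; exact aeval_mem_adjoin f)
    rcases sq_eq_sq_iff_eq_or_eq_neg.1 h2 with h3 | h3
    · exact absurd ((hfix y).1 h3) (hF ▸ h.notMem)
    · exact h3

/-- An elliptic subfield of degree 3 gives a cubic map `P / Q` such that `f` is, up to squares,
the product of four members of the pencil spanned by `P` and `Q`. -/
theorem GenusTwo.IsGenusTwoModel.exists_cubic_cover [IsAlgClosed k] [CharZero k]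
    (h : IsGenusTwoModel f x y) (hE : HasDegreeThreeEllipticSubfield k K) :
    ∃ (P Q S : k[X]) (e₁ e₂ e₃ : k), IsCoprime P Q ∧ max P.natDegree Q.natDegree = 3 ∧ S ≠ 0 ∧
      e₁ ≠ e₂ ∧ e₁ ≠ e₃ ∧ e₂ ≠ e₃ ∧
      f * S ^ 2 = Q * ((P - C e₁ * Q) * (P - C e₂ * Q) * (P - C e₃ * Q)) := by
  obtain ⟨E, ⟨g, s, t₀, hg, hg3, hs, ht₀, hE⟩, hfin⟩ := hE
  obtain ⟨c, e₁, e₂, e₃, hc, h12, h13, h23, rfl⟩ := exists_roots_of_separable_cubic hg hg3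
  have hcK : CharZero K := charZero_of_injective_algebraMap (algebraMap k K).injective
  -- Dividing `t₀` by a square root of the leading coefficient makes the cubic monic.
  obtain ⟨r, hr⟩ := IsAlgClosed.exists_pow_nat_eq c (n := 2) (by norm_num)
  have hr0 : algebraMap k K r ≠ 0 := by
    rw [_root_.map_ne_zero]; rintro rfl; apply hc; rw [← hr]; norm_num
  obtain ⟨t, ht⟩ : ∃ t, t = t₀ / algebraMap k K r := ⟨_, rfl⟩
  have hE' : adjoin k {s, t} = E := by
    rw [← hE]
    apply le_antisymm
    · rw [adjoin_le_iff]
      rintro z (rfl | rfl)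
      · exact subset_adjoin _ _ (by simp)
      · rw [ht]; exact div_mem (subset_adjoin _ _ (by simp)) (IntermediateField.algebraMap_mem _ r)
    · rw [adjoin_le_iff]
      rintro z (rfl | rfl)
      · exact subset_adjoin _ _ (by simp)
      · rw [show z = t * algebraMap k K r by rw [ht, div_mul_cancel₀ _ hr0]]
        exact mul_mem (subset_adjoin _ _ (by simp)) (IntermediateField.algebraMap_mem _ r)
  have ht2 : t ^ 2 = (s - algebraMap k K e₁) * (s - algebraMap k K e₂) *
      (s - algebraMap k K e₃) := by
    rw [ht, div_pow, ht₀, ← map_pow, hr, div_eq_iff (by rwa [_root_.map_ne_zero])]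
    simp only [map_mul, aeval_C, map_sub, aeval_X]; ring
  obtain ⟨σ, hσσ, hσy, hfix⟩ := h.exists_involution
  have hx := h.transcendental
  obtain ⟨s', t', heq, hs', ht', hadj⟩ := exists_antiinvariant_translate h12 h13 h23 σ hσσ (by
    intro p q hp hq hpq
    obtain ⟨c, rfl⟩ := mem_bot_of_elliptic_equation hx h12 h13 h23 ((hfix p).1 hp)
      ((hfix q).1 hq) hpq
    obtain ⟨d, hd⟩ := IsAlgClosed.exists_pow_nat_eq ((c - e₁) * (c - e₂) * (c - e₃)) (n := 2)
      (by norm_num)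
    have : q ^ 2 = algebraMap k K d ^ 2 := by
      rw [hpq, ← map_pow, hd]; simp
    rcases sq_eq_sq_iff_eq_or_eq_neg.1 this with h | h
    · exact ⟨c, d, rfl, h⟩
    · exact ⟨c, -d, rfl, by rw [h, map_neg]⟩) hs ht2
  have ht'0 : t' ≠ 0 := by
    rintro rfl
    have hs'c : ∃ c, s' = algebraMap k K c := by
      rw [zero_pow two_ne_zero, eq_comm, mul_eq_zero, mul_eq_zero, sub_eq_zero, sub_eq_zero,
        sub_eq_zero] at heq
      rcases heq with (h | h) | h <;> exact ⟨_, h⟩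
    obtain ⟨c, rfl⟩ := hs'c
    have hle : adjoin k {algebraMap k K c, 0} ≤ ⊥ := by
      rw [adjoin_le_iff]
      rintro z (rfl | rfl)
      · exact IntermediateField.algebraMap_mem _ c
      · exact zero_mem _
    have : s ∈ (⊥ : IntermediateField k K) := hle (hadj ▸ subset_adjoin k _ (by simp))
    obtain ⟨d, rfl⟩ := mem_bot.1 this
    exact hs (isAlgebraic_algebraMap d)
  have ht'F : t' ∉ adjoin k {x} := by
    intro hm
    rw [← hfix, ht'] at hm
    apply ht'0
    linear_combination (-1 / 2 : K) * hm
  have hs'F := (hfix s').1 hs'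
  have hle : adjoin k {s'} ≤ adjoin k {x} := by
    rw [adjoin_le_iff]; rintro _ rfl; exact hs'F
  have hs't' : t' ^ 2 = aeval s' ((X - C e₁) * (X - C e₂) * (X - C e₃)) := by
    simp only [heq, map_mul, map_sub, aeval_C, aeval_X]
  have h2 := relfinrank_adjoin_sqrt (S := {s'}) (fun hm => ht'F (hle hm))
    (by rw [hs't']; exact aeval_mem_adjoin _) rfl
  rw [Set.pair_comm, hadj, hE'] at h2
  have hle2 : adjoin k {s'} ≤ E := by
    rw [← hE', ← hadj]; exact adjoin.mono _ _ _ (by simp)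
  -- Both towers from `k(s')` to `K` have degree 6: through `E` it is `2 · 3`, so through `k(x)` the
  -- lower step has degree 3.
  have h6 := relfinrank_mul_finrank_top hle2
  rw [h2, hfin, ← relfinrank_mul_finrank_top hle, h.finrank_eq_two] at h6
  obtain ⟨P, Q, hPQ, hQ, rfl⟩ := exists_coprime_of_mem_adjoin hx hs'F
  rw [relfinrank_adjoin_div hx hPQ hQ] at h6
  have hQ' := aeval_ne_zero_of_transcendental hx hQ
  have hy0 : y ≠ 0 := fun h0 => h.notMem (h0 ▸ zero_mem _)
  -- The involution negates both `t'` and `y`, so it fixes the quotient; this turns `t'²` into `f`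
  -- times a square in `k(x)`.
  have hm : t' / y ∈ adjoin k {x} := by
    rw [← hfix, map_div₀, ht', hσy, neg_div_neg_eq]
  obtain ⟨S, hzS, hS⟩ := exists_aeval_of_squarefree_mul_sq hx h.separable.squarefree
    (N := Q * ((P - C e₁ * Q) * (P - C e₂ * Q) * (P - C e₃ * Q)))
    (z := t' / y * aeval x Q ^ 2) (mul_mem hm (pow_mem (aeval_mem_adjoin Q) 2)) (by
      rw [← h.equation]
      simp only [map_mul, map_sub, aeval_C]
      rw [show y ^ 2 * (t' / y * aeval x Q ^ 2) ^ 2 = t' ^ 2 * aeval x Q ^ 4 by field_simp, heq]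
      field_simp)
  refine ⟨P, Q, S, e₁, e₂, e₃, hPQ, by omega, ?_, h12, h13, h23, hS⟩
  rintro rfl
  rw [map_zero] at hzS
  exact mul_ne_zero (div_ne_zero ht'0 hy0) (pow_ne_zero 2 hQ') hzS

end Cover

/-! ### Möbius transformations and general position -/

section Moebius
variable {k : Type*} [Field k]

theorem eval_reflect_of_natDegree_le {f : k[X]} {N : ℕ} (hf : f.natDegree ≤ N) {z : k}
    (hz : z ≠ 0) : (reflect N f).eval z = z ^ N * f.eval z⁻¹ := by
  have hz' := inv_ne_zero hz
  let _ := invertibleOfNonzero hz'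
  have h := eval₂_reflect_mul_pow (RingHom.id k) z⁻¹ N f hf
  rw [invOf_eq_inv, inv_inv, ← eval, ← eval] at h
  rw [← h, inv_pow]
  field_simp

theorem natDegree_reflect_le_of_le {f : k[X]} {N : ℕ} (hf : f.natDegree ≤ N) :
    (reflect N f).natDegree ≤ N :=
  (natDegree_reflect_le (p := f) (N := N)).trans (by simp [hf])

theorem natDegree_comp_C_mul_X_le {f : k[X]} {N : ℕ} (hf : f.natDegree ≤ N) (d : k) :
    (f.comp (C d * X)).natDegree ≤ N :=
  natDegree_comp_le.trans ((Nat.mul_le_mul hf ((natDegree_C_mul_le d X).trans natDegree_X_le)).trans (mul_one N).le)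

variable [Infinite k]

/-- The absolute invariants do not change under Möbius transformations. -/
theorem sameInvariants_of_moebius {f g : k[X]} (hf : f.natDegree ≤ 6) {p q r s : k}
    (hdet : r * q - p * s ≠ 0)
    (h : ∀ z, p * z + q ≠ 0 → g.eval z = (p * z + q) ^ 6 * f.eval ((r * z + s) / (p * z + q))) :
    SameInvariants f g := by
  by_cases hp : p = 0
  · subst hp
    simp only [zero_mul, zero_add, sub_zero] at hdet h
    obtain ⟨hr, hq⟩ := mul_ne_zero_iff.1 hdet
    refine (sameInvariants_taylor hf (s / q)).trans ((sameInvariants_comp_C_mul_X _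
      (div_ne_zero hr hq)).trans ?_)
    have : g = C (q ^ 6) * (taylor (s / q) f).comp (C (r / q) * X) := by
      apply Polynomial.funext
      intro z
      rw [h z hq, eval_C_mul, eval_comp, taylor_eval, eval_C_mul, eval_X]
      congr 2; field_simp
    rw [this]
    exact sameInvariants_C_mul _ (pow_ne_zero 6 hq)
  -- Use `(r z + s) / (p z + q) = r / p + d / (p z + q)`: a composite of translations, scalings and
  -- one inversion.
  · obtain ⟨d, hd⟩ : ∃ d, d = (s * p - r * q) / p := ⟨_, rfl⟩
    have hd0 : d ≠ 0 := by
      rw [hd]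
      exact div_ne_zero (fun h0 => hdet (by linear_combination -h0)) hp
    have h1 : (taylor (r / p) f).natDegree ≤ 6 := by rwa [natDegree_taylor]
    have h2 := natDegree_comp_C_mul_X_le h1 d
    have h3 := natDegree_reflect_le_of_le h2
    have h4 := natDegree_comp_C_mul_X_le h3 p
    have heq : g = taylor (q / p) ((reflect 6 ((taylor (r / p) f).comp (C d * X))).comp
        (C p * X)) := by
      refine eq_of_infinite_eval_eq _ _ ?_
      refine (Set.Finite.infinite_compl (Set.finite_singleton (-(q / p)))).mono ?_
      intro z hz
      have hz' : p * z + q ≠ 0 := by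
        intro h0
        apply hz
        rw [Set.mem_singleton_iff]
        field_simp
        linear_combination h0
      rw [Set.mem_ofPred_eq, h z hz', taylor_eval, eval_comp, eval_C_mul, eval_X,
        show p * (z + q / p) = p * z + q by field_simp, eval_reflect_of_natDegree_le h2 hz',
        eval_comp, taylor_eval, eval_C_mul, eval_X]
      congr 2
      rw [hd, div_eq_iff hz', add_mul, mul_assoc, inv_mul_cancel₀ hz']
      field_simp
      ring
    rw [heq]
    exact (sameInvariants_taylor hf _).trans ((sameInvariants_comp_C_mul_X _ hd0).trans
      ((sameInvariants_reflect h2).trans ((sameInvariants_comp_C_mul_X _ hp).trans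
        (sameInvariants_taylor h4 _))))

/-- A Möbius transformation moves a product of four members of a pencil into general position. -/
theorem exists_general_position [IsAlgClosed k] {f P Q S : k[X]} {e₁ e₂ e₃ : k}
    (hf : f.natDegree = 5 ∨ f.natDegree = 6)
    (hPQ : IsCoprime P Q) (hdeg : max P.natDegree Q.natDegree = 3) (hS : S ≠ 0)
    (h : f * S ^ 2 = Q * ((P - C e₁ * Q) * (P - C e₂ * Q) * (P - C e₃ * Q))) :
    ∃ f' P' Q' S' : k[X], SameInvariants f f' ∧ f'.natDegree = 6 ∧ IsCoprime P' Q' ∧ S' ≠ 0 ∧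
      Q'.natDegree = 3 ∧ (P' - C e₁ * Q').natDegree = 3 ∧ (P' - C e₂ * Q').natDegree = 3 ∧
      (P' - C e₃ * Q').natDegree = 3 ∧
      f' * S' ^ 2 = Q' * ((P' - C e₁ * Q') * (P' - C e₂ * Q') * (P' - C e₃ * Q')) := by
  have hf0 : f ≠ 0 := by rintro rfl; simp at hf
  have hne : f * S ^ 2 ≠ 0 := mul_ne_zero hf0 (pow_ne_zero 2 hS)
  -- The substitution `X ↦ c + 1 / X` sends infinity to a point where none of the factors vanishes,
  -- so afterwards all of them have full degree.
  obtain ⟨c, hc⟩ : ∃ c, (f * S ^ 2).eval c ≠ 0 := by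
    by_contra! h0
    exact hne (Polynomial.funext fun c => by rw [h0, eval_zero])
  have hP3 : P.natDegree ≤ 3 := hdeg ▸ le_max_left _ _
  have hQ3 : Q.natDegree ≤ 3 := hdeg ▸ le_max_right _ _
  have hM : ∀ e, (P - C e * Q).natDegree ≤ 3 := fun e =>
    (natDegree_sub_le _ _).trans (max_le hP3 ((natDegree_C_mul_le _ _).trans hQ3))
  have hS3 : S.natDegree ≤ 3 := by
    have h1 : (f * S ^ 2).natDegree ≤ 3 + (3 + 3 + 3) := by
      rw [h]
      exact natDegree_mul_le_of_le hQ3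
        (natDegree_mul_le_of_le (natDegree_mul_le_of_le (hM _) (hM _)) (hM _))
    rw [natDegree_mul hf0 (pow_ne_zero 2 hS), natDegree_pow] at h1
    omega
  have hf6 : f.natDegree ≤ 6 := by omega
  have tay : ∀ (g : k[X]) (n : ℕ), g.natDegree ≤ n → (taylor c g).natDegree ≤ n := fun g n hg => by
    rwa [natDegree_taylor]
  have hprod : reflect 6 (taylor c f) * reflect 3 (taylor c S) ^ 2 = reflect 3 (taylor c Q) *
      (reflect 3 (taylor c (P - C e₁ * Q)) * reflect 3 (taylor c (P - C e₂ * Q)) *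
        reflect 3 (taylor c (P - C e₃ * Q))) := by
    have hS' := tay S 3 hS3
    rw [sq, ← reflect_mul _ _ hS' hS', ← reflect_mul _ _ (tay f 6 hf6)
      (natDegree_mul_le_of_le hS' hS'), ← reflect_mul _ _ (tay _ 3 (hM _)) (tay _ 3 (hM _)),
      ← reflect_mul _ _ (natDegree_mul_le_of_le (tay _ 3 (hM _)) (tay _ 3 (hM _)))
        (tay _ 3 (hM _)), ← reflect_mul _ _ (tay _ 3 hQ3) (natDegree_mul_le_of_le
        (natDegree_mul_le_of_le (tay _ 3 (hM _)) (tay _ 3 (hM _))) (tay _ 3 (hM _)))]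
    rw [← taylor_mul, ← taylor_mul, ← taylor_mul, ← taylor_mul, ← taylor_mul, ← sq, h]
  have hlin : ∀ e, reflect 3 (taylor c (P - C e * Q)) = reflect 3 (taylor c P) -
      C e * reflect 3 (taylor c Q) := by
    intro e
    rw [map_sub, reflect_sub, taylor_mul, taylor_C, reflect_C_mul]
  rw [hlin, hlin, hlin] at hprod
  have hcoeff : ∀ (n : ℕ) (g : k[X]), (reflect n (taylor c g)).coeff n = g.eval c := by
    intro n g
    rw [coeff_reflect, revAt_le le_rfl, Nat.sub_self, taylor_coeff_zero]
  have hnat : ∀ (n : ℕ) (g : k[X]), g.natDegree ≤ n → g.eval c ≠ 0 →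
      (reflect n (taylor c g)).natDegree = n := by
    intro n g hg h0
    exact natDegree_eq_of_le_of_coeff_ne_zero (natDegree_reflect_le_of_le (tay g n hg))
      (by rwa [hcoeff])
  have hfc : f.eval c ≠ 0 ∧ S.eval c ≠ 0 := by
    rw [eval_mul, eval_pow] at hc
    exact ⟨left_ne_zero_of_mul hc, fun h0 => hc (by rw [h0]; ring)⟩
  have hMc : Q.eval c ≠ 0 ∧ (P - C e₁ * Q).eval c ≠ 0 ∧ (P - C e₂ * Q).eval c ≠ 0 ∧
      (P - C e₃ * Q).eval c ≠ 0 := by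
    rw [h, eval_mul, eval_mul, eval_mul] at hc
    simp only [mul_ne_zero_iff] at hc
    exact ⟨hc.1, hc.2.1.1, hc.2.1.2, hc.2.2⟩
  refine ⟨reflect 6 (taylor c f), reflect 3 (taylor c P), reflect 3 (taylor c Q),
    reflect 3 (taylor c S), (sameInvariants_taylor hf6 c).trans
      (sameInvariants_reflect (tay f 6 hf6)), hnat 6 f hf6 hfc.1, ?_, ?_, hnat 3 Q hQ3 hMc.1,
    hlin e₁ ▸ hnat 3 _ (hM e₁) hMc.2.1, hlin e₂ ▸ hnat 3 _ (hM e₂) hMc.2.2.1,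
    hlin e₃ ▸ hnat 3 _ (hM e₃) hMc.2.2.2, hprod⟩
  · rw [isCoprime_iff_aeval_ne_zero_of_isAlgClosed k k]
    intro z
    simp only [coe_aeval_eq_eval]
    -- The point `z = 0` is the old point at infinity, which is not a common zero because one of `P,
    -- Q` has degree 3.
    by_cases hz : z = 0
    · subst hz
      have h0 : ∀ g : k[X], g.natDegree ≤ 3 → (reflect 3 (taylor c g)).eval 0 = g.coeff 3 := by
        intro g hg
        rw [← coeff_zero_eq_eval_zero, coeff_reflect, revAt_le (by omega),
          coeff_taylor_of_natDegree_le hg]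
      rw [h0 P hP3, h0 Q hQ3]
      by_contra! h1
      have h2 : ∀ g : k[X], g.natDegree ≤ 3 → g.coeff 3 = 0 → g.natDegree < 3 := by
        intro g hg hg3
        refine lt_of_le_of_ne hg fun h4 => ?_
        rw [← h4, coeff_natDegree, leadingCoeff_eq_zero] at hg3
        rw [hg3] at h4; simp at h4
      have := h2 P hP3 h1.1
      have := h2 Q hQ3 h1.2
      omega
    · rw [eval_reflect_of_natDegree_le (tay P 3 hP3) hz,
        eval_reflect_of_natDegree_le (tay Q 3 hQ3) hz, taylor_eval, taylor_eval]
      have := (isCoprime_iff_aeval_ne_zero_of_isAlgClosed k k P Q).1 hPQ (z⁻¹ + c)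
      simp only [coe_aeval_eq_eval] at this
      exact this.imp (mul_ne_zero (pow_ne_zero 3 hz)) (mul_ne_zero (pow_ne_zero 3 hz))
  · intro h0
    have := hcoeff 3 S
    rw [h0, coeff_zero] at this
    exact hfc.2 this.symm

end Moebius

/-! ### Normalizing three double roots to `0, ∞, 1` -/

section TwoRamified
variable {k : Type*} [Field k]

/-- The product of a member of the pencil spanned by `X² (α X + β)` and `γ X + δ` with the simple
factors of the members having a double root at `0`, `∞`, `1`, where `γ = -(3 α + 2 β)` and
`δ = 2 α + β`. -/
noncomputable def ramifiedSextic (α β ρ σ : k) : k[X] :=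
  (C ρ * (X ^ 2 * (C α * X + C β)) + C σ * (C (-(3 * α + 2 * β)) * X + C (2 * α + β))) *
    ((C α * X + C β) * (C (-(3 * α + 2 * β)) * X + C (2 * α + β)) *
      (C α * X + C (2 * α + β)))

theorem ramifiedSextic_eval (α β ρ σ x : k) : (ramifiedSextic α β ρ σ).eval x =
    (ρ * (x ^ 2 * (α * x + β)) + σ * (-(3 * α + 2 * β) * x + (2 * α + β))) *
      ((α * x + β) * (-(3 * α + 2 * β) * x + (2 * α + β)) * (α * x + (2 * α + β))) := by
  simp only [ramifiedSextic, eval_mul, eval_add, eval_C, eval_X, eval_pow]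

/-- The product of a member of a pencil with the simple factors of three ramified members. -/
noncomputable def pencilSextic (l₁ l₂ A₁ B₁ A₂ B₂ A₃ B₃ ρ σ : k) : k[X] :=
  (C ρ * ((X - C l₁) ^ 2 * (C A₁ * X + C B₁)) + C σ * ((X - C l₂) ^ 2 * (C A₂ * X + C B₂))) *
    ((C A₁ * X + C B₁) * (C A₂ * X + C B₂) * (C A₃ * X + C B₃))

theorem natDegree_pencilSextic_le (l₁ l₂ A₁ B₁ A₂ B₂ A₃ B₃ ρ σ : k) :
    (pencilSextic l₁ l₂ A₁ B₁ A₂ B₂ A₃ B₃ ρ σ).natDegree ≤ 6 := by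
  rw [pencilSextic]; compute_degree

/-- The Möbius map `z ↦ (l₂ p z + l₁ q) / (p z + q)` with `p = l₃ - l₁`, `q = l₂ - l₃` sends `0, ∞,
1` to `l₁, l₂, l₃`. After the substitution the third member, the sum of the other two, has a double
root at 1; this fixes the coefficients `-(3α + 2β)` and `2α + β`. -/
theorem sameInvariants_pencilSextic [Infinite k] {l₁ l₂ l₃ : k} (h12 : l₁ ≠ l₂) (h13 : l₁ ≠ l₃)
    (h23 : l₂ ≠ l₃) {A₁ B₁ A₂ B₂ A₃ B₃ : k}
    (hrel : (X - C l₃) ^ 2 * (C A₃ * X + C B₃) = (X - C l₁) ^ 2 * (C A₁ * X + C B₁) +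
      (X - C l₂) ^ 2 * (C A₂ * X + C B₂)) (ρ σ : k) :
    ∃ α β, SameInvariants (pencilSextic l₁ l₂ A₁ B₁ A₂ B₂ A₃ B₃ ρ σ)
      (ramifiedSextic α β ρ σ) := by
  have hco : ∀ l A B : k, (X - C l) ^ 2 * (C A * X + C B) = C A * X ^ 3 + C (B - 2 * l * A) * X ^ 2
      + C (l ^ 2 * A - 2 * l * B) * X + C (l ^ 2 * B) := by
    intro l A B
    simp only [map_sub, map_mul, map_pow, map_ofNat]; ring
  rw [hco, hco, hco] at hrel
  have e3 : A₃ = A₁ + A₂ := by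
    simpa only [coeff_add, coeff_C_mul, coeff_X_pow, coeff_X, coeff_C, OfNat.ofNat_ne_zero,
      if_true, if_false, mul_zero, mul_one, add_zero, show ((3 : ℕ) = 2) = False by simp,
      show ((1 : ℕ) = 3) = False by simp] using congrArg (fun f : k[X] => f.coeff 3) hrel
  have e2 : B₃ - 2 * l₃ * A₃ = (B₁ - 2 * l₁ * A₁) + (B₂ - 2 * l₂ * A₂) := by
    simpa only [coeff_add, coeff_C_mul, coeff_X_pow, coeff_X, coeff_C, OfNat.ofNat_ne_one,
      OfNat.ofNat_ne_zero, if_true, if_false, mul_zero, mul_one, add_zero, zero_add,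
      show ((2 : ℕ) = 3) = False by simp, show ((1 : ℕ) = 2) = False by simp] using
      congrArg (fun f : k[X] => f.coeff 2) hrel
  have e1 : l₃ ^ 2 * A₃ - 2 * l₃ * B₃ =
      (l₁ ^ 2 * A₁ - 2 * l₁ * B₁) + (l₂ ^ 2 * A₂ - 2 * l₂ * B₂) := by
    simpa only [coeff_add, coeff_C_mul, coeff_X_pow, coeff_X, coeff_C, OfNat.ofNat_ne_one,
      one_ne_zero, if_true, if_false, mul_zero, mul_one, add_zero, zero_add,
      show ((1 : ℕ) = 3) = False by simp, show ((1 : ℕ) = 2) = False by simp] using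
      congrArg (fun f : k[X] => f.coeff 1) hrel
  have e0 : l₃ ^ 2 * B₃ = l₁ ^ 2 * B₁ + l₂ ^ 2 * B₂ := by
    simpa only [eval_add, eval_mul, eval_C, eval_X, eval_pow, mul_zero, zero_add, ne_eq,
      OfNat.ofNat_ne_zero, not_false_eq_true, zero_pow] using congrArg (eval 0) hrel
  obtain ⟨p, hp⟩ : ∃ p, p = l₃ - l₁ := ⟨_, rfl⟩
  obtain ⟨q, hq⟩ : ∃ q, q = l₂ - l₃ := ⟨_, rfl⟩
  have hp0 : p ≠ 0 := hp ▸ sub_ne_zero.2 h13.symm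
  have hq0 : q ≠ 0 := hq ▸ sub_ne_zero.2 h23
  have hd0 : l₂ - l₁ ≠ 0 := sub_ne_zero.2 h12.symm
  obtain ⟨α, hα⟩ : ∃ α, α = (l₂ - l₁) ^ 2 * p ^ 2 * ((A₁ * l₂ + B₁) * p) := ⟨_, rfl⟩
  obtain ⟨β, hβ⟩ : ∃ β, β = (l₂ - l₁) ^ 2 * p ^ 2 * ((A₁ * l₁ + B₁) * q) := ⟨_, rfl⟩
  -- The four identities `w3, w2, w1, w0` compare coefficients of the transformed relation: up to
  -- factors they are the polar forms of `hrel` at `(l₂, l₂, l₂)`, `(l₂, l₂, l₁)`, `(l₁, l₁, l₂)`,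
  -- `(l₁, l₁, l₁)`.
  have w3 : p ^ 2 * q ^ 2 * ((A₃ * l₂ + B₃) * p) = α := by
    rw [hα, hp, hq]
    linear_combination (l₃ - l₁) ^ 3 * (l₂ ^ 3 * e3 + l₂ ^ 2 * e2 + l₂ * e1 + e0)
  have w2 : p ^ 2 * q ^ 2 * ((A₃ * l₁ + B₃) * q - 2 * ((A₃ * l₂ + B₃) * p)) = β := by
    rw [hβ, hp, hq]
    linear_combination (l₃ - l₁) ^ 2 * (l₂ - l₃) * (3 * l₂ ^ 2 * l₁ * e3 +
      (l₂ ^ 2 + 2 * l₂ * l₁) * e2 + (2 * l₂ + l₁) * e1 + 3 * e0)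
  have w1 : (l₁ - l₂) ^ 2 * q ^ 2 * ((A₂ * l₂ + B₂) * p) =
      p ^ 2 * q ^ 2 * ((A₃ * l₂ + B₃) * p - 2 * ((A₃ * l₁ + B₃) * q)) := by
    rw [hp, hq]
    linear_combination -((l₃ - l₁) * (l₂ - l₃) ^ 2 * (3 * l₂ * l₁ ^ 2 * e3 +
      (l₁ ^ 2 + 2 * l₂ * l₁) * e2 + (2 * l₁ + l₂) * e1 + 3 * e0))
  have w0 : (l₁ - l₂) ^ 2 * q ^ 2 * ((A₂ * l₁ + B₂) * q) =
      p ^ 2 * q ^ 2 * ((A₃ * l₁ + B₃) * q) := by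
    rw [hp, hq]
    linear_combination -((l₂ - l₃) ^ 3 * (l₁ ^ 3 * e3 + l₁ ^ 2 * e2 + l₁ * e1 + e0))
  have hζ : p ^ 2 * q ^ 2 * ((A₃ * l₁ + B₃) * q) = 2 * α + β := by
    linear_combination w2 + 2 * w3
  have hγ : (l₁ - l₂) ^ 2 * q ^ 2 * ((A₂ * l₂ + B₂) * p) = -(3 * α + 2 * β) := by
    linear_combination w1 + w3 - 2 * hζ
  have hδ := w0.trans hζ
  obtain ⟨κ, hκ⟩ : ∃ κ, κ = (l₂ - l₁) ^ 2 * p ^ 2 * ((l₁ - l₂) ^ 2 * q ^ 2) * (p ^ 2 * q ^ 2) :=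
    ⟨_, rfl⟩
  have hκ0 : κ ≠ 0 := by
    rw [hκ, ← neg_sub l₂ l₁, neg_sq]
    simp only [mul_ne_zero_iff, pow_ne_zero_iff two_ne_zero]
    exact ⟨⟨⟨hd0, hp0⟩, hd0, hq0⟩, hp0, hq0⟩
  have hdeg := natDegree_pencilSextic_le l₁ l₂ A₁ B₁ A₂ B₂ A₃ B₃ ρ σ
  refine ⟨α, β, (sameInvariants_C_mul _ hκ0).trans (sameInvariants_of_moebius
    (p := p) (q := q) (r := l₂ * p) (s := l₁ * q)
    ((natDegree_C_mul_le _ _).trans hdeg) ?_ ?_)⟩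
  · rw [show l₂ * p * q - p * (l₁ * q) = (l₂ - l₁) * (p * q) by ring]
    exact mul_ne_zero hd0 (mul_ne_zero hp0 hq0)
  · intro z hz
    obtain ⟨x, hx⟩ : ∃ x, x = (l₂ * p * z + l₁ * q) / (p * z + q) := ⟨_, rfl⟩
    obtain ⟨d, hd⟩ : ∃ d, d = p * z + q := ⟨_, rfl⟩
    rw [← hd] at hx hz
    have hxd : x * d = l₂ * p * z + l₁ * q := by rw [hx, div_mul_cancel₀ _ hz]
    have g1 : d * (x - l₁) = (l₂ - l₁) * (p * z) := by rw [mul_sub, mul_comm, hxd, hd]; ring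
    have g2 : d * (x - l₂) = (l₁ - l₂) * q := by rw [mul_sub, mul_comm, hxd, hd]; ring
    have lin : ∀ A B : k, d * (A * x + B) = (A * l₂ + B) * p * z + (A * l₁ + B) * q := by
      intro A B
      rw [show d * (A * x + B) = A * (x * d) + B * d by ring, hxd, hd]; ring
    have f1 : (l₂ - l₁) ^ 2 * p ^ 2 * (d * (A₁ * x + B₁)) = α * z + β := by
      rw [lin, hα, hβ]; ring
    have f2 : (l₁ - l₂) ^ 2 * q ^ 2 * (d * (A₂ * x + B₂)) =
        -(3 * α + 2 * β) * z + (2 * α + β) := by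
      rw [lin, ← hγ, ← hδ]; ring
    have f3 : p ^ 2 * q ^ 2 * (d * (A₃ * x + B₃)) = α * z + (2 * α + β) := by
      rw [lin]
      linear_combination z * w3 + hζ
    have c1 : z ^ 2 * (α * z + β) = d ^ 3 * ((x - l₁) ^ 2 * (A₁ * x + B₁)) := by
      rw [← f1]
      linear_combination -(d * (A₁ * x + B₁)) * (d * (x - l₁) + (l₂ - l₁) * (p * z)) * g1
    have c2 : -(3 * α + 2 * β) * z + (2 * α + β) = d ^ 3 * ((x - l₂) ^ 2 * (A₂ * x + B₂)) := by
      rw [← f2]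
      linear_combination -(d * (A₂ * x + B₂)) * (d * (x - l₂) + (l₁ - l₂) * q) * g2
    rw [ramifiedSextic_eval, ← hd, ← hx]
    simp only [pencilSextic, eval_mul, eval_add, eval_C, eval_X, eval_pow, eval_sub]
    rw [c1]
    have hB : (α * z + β) * (-(3 * α + 2 * β) * z + (2 * α + β)) * (α * z + (2 * α + β)) =
        d ^ 3 * (κ * ((A₁ * x + B₁) * (A₂ * x + B₂) * (A₃ * x + B₃))) := by
      rw [← f1, ← f2, ← f3, hκ]; ring
    rw [hB, c2]
    ring

end TwoRamified

/-! ### Ramification type of the cubic map -/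

section Ramification
variable {k : Type*} [Field k]

theorem exists_mul_sq_of_coprime {a b f S : k[X]} (h : IsCoprime a b) (hS : S ≠ 0)
    (e : a * b = f * S ^ 2) : ∃ f₁ S₁ f₂ S₂, a = f₁ * S₁ ^ 2 ∧ b = f₂ * S₂ ^ 2 ∧ f = f₁ * f₂ ∧
      S = S₁ * S₂ := by
  have hdvd : S ∣ a * b := ⟨f * S, by rw [e]; ring⟩
  obtain ⟨S₁, S₂, h1, h2, rfl⟩ := exists_dvd_and_dvd_of_dvd_mul hdvd
  have n1 := left_ne_zero_of_mul hS
  have n2 := right_ne_zero_of_mul hS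
  have d1 : S₁ ^ 2 ∣ a := by
    have hc : IsCoprime (S₁ ^ 2) b := (h.of_isCoprime_of_dvd_left h1).pow_left
    exact hc.dvd_of_dvd_mul_right ⟨f * S₂ ^ 2, by rw [e]; ring⟩
  have d2 : S₂ ^ 2 ∣ b := by
    have hc : IsCoprime (S₂ ^ 2) a := (h.symm.of_isCoprime_of_dvd_left h2).pow_left
    exact hc.dvd_of_dvd_mul_left ⟨f * S₁ ^ 2, by rw [e]; ring⟩
  obtain ⟨f₁, rfl⟩ := d1
  obtain ⟨f₂, rfl⟩ := d2
  refine ⟨f₁, S₁, f₂, S₂, mul_comm _ _, mul_comm _ _, ?_, rfl⟩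
  apply mul_right_cancel₀ (pow_ne_zero 2 hS)
  rw [← e]; ring

theorem isCoprime_pencil {P Q : k[X]} (h : IsCoprime P Q) {a b c d : k} (hdet : a * d - c * b ≠ 0) :
    IsCoprime (C a * P + C b * Q) (C c * P + C d * Q) := by
  obtain ⟨u, v, huv⟩ := h
  have hc : C (a * d - c * b)⁻¹ * (C a * C d - C c * C b) = 1 := by
    rw [← C_mul, ← C_mul, ← C_sub, ← C_mul, inv_mul_cancel₀ hdet, C_1]
  refine ⟨C (a * d - c * b)⁻¹ * (u * C d - v * C c), C (a * d - c * b)⁻¹ * (v * C a - u * C b), ?_⟩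
  linear_combination huv + (u * P + v * Q) * hc

theorem exists_root_of_natDegree_eq_one {S : k[X]} (h : S.natDegree = 1) :
    ∃ s l : k, s ≠ 0 ∧ S = C s * (X - C l) := by
  obtain ⟨a, ha, b, rfl⟩ := natDegree_eq_one.1 h
  refine ⟨a, -b / a, ha, ?_⟩
  rw [mul_sub, ← C_mul, mul_div_cancel₀ _ ha, C_neg, sub_neg_eq_add]

variable [Infinite k]

theorem exists_sameInvariants_of_three_ramified {C₀ C₁ C₂ C₃ f₁ f₂ f₃ S₁ S₂ S₃ : k[X]}
    (h1 : C₁ = f₁ * S₁ ^ 2) (h2 : C₂ = f₂ * S₂ ^ 2) (h3 : C₃ = f₃ * S₃ ^ 2)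
    (df1 : f₁.natDegree = 1) (df2 : f₂.natDegree = 1) (df3 : f₃.natDegree = 1)
    (dS1 : S₁.natDegree = 1) (dS2 : S₂.natDegree = 1) (dS3 : S₃.natDegree = 1)
    (c12 : IsCoprime C₁ C₂) (c13 : IsCoprime C₁ C₃) (c23 : IsCoprime C₂ C₃)
    {u v ρ σ : k} (hu : u ≠ 0) (hv : v ≠ 0) (huv : C₃ = C u * C₁ + C v * C₂)
    (h0 : C₀ = C ρ * C₁ + C σ * C₂) :
    ∃ α β ρ σ, SameInvariants (C₀ * (f₁ * f₂ * f₃)) (ramifiedSextic α β ρ σ) := by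
  obtain ⟨s₁, l₁, hs1, rfl⟩ := exists_root_of_natDegree_eq_one dS1
  obtain ⟨s₂, l₂, hs2, rfl⟩ := exists_root_of_natDegree_eq_one dS2
  obtain ⟨s₃, l₃, hs3, rfl⟩ := exists_root_of_natDegree_eq_one dS3
  obtain ⟨A₁, -, B₁, rfl⟩ := natDegree_eq_one.1 df1
  obtain ⟨A₂, -, B₂, rfl⟩ := natDegree_eq_one.1 df2
  obtain ⟨A₃, -, B₃, rfl⟩ := natDegree_eq_one.1 df3
  have hl : ∀ {l l' s s' : k} {f f' : k[X]}, IsCoprime (f * (C s * (X - C l)) ^ 2)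
      (f' * (C s' * (X - C l')) ^ 2) → l ≠ l' := by
    rintro l l' s s' f f' ⟨p, q, h⟩ rfl
    have := congrArg (eval l) h
    simp at this
  have h12 := hl (h1 ▸ h2 ▸ c12)
  have h13 := hl (h1 ▸ h3 ▸ c13)
  have h23 := hl (h2 ▸ h3 ▸ c23)
  obtain ⟨α, β, hs⟩ := sameInvariants_pencilSextic h12 h13 h23 (A₁ := u * s₁ ^ 2 * A₁)
    (B₁ := u * s₁ ^ 2 * B₁) (A₂ := v * s₂ ^ 2 * A₂) (B₂ := v * s₂ ^ 2 * B₂) (A₃ := s₃ ^ 2 * A₃)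
    (B₃ := s₃ ^ 2 * B₃) (by
      rw [h1, h2, h3] at huv
      simp only [map_mul, map_pow]
      linear_combination huv) (ρ / u) (σ / v)
  have hκ : u * v * (s₁ ^ 2 * s₂ ^ 2 * s₃ ^ 2) ≠ 0 := by
    simp [hu, hv, hs1, hs2, hs3]
  refine ⟨α, β, ρ / u, σ / v, (sameInvariants_C_mul _ hκ).trans ?_⟩
  convert! hs using 1
  rw [pencilSextic, h0, h1, h2]
  have e1 : C (ρ / u) * C u = C ρ := by rw [← C_mul, div_mul_cancel₀ _ hu]
  have e2 : C (σ / v) * C v = C σ := by rw [← C_mul, div_mul_cancel₀ _ hv]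
  rw [← e1, ← e2]
  simp only [map_mul, map_pow]
  ring

/-- Cramer's rule expresses the members 0 and 3 of the pencil through the members 1 and 2; the
determinants being nonzero, both coefficients for member 3 are nonzero. -/
theorem exists_sameInvariants_of_pencil {P Q : k[X]} (hPQ : IsCoprime P Q) (a b : Fin 4 → k)
    (hdet : ∀ i j, i ≠ j → a i * b j - a j * b i ≠ 0) (f S : Fin 4 → k[X])
    (h : ∀ i, C (a i) * P + C (b i) * Q = f i * S i ^ 2) (hS0 : (S 0).natDegree = 0)
    (hS0' : S 0 ≠ 0) (hdeg : ∀ i, i ≠ 0 → (f i).natDegree = 1 ∧ (S i).natDegree = 1) :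
    ∃ α β ρ σ, SameInvariants (∏ i, f i) (ramifiedSextic α β ρ σ) := by
  obtain ⟨c, hc⟩ := natDegree_eq_zero.1 hS0
  have hc0 : c ≠ 0 := by rintro rfl; exact hS0' (by rw [← hc, C_0])
  have hΔ := hdet 1 2 (by decide)
  have comb : ∀ i, C (a i) * P + C (b i) * Q =
      C ((a i * b 2 - a 2 * b i) / (a 1 * b 2 - a 2 * b 1)) * (C (a 1) * P + C (b 1) * Q) +
      C ((a 1 * b i - a i * b 1) / (a 1 * b 2 - a 2 * b 1)) * (C (a 2) * P + C (b 2) * Q) := by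
    intro i
    have ha : a i = (a i * b 2 - a 2 * b i) / (a 1 * b 2 - a 2 * b 1) * a 1 +
        (a 1 * b i - a i * b 1) / (a 1 * b 2 - a 2 * b 1) * a 2 := by
      rw [div_mul_eq_mul_div, div_mul_eq_mul_div, ← add_div, eq_div_iff hΔ]; ring
    have hb : b i = (a i * b 2 - a 2 * b i) / (a 1 * b 2 - a 2 * b 1) * b 1 +
        (a 1 * b i - a i * b 1) / (a 1 * b 2 - a 2 * b 1) * b 2 := by
      rw [div_mul_eq_mul_div, div_mul_eq_mul_div, ← add_div, eq_div_iff hΔ]; ring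
    generalize (a i * b 2 - a 2 * b i) / (a 1 * b 2 - a 2 * b 1) = u at *
    generalize (a 1 * b i - a i * b 1) / (a 1 * b 2 - a 2 * b 1) = v at *
    rw [ha, hb]
    simp only [map_mul, map_add]; ring
  obtain ⟨α, β, ρ, σ, hs⟩ := exists_sameInvariants_of_three_ramified
    (C₀ := C (a 0) * P + C (b 0) * Q) (h 1) (h 2) (h 3)
    (hdeg 1 (by decide)).1 (hdeg 2 (by decide)).1 (hdeg 3 (by decide)).1
    (hdeg 1 (by decide)).2 (hdeg 2 (by decide)).2 (hdeg 3 (by decide)).2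
    (isCoprime_pencil hPQ (hdet 1 2 (by decide))) (isCoprime_pencil hPQ (hdet 1 3 (by decide)))
    (isCoprime_pencil hPQ (hdet 2 3 (by decide)))
    (div_ne_zero (hdet 3 2 (by decide)) hΔ) (div_ne_zero (hdet 1 3 (by decide)) hΔ)
    (comb 3) (comb 0)
  refine ⟨α, β, ρ, σ, (sameInvariants_C_mul _ (pow_ne_zero 2 hc0)).trans ?_⟩
  convert! hs using 1
  rw [Fin.prod_univ_four, h 0, ← hc, C_pow]
  ring

/-- In general position, exactly three of the four branch points of an elliptic subfield of
degree 3 are ramified at Weierstrass points. -/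
theorem exists_sameInvariants_ramifiedSextic {f P Q S : k[X]} {e₁ e₂ e₃ : k}
    (h12 : e₁ ≠ e₂) (h13 : e₁ ≠ e₃) (h23 : e₂ ≠ e₃) (hf : f.natDegree = 6) (hPQ : IsCoprime P Q)
    (hS : S ≠ 0) (d0 : Q.natDegree = 3) (d1 : (P - C e₁ * Q).natDegree = 3)
    (d2 : (P - C e₂ * Q).natDegree = 3) (d3 : (P - C e₃ * Q).natDegree = 3)
    (h : f * S ^ 2 = Q * ((P - C e₁ * Q) * (P - C e₂ * Q) * (P - C e₃ * Q))) :
    ∃ α β ρ σ, SameInvariants f (ramifiedSextic α β ρ σ) := by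
  let a : Fin 4 → k := ![0, 1, 1, 1]
  let b : Fin 4 → k := ![1, -e₁, -e₂, -e₃]
  have hdet : ∀ i j, i ≠ j → a i * b j - a j * b i ≠ 0 := by
    intro i j hij h0
    fin_cases i <;> fin_cases j <;> simp [a, b] at hij h0 <;>
      first
      | exact h12 (by linear_combination h0)
      | exact h12 (by linear_combination -h0)
      | exact h13 (by linear_combination h0)
      | exact h13 (by linear_combination -h0)
      | exact h23 (by linear_combination h0)
      | exact h23 (by linear_combination -h0)
  have hm : ∀ i, C (a i) * P + C (b i) * Q = ![Q, P - C e₁ * Q, P - C e₂ * Q, P - C e₃ * Q] i := by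
    intro i; fin_cases i <;> simp [a, b, sub_eq_add_neg]
  have hcop : ∀ i j, i ≠ j → IsCoprime (C (a i) * P + C (b i) * Q) (C (a j) * P + C (b j) * Q) :=
    fun i j hij => isCoprime_pencil hPQ (hdet i j hij)
  simp only [hm] at hcop
  have c01 := hcop 0 1 (by decide)
  have c02 := hcop 0 2 (by decide)
  have c03 := hcop 0 3 (by decide)
  have c12 := hcop 1 2 (by decide)
  have c13 := hcop 1 3 (by decide)
  have c23 := hcop 2 3 (by decide)
  simp only [Matrix.cons_val] at c01 c02 c03 c12 c13 c23
  obtain ⟨f₀, S₀, g, T, q0, q1, rfl, rfl⟩ := exists_mul_sq_of_coprime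
    ((c01.mul_right c02).mul_right c03) hS h.symm
  obtain ⟨g', T', f₃, S₃, q2, q3, rfl, rfl⟩ := exists_mul_sq_of_coprime
    (c13.mul_left c23) (right_ne_zero_of_mul hS) q1
  obtain ⟨f₁, S₁, f₂, S₂, q4, q5, rfl, rfl⟩ := exists_mul_sq_of_coprime
    c12 (left_ne_zero_of_mul (right_ne_zero_of_mul hS)) q2
  let F : Fin 4 → k[X] := ![f₀, f₁, f₂, f₃]
  let T : Fin 4 → k[X] := ![S₀, S₁, S₂, S₃]
  have hFT : ∀ i, C (a i) * P + C (b i) * Q = F i * T i ^ 2 := by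
    intro i; rw [hm]; fin_cases i
    · exact q0
    · exact q4
    · exact q5
    · exact q3
  have hprod : ∏ i, F i = f₀ * (f₁ * f₂ * f₃) := by
    rw [Fin.prod_univ_four]; simp only [F, Matrix.cons_val]; ring
  rw [← hprod] at hf ⊢
  have hd : ∀ i, (C (a i) * P + C (b i) * Q).natDegree = 3 := by
    intro i; rw [hm]; fin_cases i
    · exact d0
    · exact d1
    · exact d2
    · exact d3
  have hne : ∀ i, F i ≠ 0 ∧ T i ≠ 0 := by
    intro i
    have h1 := hd i
    rw [hFT] at h1
    constructor <;> intro h0 <;> rw [h0] at h1 <;> simp at h1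
  have hdeg : ∀ i, (F i).natDegree + 2 * (T i).natDegree = 3 := by
    intro i
    rw [← hd i, hFT, natDegree_mul (hne i).1 (pow_ne_zero 2 (hne i).2), natDegree_pow]
  have hsum : (F 0).natDegree + (F 1).natDegree + (F 2).natDegree + (F 3).natDegree = 6 := by
    rw [← hf, natDegree_prod _ _ fun i _ => (hne i).1, Fin.sum_univ_four]
  -- From `deg Fᵢ + 2 deg Tᵢ = 3` each `deg Tᵢ` is 0 or 1, and `∑ deg Fᵢ = 6` gives `∑ deg Tᵢ = 3`;
  -- so exactly one is 0. That index is then swapped to 0.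
  obtain ⟨i₀, hi⟩ : ∃ i₀, ∀ i, (T i).natDegree = if i = i₀ then 0 else 1 := by
    have := hdeg 0
    have := hdeg 1
    have := hdeg 2
    have := hdeg 3
    by_cases t0 : (T 0).natDegree = 0
    · refine ⟨0, fun i => ?_⟩; fin_cases i <;> simp <;> omega
    by_cases t1 : (T 1).natDegree = 0
    · refine ⟨1, fun i => ?_⟩; fin_cases i <;> simp <;> omega
    by_cases t2 : (T 2).natDegree = 0
    · refine ⟨2, fun i => ?_⟩; fin_cases i <;> simp <;> omega
    · refine ⟨3, fun i => ?_⟩; fin_cases i <;> simp <;> omega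
  let e := Equiv.swap 0 i₀
  rw [← Equiv.prod_comp e F]
  have he0 : e 0 = i₀ := Equiv.swap_apply_left 0 i₀
  refine exists_sameInvariants_of_pencil hPQ (a ∘ e) (b ∘ e)
    (fun i j hij => hdet _ _ (e.injective.ne hij)) (F ∘ e) (T ∘ e) (fun i => hFT (e i)) ?_
    (hne (e 0)).2 ?_
  · rw [Function.comp_apply, hi, he0, if_pos rfl]
  · intro i hi0
    have h1 := hi (e i)
    rw [if_neg (by rw [← he0]; exact e.injective.ne hi0)] at h1
    have h2 := hdeg (e i)
    exact ⟨by rw [Function.comp_apply]; omega, h1⟩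

end Ramification

/-! ### The generic ramified sextic is equivalent to some `F G` -/

section Generic
variable {k : Type*} [Field k] [IsAlgClosed k] [CharZero k]

/-- Besides `0, ∞, 1` the cubic map has a fourth ramification point `-(t - 1)(t + 1) / (2t + 1)`,
and `(t - 1) / (2t + 1)` is the simple point of its fibre. The Möbius map moves these to `z = 0` and
`z = ∞`, so the pencil contains `z²`; this is the pencil of `F` and `X²` in the normal form. The
three simple roots become the roots of `G`. -/
theorem exists_sameInvariants_sextic_one {t ρ σ : k} (h0 : t ≠ 0) (h1 : t + 1 ≠ 0) (h2 : t - 1 ≠ 0)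
    (h3 : t + 2 ≠ 0) (h4 : 2 * t + 1 ≠ 0)
    (h5 : ρ * ((t - 1) ^ 3 * (t + 1)) + σ * (2 * t + 1) ^ 3 ≠ 0) :
    ∃ a b, SameInvariants (ramifiedSextic 1 (t - 1) ρ σ) (sextic a b) := by
  -- This cube root is the scaling of `z` that makes the constant terms of the monic pencil members
  -- equal to 1.
  obtain ⟨r, hr⟩ := IsAlgClosed.exists_pow_nat_eq (t * (t + 1) / 2) (n := 3) (by norm_num)
  have hr0 : r ≠ 0 := by
    rintro rfl
    rw [zero_pow (by norm_num), eq_comm] at hr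
    exact div_ne_zero (mul_ne_zero h0 h1) two_ne_zero hr
  replace hr : 2 * r ^ 3 = t * (t + 1) := by rw [hr]; field_simp
  obtain ⟨b, hb⟩ : ∃ b, r ^ 2 * b = 2 * r ^ 3 + 1 :=
    ⟨(2 * r ^ 3 + 1) / r ^ 2, mul_div_cancel₀ _ (pow_ne_zero 2 hr0)⟩
  obtain ⟨a₁, ha₁⟩ : ∃ a, 2 * (t + 1) * r * a = t - 4 * (t + 1) ^ 2 :=
    ⟨(t - 4 * (t + 1) ^ 2) / (2 * (t + 1) * r),
      mul_div_cancel₀ _ (mul_ne_zero (mul_ne_zero two_ne_zero h1) hr0)⟩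
  obtain ⟨a₂, ha₂⟩ : ∃ a, r * a = r ^ 3 + 2 := ⟨(r ^ 3 + 2) / r, mul_div_cancel₀ _ hr0⟩
  obtain ⟨l, hl⟩ : ∃ l, l = ρ * ((t - 1) ^ 3 * (t + 1)) + σ * (2 * t + 1) ^ 3 := ⟨_, rfl⟩
  rw [← hl] at h5
  -- Two ramified members become multiples of `z³ + aᵢ z² + b z + 1` with a common `b`, so the
  -- fourth member has the same shape with `a` a weighted mean. The total weight `l` is nonzero
  -- exactly when that member is not a multiple of `z²`.
  obtain ⟨a, ha⟩ : ∃ a, l * a = ρ * ((t - 1) ^ 3 * (t + 1)) * a₁ + σ * (2 * t + 1) ^ 3 * a₂ :=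
    ⟨_, mul_div_cancel₀ _ h5⟩
  obtain ⟨κ, hκ⟩ : ∃ κ, κ = 2 * r ^ 3 * l * (4 * (2 * t + 1) * (t - 1) * (t + 2) * r ^ 6) :=
    ⟨_, rfl⟩
  have hκ0 : κ ≠ 0 := by
    rw [hκ]
    exact mul_ne_zero (mul_ne_zero (mul_ne_zero two_ne_zero (pow_ne_zero 3 hr0)) h5)
      (mul_ne_zero (mul_ne_zero (mul_ne_zero (mul_ne_zero (by norm_num) h4) h2) h3)
        (pow_ne_zero 6 hr0))
  have hdeg : (ramifiedSextic 1 (t - 1) ρ σ).natDegree ≤ 6 := by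
    rw [ramifiedSextic]; compute_degree
  refine ⟨a, b, (sameInvariants_C_mul _ (inv_ne_zero hκ0)).trans (sameInvariants_of_moebius
    (p := (2 * t + 1) * r) (q := 2 * t + 1) (r := (t - 1) * r) (s := -((t - 1) * (t + 1)))
    ((natDegree_C_mul_le _ _).trans hdeg) ?_ ?_)⟩
  · rw [show (t - 1) * r * (2 * t + 1) - (2 * t + 1) * r * -((t - 1) * (t + 1)) =
      (2 * t + 1) * r * ((t - 1) * (t + 2)) by ring]
    exact mul_ne_zero (mul_ne_zero h4 hr0) (mul_ne_zero h2 h3)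
  · intro z hz
    obtain ⟨d, hd⟩ : ∃ d, d = (2 * t + 1) * r * z + (2 * t + 1) := ⟨_, rfl⟩
    obtain ⟨x, hx⟩ : ∃ x, x = ((t - 1) * r * z + -((t - 1) * (t + 1))) / d := ⟨_, rfl⟩
    rw [← hd] at hz
    rw [← hd, ← hx, eval_C_mul, ramifiedSextic_eval]
    have hxd : d * x = (t - 1) * (r * z - (t + 1)) := by
      rw [hx, mul_div_cancel₀ _ hz]; ring
    have i1 : (r * z - (t + 1)) ^ 2 * (t + 2 * (t + 1) * r * z) =
        2 * (t + 1) * r ^ 3 * (z ^ 3 + a₁ * z ^ 2 + b * z + 1) := by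
      linear_combination -(2 * (t + 1) * r * z + (t + 1)) * hr - r ^ 2 * z ^ 2 * ha₁
        - 2 * (t + 1) * r * z * hb
    have i2 : (1 + r * z) ^ 2 * (r ^ 2 + z) = r ^ 2 * (z ^ 3 + a₂ * z ^ 2 + b * z + 1) := by
      linear_combination -r * z ^ 2 * ha₂ - z * hb
    have i3 : (t + 2 * (t + 1) * r * z) * (t + 1 + 2 * t * r * z) * (r ^ 2 + z) =
        2 * r ^ 5 * (4 * z ^ 3 + b ^ 2 * z ^ 2 + 2 * b * z + 1) := by
      linear_combination -(1 + 2 * r * z) ^ 2 * (r ^ 2 + z) * hr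
        - (4 * r ^ 3 * z + 2 * r * (r ^ 2 * b + 2 * r ^ 3 + 1) * z ^ 2) * hb
    have j1 : d * (1 * x + (t - 1)) = (t - 1) * (t + 2 * (t + 1) * r * z) := by
      linear_combination hxd + (t - 1) * hd
    have j2 : d * (-(3 * 1 + 2 * (t - 1)) * x + (2 * 1 + (t - 1))) =
        (2 * t + 1) * (2 * r * (r ^ 2 + z)) := by
      linear_combination -(2 * t + 1) * hxd + (t + 1) * hd - (2 * t + 1) * hr
    have j3 : d * (1 * x + (2 * 1 + (t - 1))) = (t + 2) * (t + 1 + 2 * t * r * z) * 1 := by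
      linear_combination hxd + (t + 1) * hd
    have k1 : d ^ 3 * (x ^ 2 * (1 * x + (t - 1))) =
        2 * r ^ 3 * ((t - 1) ^ 3 * (t + 1) * (z ^ 3 + a₁ * z ^ 2 + b * z + 1)) := by
      rw [show d ^ 3 * (x ^ 2 * (1 * x + (t - 1))) = (d * x) ^ 2 * (d * (1 * x + (t - 1))) by ring,
        j1, hxd]
      linear_combination (t - 1) ^ 3 * i1
    have k2 : d ^ 3 * (-(3 * 1 + 2 * (t - 1)) * x + (2 * 1 + (t - 1))) =
        2 * r ^ 3 * ((2 * t + 1) ^ 3 * (z ^ 3 + a₂ * z ^ 2 + b * z + 1)) := by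
      rw [pow_succ, mul_assoc, j2, hd]
      linear_combination 2 * r * (2 * t + 1) ^ 3 * i2
    have k3 : d ^ 3 * ((1 * x + (t - 1)) * (-(3 * 1 + 2 * (t - 1)) * x + (2 * 1 + (t - 1))) *
        (1 * x + (2 * 1 + (t - 1)))) = 4 * (2 * t + 1) * (t - 1) * (t + 2) * r ^ 6 *
          (4 * z ^ 3 + b ^ 2 * z ^ 2 + 2 * b * z + 1) := by
      rw [show ∀ u v w : k, d ^ 3 * (u * v * w) = d * u * (d * v) * (d * w) by intros; ring,
        j1, j2, j3]
      linear_combination 2 * (2 * t + 1) * (t - 1) * (t + 2) * r * i3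
    have k4 : d ^ 3 * (ρ * (x ^ 2 * (1 * x + (t - 1))) +
        σ * (-(3 * 1 + 2 * (t - 1)) * x + (2 * 1 + (t - 1)))) =
        2 * r ^ 3 * (l * (z ^ 3 + a * z ^ 2 + b * z + 1)) := by
      rw [mul_add, mul_left_comm, k1, mul_left_comm (d ^ 3) σ, k2]
      linear_combination -2 * r ^ 3 * z ^ 2 * ha - 2 * r ^ 3 * (z ^ 3 + b * z + 1) * hl
    have hs : (sextic a b).eval z = (z ^ 3 + a * z ^ 2 + b * z + 1) *
        (4 * z ^ 3 + b ^ 2 * z ^ 2 + 2 * b * z + 1) := by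
      simp [sextic, cubicF, cubicG]
    rw [hs, mul_left_comm, show ∀ u v : k, d ^ 6 * (u * v) = d ^ 3 * u * (d ^ 3 * v) by
      intros; ring, k3, k4, eq_inv_mul_iff_mul_eq₀ hκ0, hκ]
    ring

/-- Each of the four factors is homogeneous of degree 1 in `α, β`, so dividing by `α⁴` reduces to `α
= 1` and `t = 1 + β / α`. -/
theorem exists_sameInvariants_sextic {α β ρ σ : k} (h : α ≠ 0) (h0 : α + β ≠ 0)
    (h1 : 2 * α + β ≠ 0) (h2 : β ≠ 0) (h3 : 3 * α + β ≠ 0) (h4 : 3 * α + 2 * β ≠ 0)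
    (h5 : ρ * β ^ 3 * (2 * α + β) + σ * α * (3 * α + 2 * β) ^ 3 ≠ 0) :
    ∃ a b, SameInvariants (ramifiedSextic α β ρ σ) (sextic a b) := by
  obtain ⟨s, rfl⟩ : ∃ s, β = α * s := ⟨β / α, (mul_div_cancel₀ _ h).symm⟩
  obtain ⟨a, b, hs⟩ := exists_sameInvariants_sextic_one (t := 1 + s) (ρ := ρ) (σ := σ)
    (fun h' => h0 (by linear_combination α * h')) (fun h' => h1 (by linear_combination α * h'))
    (fun h' => h2 (by linear_combination α * h')) (fun h' => h3 (by linear_combination α * h'))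
    (fun h' => h4 (by linear_combination α * h'))
    (fun h' => h5 (by linear_combination α ^ 4 * h'))
  refine ⟨a, b, (sameInvariants_C_mul _ (pow_ne_zero 4 (inv_ne_zero h))).trans ?_⟩
  convert! hs using 1
  have e : C α⁻¹ * C α = 1 := by rw [← C_mul, inv_mul_cancel₀ h, C_1]
  rw [add_sub_cancel_left, ramifiedSextic, ramifiedSextic]
  have e1 : C (α * s) = C α * C s := C_mul
  have e2 : C (-(3 * α + 2 * (α * s))) = C α * C (-(3 * 1 + 2 * s)) := by rw [← C_mul]; congr 1; ring
  have e3 : C (2 * α + α * s) = C α * C (2 * 1 + s) := by rw [← C_mul]; congr 1; ring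
  rw [e1, e2, e3, C_pow, C_1]
  calc _ = (C α⁻¹ * C α) ^ 4 * ((C ρ * (X ^ 2 * (1 * X + C s)) + C σ * (C (-(3 * 1 + 2 * s)) * X +
      C (2 * 1 + s))) * ((1 * X + C s) * (C (-(3 * 1 + 2 * s)) * X + C (2 * 1 + s)) *
        (1 * X + C (2 * 1 + s)))) := by ring
    _ = _ := by rw [e, one_pow, one_mul]

end Generic

/-! ### Zariski density and conclusion -/

section Density
universe u
variable {k : Type u} [Field k] {n : ℕ}

/-- A function given by a polynomial. -/
def IsPolynomialFunction (φ : (Fin n → k) → k) : Prop :=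
  ∃ j : MvPolynomial (Fin n) k, ∀ p, φ p = MvPolynomial.eval p j

namespace IsPolynomialFunction
variable {φ ψ : (Fin n → k) → k}

theorem const (c : k) : IsPolynomialFunction fun _ : Fin n → k => c :=
  ⟨.C c, fun _ => (MvPolynomial.eval_C c).symm⟩

theorem add (h : IsPolynomialFunction φ) (h' : IsPolynomialFunction ψ) :
    IsPolynomialFunction fun p => φ p + ψ p := by
  obtain ⟨i, hi⟩ := h
  obtain ⟨j, hj⟩ := h'
  exact ⟨i + j, fun p => by simp only [hi, hj, map_add]⟩

theorem sub (h : IsPolynomialFunction φ) (h' : IsPolynomialFunction ψ) :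
    IsPolynomialFunction fun p => φ p - ψ p := by
  obtain ⟨i, hi⟩ := h
  obtain ⟨j, hj⟩ := h'
  exact ⟨i - j, fun p => by simp only [hi, hj, map_sub]⟩

theorem mul (h : IsPolynomialFunction φ) (h' : IsPolynomialFunction ψ) :
    IsPolynomialFunction fun p => φ p * ψ p := by
  obtain ⟨i, hi⟩ := h
  obtain ⟨j, hj⟩ := h'
  exact ⟨i * j, fun p => by simp only [hi, hj, map_mul]⟩

theorem pow (h : IsPolynomialFunction φ) (m : ℕ) : IsPolynomialFunction fun p => φ p ^ m := by
  obtain ⟨i, hi⟩ := h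
  exact ⟨i ^ m, fun p => by simp only [hi, map_pow]⟩

theorem coeff_map (F : (MvPolynomial (Fin n) k)[X]) (i : ℕ) :
    IsPolynomialFunction fun p => (F.map (MvPolynomial.eval p)).coeff i :=
  ⟨F.coeff i, fun _ => Polynomial.coeff_map _ _⟩

theorem J₂ (F : (MvPolynomial (Fin n) k)[X]) :
    IsPolynomialFunction fun p => J₂ (F.map (MvPolynomial.eval p)) := by
  unfold GenusTwo.J₂
  repeat' first
    | exact const _
    | exact coeff_map F _
    | apply add
    | apply sub
    | apply mul
    | apply pow

theorem J₄ (F : (MvPolynomial (Fin n) k)[X]) :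
    IsPolynomialFunction fun p => J₄ (F.map (MvPolynomial.eval p)) := by
  unfold GenusTwo.J₄
  repeat' first
    | exact const _
    | exact coeff_map F _
    | apply add
    | apply sub
    | apply mul
    | apply pow

theorem J₆ (F : (MvPolynomial (Fin n) k)[X]) :
    IsPolynomialFunction fun p => J₆ (F.map (MvPolynomial.eval p)) := by
  unfold GenusTwo.J₆
  repeat' first
    | exact const _
    | exact coeff_map F _
    | apply add
    | apply sub
    | apply mul
    | apply pow

theorem J₁₀ (F : (MvPolynomial (Fin n) k)[X]) :
    IsPolynomialFunction fun p => J₁₀ (F.map (MvPolynomial.eval p)) := by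
  refine ⟨-(resultant (derivative F) (6 * F - X * derivative F) 5 5) * .C (6 ^ 4)⁻¹, fun p => ?_⟩
  have h1 : 6 * F.map (MvPolynomial.eval p) - X * derivative (F.map (MvPolynomial.eval p)) =
      (6 * F - X * derivative F).map (MvPolynomial.eval p) := by simp [derivative_map]
  beta_reduce
  rw [map_mul, map_neg, GenusTwo.J₁₀, MvPolynomial.eval_C, div_eq_mul_inv, h1, derivative_map,
    resultant_map_map]

end IsPolynomialFunction

/-- A polynomial relation between the absolute invariants of an algebraic family of sextics holds
on the whole family if it holds generically. -/
theorem relation_of_generic [Infinite k] (F : (MvPolynomial (Fin n) k)[X])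
    {G : MvPolynomial (Fin n) k} (hG : G ≠ 0) (P : MvPolynomial (Fin 3) k)
    (h : ∀ p, MvPolynomial.eval p G ≠ 0 → J₂ (F.map (MvPolynomial.eval p)) ≠ 0 →
      MvPolynomial.eval (absTriple (F.map (MvPolynomial.eval p))) P = 0)
    (p : Fin n → k) (hp : J₂ (F.map (MvPolynomial.eval p)) ≠ 0) :
    MvPolynomial.eval (absTriple (F.map (MvPolynomial.eval p))) P = 0 := by
  obtain ⟨j₂, h2⟩ := IsPolynomialFunction.J₂ F
  obtain ⟨j₄, h4⟩ := IsPolynomialFunction.J₄ F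
  obtain ⟨j₆, h6⟩ := IsPolynomialFunction.J₆ F
  obtain ⟨j₁₀, h10⟩ := IsPolynomialFunction.J₁₀ F
  beta_reduce at h2 h4 h6 h10
  obtain ⟨M, Q, hQ⟩ := exists_clear_denominators
    ![144 * j₄ * j₂ ^ 3, -1728 * (j₂ * j₄ - 3 * j₆) * j₂ ^ 2, 486 * j₁₀] (j₂ ^ 5) P
  have key : ∀ p, MvPolynomial.eval p j₂ ≠ 0 →
      MvPolynomial.eval (absTriple (F.map (MvPolynomial.eval p))) P *
        (MvPolynomial.eval p j₂ ^ 5) ^ M = MvPolynomial.eval p Q := by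
    intro p hp
    have h1 := hQ k (MvPolynomial.aeval p) (by
      rw [map_pow, MvPolynomial.aeval_eq_eval]; exact pow_ne_zero 5 hp)
    simp only [MvPolynomial.aeval_eq_eval, map_pow] at h1
    rw [← h1]
    congr 3
    ext j
    fin_cases j
    · simp [absTriple, absInv₁, h2, h4]; field_simp
    · simp [absTriple, absInv₂, h2, h4, h6]; field_simp
    · simp [absTriple, absInv₃, h2, h10]
  have hj2 : MvPolynomial.eval p j₂ ≠ 0 := by rwa [h2] at hp
  -- The product vanishes at every point of the infinite field `k`; as `G` and `j₂` are nonzero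
  -- polynomials, `Q` itself must be zero.
  have hzero : Q * G * j₂ = 0 := by
    apply MvPolynomial.funext
    intro q
    rw [map_mul, map_mul, map_zero]
    by_cases hq : MvPolynomial.eval q j₂ = 0
    · rw [hq, mul_zero]
    by_cases hg : MvPolynomial.eval q G = 0
    · rw [hg, mul_zero, zero_mul]
    rw [← key q hq, h q hg (by rwa [h2]), zero_mul, zero_mul, zero_mul]
  have hQ0 : Q = 0 := by
    rcases mul_eq_zero.1 hzero with h1 | h1
    · exact (mul_eq_zero.1 h1).resolve_right hG
    · exact absurd (by rw [h1, map_zero]) hj2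
  have := key p hj2
  rw [hQ0, map_zero] at this
  exact (mul_eq_zero.1 this).resolve_right (pow_ne_zero M (pow_ne_zero 5 hj2))

/-- The sextic `F G` over a commutative ring. -/
noncomputable def sexticOver {R : Type*} [CommRing R] (a b : R) : R[X] :=
  (X ^ 3 + C a * X ^ 2 + C b * X + 1) * (C 4 * X ^ 3 + C (b ^ 2) * X ^ 2 + C (2 * b) * X + 1)

/-- The sextic `F G` over the polynomial ring in `a`, `b`. -/
noncomputable def universalSextic (k : Type u) [Field k] : (MvPolynomial (Fin 2) k)[X] :=
  sexticOver (.X 0) (.X 1)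

theorem universalSextic_map (p : Fin 2 → k) :
    (universalSextic k).map (MvPolynomial.eval p) = sextic (p 0) (p 1) := by
  simp [universalSextic, sexticOver, sextic, cubicF, cubicG]

/-- The `ramifiedSextic` over a commutative ring. -/
noncomputable def ramifiedSexticOver {R : Type*} [CommRing R] (α β ρ σ : R) : R[X] :=
  (C ρ * (X ^ 2 * (C α * X + C β)) + C σ * (C (-(3 * α + 2 * β)) * X + C (2 * α + β))) *
    ((C α * X + C β) * (C (-(3 * α + 2 * β)) * X + C (2 * α + β)) *
      (C α * X + C (2 * α + β)))

/-- The polynomial family of all `ramifiedSextic`s. -/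
noncomputable def universalRamifiedSextic (k : Type u) [Field k] : (MvPolynomial (Fin 4) k)[X] :=
  ramifiedSexticOver (.X 0) (.X 1) (.X 2) (.X 3)

theorem universalRamifiedSextic_map (p : Fin 4 → k) :
    (universalRamifiedSextic k).map (MvPolynomial.eval p) =
      ramifiedSextic (p 0) (p 1) (p 2) (p 3) := by
  simp [universalRamifiedSextic, ramifiedSexticOver, ramifiedSextic]

variable [CharZero k] [IsAlgClosed k]

/-- The open set `g ≠ 0` is pulled back along `(a, b) ↦ (r₁, r₂)`. The pullback is non-empty because
almost every `(r₁, r₂)` is attained, by `exists_pairInv_eq`. -/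
theorem exists_generic_pair {g : MvPolynomial (Fin 2) k} (hg : g ≠ 0) :
    ∃ G : MvPolynomial (Fin 2) k, G ≠ 0 ∧ ∀ p, MvPolynomial.eval p G ≠ 0 →
      p 1 ^ 3 - 2 * (p 0 * p 1) - 9 ≠ 0 ∧ p 1 ^ 3 - 27 ≠ 0 ∧ resFG (p 0) (p 1) ≠ 0 ∧
      MvPolynomial.eval ![pairInv₁ (cubicF (p 0) (p 1)) (cubicG (p 1)),
        pairInv₂ (cubicF (p 0) (p 1)) (cubicG (p 1))] g ≠ 0 := by
  obtain ⟨m, em⟩ : ∃ m : MvPolynomial (Fin 2) k, ∀ p, MvPolynomial.eval p m =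
      p 1 ^ 3 - 2 * (p 0 * p 1) - 9 :=
    ⟨.X 1 ^ 3 - 2 * (.X 0 * .X 1) - 9, fun p => by simp⟩
  obtain ⟨n, en⟩ : ∃ n : MvPolynomial (Fin 2) k, ∀ p, MvPolynomial.eval p n = p 1 ^ 3 - 27 :=
    ⟨.X 1 ^ 3 - 27, fun p => by simp⟩
  obtain ⟨R, eR⟩ : ∃ R : MvPolynomial (Fin 2) k, ∀ p, MvPolynomial.eval p R =
      resFG (p 0) (p 1) :=
    ⟨4 * .X 0 ^ 3 + 4 * .X 1 ^ 3 + 27 - 18 * .X 0 * .X 1 - .X 0 ^ 2 * .X 1 ^ 2, fun p => by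
      simp [resFG]⟩
  obtain ⟨B, eB⟩ : ∃ B : MvPolynomial (Fin 2) k, ∀ p, MvPolynomial.eval p B =
      p 0 * p 1 * (5 * p 0 + 432 * p 1) * (p 0 + 144 * p 1) :=
    ⟨.X 0 * .X 1 * (5 * .X 0 + 432 * .X 1) * (.X 0 + 144 * .X 1), fun p => by simp⟩
  obtain ⟨M, Q, hQ⟩ := exists_clear_denominators ![-48 * m ^ 3 * n, m ^ 4] (-1296 * R * n) g
  have key : ∀ p, MvPolynomial.eval p n ≠ 0 → MvPolynomial.eval p R ≠ 0 →
      MvPolynomial.eval ![pairInv₁ (cubicF (p 0) (p 1)) (cubicG (p 1)),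
        pairInv₂ (cubicF (p 0) (p 1)) (cubicG (p 1))] g *
        (-1296 * MvPolynomial.eval p R * MvPolynomial.eval p n) ^ M = MvPolynomial.eval p Q := by
    intro p hn hR
    have h1 := hQ k (MvPolynomial.aeval p) (by
      rw [MvPolynomial.aeval_eq_eval]
      simp [hn, hR])
    simp only [MvPolynomial.aeval_eq_eval, map_mul, map_neg, map_ofNat] at h1
    rw [← h1]
    congr 3
    ext j
    fin_cases j
    · simp only [pairInv₁_eq, ← eR, ← em]
      simp
      field_simp
      ring
    · simp only [pairInv₂_eq, ← eR, ← em, ← en]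
      simp
  have hB : B ≠ 0 := by
    rintro rfl
    have h1 := eB ![1, 1]
    simp at h1
    norm_num at h1
  obtain ⟨q, hq⟩ : ∃ q, MvPolynomial.eval q (g * B) ≠ 0 := by
    by_contra! h0
    exact mul_ne_zero hg hB (MvPolynomial.funext fun q => by rw [h0, map_zero])
  rw [map_mul, eB] at hq
  simp only [mul_ne_zero_iff] at hq
  obtain ⟨hgq, ⟨⟨h1, h2⟩, h3⟩, h4⟩ := hq
  obtain ⟨a', b', -, hm', hn', hR', e1, e2⟩ := exists_pairInv_eq h1 h2 h3 h4
  refine ⟨m * n * R * Q, ?_, ?_⟩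
  · intro h0
    have h5 := congrArg (MvPolynomial.eval ![a', b']) h0
    have hn'' : MvPolynomial.eval ![a', b'] n ≠ 0 := by rw [en]; exact hn'
    have hR'' : MvPolynomial.eval ![a', b'] R ≠ 0 := by rw [eR]; exact hR'
    have hm'' : MvPolynomial.eval ![a', b'] m ≠ 0 := by rw [em]; exact hm'
    have h6 := key ![a', b'] hn'' hR''
    simp only [Matrix.cons_val_zero, Matrix.cons_val_one, e1, e2] at h6
    rw [map_mul, map_mul, map_mul, map_zero, ← h6,
      show ![q 0, q 1] = q by ext i; fin_cases i <;> rfl] at h5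
    exact mul_ne_zero (mul_ne_zero (mul_ne_zero hm'' hn'') hR'') (mul_ne_zero hgq
      (pow_ne_zero M (mul_ne_zero (mul_ne_zero (by norm_num) hR'') hn''))) h5
  · intro p hp
    rw [map_mul, map_mul, map_mul] at hp
    have hQp := right_ne_zero_of_mul hp
    have hR := right_ne_zero_of_mul (left_ne_zero_of_mul hp)
    have hn := right_ne_zero_of_mul (left_ne_zero_of_mul (left_ne_zero_of_mul hp))
    have hm := left_ne_zero_of_mul (left_ne_zero_of_mul (left_ne_zero_of_mul hp))
    rw [← key p hn hR] at hQp
    exact ⟨em p ▸ hm, en p ▸ hn, eR p ▸ hR, left_ne_zero_of_mul hQp⟩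

/-- For generic `(a, b)` the triple of invariants is a value of `rho` at a point of the open set;
`relation_of_generic` extends the relation to special `(a, b)`. -/
theorem relation_sextic {g : MvPolynomial (Fin 2) k} (hg : g ≠ 0) (P : MvPolynomial (Fin 3) k)
    (h : ∀ p, MvPolynomial.eval p g ≠ 0 → MvPolynomial.eval (rho p) P = 0) (a b : k)
    (hJ : J₂ (sextic a b) ≠ 0) : MvPolynomial.eval (absTriple (sextic a b)) P = 0 := by
  obtain ⟨G, hG, hp⟩ := exists_generic_pair hg
  have := relation_of_generic (universalSextic k) hG P (by
    intro p hp' hJp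
    obtain ⟨hm, hn, hR, hgp⟩ := hp p hp'
    rw [universalSextic_map] at hJp ⊢
    rw [absTriple, rho₁_sextic _ _ hJp hm hn hR, rho₂_sextic _ _ hJp hm hn hR,
      rho₃_sextic _ _ hJp hm hn hR]
    have := h _ hgp
    rwa [rho, Matrix.cons_val_zero, Matrix.cons_val_one, Matrix.cons_val_zero] at this) ![a, b]
    (by rw [universalSextic_map]; exact hJ)
  rwa [universalSextic_map] at this

/-- The degenerate members, which need not be equivalent to any `F G`, are reached by specialization
within the family over affine 4-space. -/
theorem relation_ramifiedSextic {P : MvPolynomial (Fin 3) k}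
    (h : ∀ a b, J₂ (sextic a b) ≠ 0 → MvPolynomial.eval (absTriple (sextic a b)) P = 0)
    (α β ρ σ : k) (hJ : J₂ (ramifiedSextic α β ρ σ) ≠ 0) :
    MvPolynomial.eval (absTriple (ramifiedSextic α β ρ σ)) P = 0 := by
  let x : MvPolynomial (Fin 4) k := .X 0
  let y : MvPolynomial (Fin 4) k := .X 1
  let z : MvPolynomial (Fin 4) k := .X 2
  let w : MvPolynomial (Fin 4) k := .X 3
  let G := x * (x + y) * (2 * x + y) * y * (3 * x + y) * (3 * x + 2 * y) *
    (z * y ^ 3 * (2 * x + y) + w * x * (3 * x + 2 * y) ^ 3)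
  have eG : ∀ p, MvPolynomial.eval p G = p 0 * (p 0 + p 1) * (2 * p 0 + p 1) * p 1 *
      (3 * p 0 + p 1) * (3 * p 0 + 2 * p 1) *
      (p 2 * p 1 ^ 3 * (2 * p 0 + p 1) + p 3 * p 0 * (3 * p 0 + 2 * p 1) ^ 3) := by
    intro p; simp [G, x, y, z, w]
  have hG : G ≠ 0 := by
    intro h0
    have h1 := eG ![1, 1, 1, 1]
    rw [h0, map_zero] at h1
    simp at h1
    norm_num at h1
  have := relation_of_generic (universalRamifiedSextic k) hG P (by
    intro p hp hJp
    rw [universalRamifiedSextic_map] at hJp ⊢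
    rw [eG] at hp
    simp only [mul_ne_zero_iff] at hp
    obtain ⟨⟨⟨⟨⟨⟨h0, h1⟩, h2⟩, h3⟩, h4⟩, h5⟩, h6⟩ := hp
    obtain ⟨a, b, hs⟩ := exists_sameInvariants_sextic h0 h1 h2 h3 h4 h5 h6
    rw [hs.2]
    exact h a b (hs.1 hJp)) ![α, β, ρ, σ] (by rw [universalRamifiedSextic_map]; exact hJ)
  rwa [universalRamifiedSextic_map] at this

/-- The image of `rho` is Zariski dense in the locus. -/
theorem relation_locusL₃ {P : MvPolynomial (Fin 3) k}
    (h : ∀ a b, J₂ (sextic a b) ≠ 0 → MvPolynomial.eval (absTriple (sextic a b)) P = 0)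
    {q : Fin 3 → k} (hq : q ∈ locusL₃ k) : MvPolynomial.eval q P = 0 := by
  obtain ⟨K, _, _, f, x, y, hK, hE, hJ, rfl⟩ := hq
  obtain ⟨A, B, S, e₁, e₂, e₃, hAB, hdeg, hS, h12, h13, h23, hf⟩ := hK.exists_cubic_cover hE
  obtain ⟨f', A', B', S', hs, hf', hAB', hS', d0, d1, d2, d3, hf''⟩ :=
    exists_general_position hK.natDegree_eq hAB hdeg hS hf
  obtain ⟨α, β, ρ, σ, hs'⟩ := exists_sameInvariants_ramifiedSextic h12 h13 h23 hf' hAB' hS'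
    d0 d1 d2 d3 hf''
  have hss := hs.trans hs'
  change MvPolynomial.eval (absTriple f) P = 0
  rw [hss.2]
  exact relation_ramifiedSextic h α β ρ σ (hss.1 hJ)

variable (k) in
theorem isBirationalParameterization_rho :
    IsBirationalParameterization (rho : (Fin 2 → k) → (Fin 3 → k)) (locusL₃ k) := by
  obtain ⟨g₀, hg₀, hmem⟩ := exists_rho_mem_locusL₃ k
  obtain ⟨g₁, hg₁, A, B, hAB⟩ := exists_rho_inverse (k := k)
  obtain ⟨N, D, hD, hND⟩ := exists_rho_fractions k
  have hg : g₀ * g₁ * D ≠ 0 := mul_ne_zero (mul_ne_zero hg₀ hg₁) hD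
  have hne : ∀ p, MvPolynomial.eval p (g₀ * g₁ * D) ≠ 0 → MvPolynomial.eval p g₀ ≠ 0 ∧
      MvPolynomial.eval p g₁ ≠ 0 ∧ MvPolynomial.eval p D ≠ 0 := by
    intro p hp
    rw [map_mul, map_mul] at hp
    exact ⟨left_ne_zero_of_mul (left_ne_zero_of_mul hp),
      right_ne_zero_of_mul (left_ne_zero_of_mul hp), right_ne_zero_of_mul hp⟩
  refine ⟨g₀ * g₁ * D, hg, ⟨N, fun _ => D, fun p hp j => ⟨(hne p hp).2.2, ?_⟩⟩,
    fun p hp => hmem p (hne p hp).1, fun P hP q hq =>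
      relation_locusL₃ (fun a b hJ => relation_sextic hg P hP a b hJ) hq,
    A, B, fun p hp j => hAB p (hne p hp).2.1 j⟩
  have h1 := (hND k (MvPolynomial.aeval p) (by
    rw [MvPolynomial.aeval_eq_eval]; exact (hne p hp).2.2)).2.2 j
  simp only [MvPolynomial.aeval_eq_eval, MvPolynomial.eval_X] at h1
  exact h1

end Density
theorem lemma7 {k : Type*} [Field k] [IsAlgClosed k] [CharZero k]
    {L : Type*} [Field L] [Algebra k L] (a b : L) (hab : AlgebraicIndependent k ![a, b])
    (u v : L) (hu : u = a * b) (hv : v = b ^ 3)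
    (i₁ i₂ i₃ r₁ r₂ : L)
    (hi₁ : i₁ = absInv₁ (sextic a b)) (hi₂ : i₂ = absInv₂ (sextic a b))
    (hi₃ : i₃ = absInv₃ (sextic a b))
    (hr₁ : r₁ = pairInv₁ (cubicF a b) (cubicG b))
    (hr₂ : r₂ = pairInv₂ (cubicF a b) (cubicG b)) :
    -- all the quotients involved have nonzero denominators
    (J₂ (sextic a b) ≠ 0 ∧ cubicR (cubicF a b) (cubicG b) ≠ 0 ∧
      (cubicF a b).discr ≠ 0 ∧ (cubicG b).discr ≠ 0 ∧
      r₁ ≠ 0 ∧ rhoDen r₁ r₂ ≠ 0 ∧ v - 27 ≠ 0 ∧ betaDen u v ≠ 0) ∧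
    -- the two fields coincide
    fieldI k a b = fieldR k a b ∧
    -- the formulas
    i₁ = rho₁ r₁ r₂ ∧ i₂ = rho₂ r₁ r₂ ∧ i₃ = rho₃ r₁ r₂ ∧
    -- `k(u, v)` is Galois of degree 2 over `k(i₁, i₂, i₃)`, with group generated by `β`
    (∃ h : fieldI k a b ≤ fieldUV k a b,
      Module.finrank (fieldI k a b) (IntermediateField.extendScalars h) = 2 ∧
      IsGalois (fieldI k a b) (IntermediateField.extendScalars h) ∧
      ∃ β : IntermediateField.extendScalars h ≃ₐ[fieldI k a b] IntermediateField.extendScalars h,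
        (β ⟨a * b, u_mem k a b⟩ : L) = betaU u v ∧
        (β ⟨b ^ 3, v_mem k a b⟩ : L) = betaV u v ∧
        orderOf β = 2 ∧ Subgroup.zpowers β = ⊤) ∧
    -- `r₁, r₂` are independent parameters, and they parameterize the locus birationally
    AlgebraicIndependent k ![r₁, r₂] ∧
    IsBirationalParameterization (rho : (Fin 2 → k) → (Fin 3 → k)) (locusL₃ k) := by
  have : CharZero L := charZero_of_injective_algebraMap (algebraMap k L).injective
  obtain ⟨hb, hm, hn, hR, hJ⟩ := generic_pair_ne_zero hab
  obtain ⟨h1, h2, h3⟩ := absInv_sextic hab r₁ r₂ hr₁ hr₂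
  have hind := algebraicIndependent_pairInv hab
  rw [← hr₁, ← hr₂] at hind
  obtain ⟨hr0, hd, -⟩ := mem_adjoin_rho hind
  subst hu hv
  refine ⟨⟨hJ, ?_, ?_, ?_, hr0, hd, hn, ?_⟩, fieldI_eq_fieldR hab, hi₁.trans h1, hi₂.trans h2,
    hi₃.trans h3, fieldUV_galois hab, hind, isBirationalParameterization_rho k⟩
  · rwa [cubicR_eq]
  · rw [discr_cubicF]; exact neg_ne_zero.2 hR
  · rw [discr_cubicG]; exact mul_ne_zero (by norm_num) hn
  · rw [betaDen_mul_pow]; exact mul_ne_zero (pow_ne_zero _ hb) hR
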